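/- **Setting.** Let $d\ge 3$, $T>0$, and let $\Omega\subset\mathbb R^d$ be compact with smooth boundary and outward unit normal $\nu$. Let $\rho\in C^\infty(\Omega)$ and $\mu,\lambda\in C^1(\Omega)$ be real with $\rho>0$, $\mu>0$ and $d\lambda+2\mu>0$ on $\Omega$. For a vector field $w$ write $(\nabla w)_{ij}=\partial_{x_j}w_i$ and $T_\nu w=\mu\,\partial_\nu w+\mu(\nabla w)^\top\nu+\lambda(\nabla\cdot w)\nu$ on $\partial\Omega$. All pairings are bilinear (no complex conjugation): $$(u,v)_{L^2(\Omega;\rho\,dx)}=\int_\Omega (u\cdot v)\,\rho\,dx,\qquad \langle f,h\rangle=\int_0^T\!\!\int_{\partial\Omega} f\cdot h\,dS\,dt .$$ Let $C_0^\infty((0,T)\times\partial\Omega)$ be the space of $\mathbb C^d$-valued functions $f$ that are smooth on $[0,T]\times\partial\Omega$ and satisfy $f(0,\cdot)=0$. For such $f$, $u_f\in C([0,T];H^1(\Omega))\cap C^1([0,T];L^2(\Omega))$ denotes the finite-energy weak solution of $$\rho\,\partial_t^2u=\nabla\cdot\big(\mu(\nabla u+\nabla u^\top)\big)+\nabla(\lambda\nabla\cdot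 u)\ \text{in }(0,T)\times\Omega,\qquad u(0)=\partial_tu(0)=0,\qquad u=f\ \text{on }(0,T)\times\partial\Omega,$$ and $\Lambda_{\rho,T}f=T_\nu u_f\in L^2((0,T)\times\partial\Omega)^d$ is its surface traction, understood as the weak conormal derivative given by Green's formula. Thus $\Lambda_{\rho,T}$ is a linear operator, with values in $L^2((0,T)\times\partial\Omega)^d$, whose domain $D(\Lambda_{\rho,T})$ consists of all $f\in C_0^\infty((0,T)\times\partial\Omega)$ that have such a solution with traction in $L^2$. Its adjoint $\Lambda_{\rho,T}^*$ with respect to $\langle\cdot,\cdot\rangle$ maps $h\in L^2((0,T)\times\partial\Omega)^d$ to the linear functional $\langle f,\Lambda_{\rho,T}^*h\rangle=\langle\Lambda_{\rho,T}f,h\rangle$ on $D(\Lambda_{\rho,T})$; here $\langle f,\cdot\rangle$ is the duality pairing extending the $L^2$ pairing. Let $(\mathscr I h)(t,\cdot)=\int_t^T h(s,\cdot)\,ds$, $T_0\phi=\phi|_{\partial\Omega}$ and $T_1\phi=T_\nu\phi|_{\partial\Omega}$ (regarded as constant in time), and $$\mathcal K(\Lambda_{\rho,T})=\Lambda_{\rho,T}^*\,\mathscr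 I\,T_0-\mathscr I\,T_1 .$$ **Theorem (modified Blagoveščenskiĭ identity).** Let $\xi,\eta\in\mathbb R^d$ with $|\xi|=|\eta|$, $\theta=(\xi+\mathrm i\eta)/2$, and let $0\ne\iota\in\mathbb C^d$ be such that, on $\Omega$, $$\mathrm i(\theta\,\iota^\top+\iota\,\theta^\top)\nabla\mu+\mathrm i(\iota\cdot\theta)\nabla\lambda-\mu(\theta\cdot\theta)\iota-(\lambda+\mu)(\iota\cdot\theta)\theta=0 .$$ Put $\phi(x)=\iota\,e^{\mathrm i\theta\cdot x}$. Let $f\in C_0^\infty((0,T)\times\partial\Omega)$ and let $u_f$ be a finite-energy solution with boundary values $f$ and surface traction in $L^2((0,T)\times\partial\Omega)^d$. Then $f\in D(\Lambda_{\rho,T})$ and $$(u_f(T),\phi)_{L^2(\Omega;\rho\,dx)}=\langle f,\ \mathcal K(\Lambda_{\rho,T})\phi\rangle .$$ -/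

import Mathlib

open MeasureTheory Set Filter Topology
open scoped ContDiff

noncomputable section

namespace ElasticWave

/-- The physical space `ℝᵈ`. -/
abbrev Pt (d : ℕ) := EuclideanSpace ℝ (Fin d)

/-- The space `ℂᵈ` of values of displacement fields. -/
abbrev Vec (d : ℕ) := EuclideanSpace ℂ (Fin d)

/-- The bilinear (not sesquilinear) product `a · b = ∑ aᵢ bᵢ` on `ℂᵈ`. -/
def dotc {d : ℕ} (a b : Vec d) : ℂ := ∑ i, a i * b i

/-- The partial derivative `∂ⱼ w` of a vector field. -/
def pderiv {d : ℕ} (j : Fin d) (w : Pt d → Vec d) (x : Pt d) : Vec d :=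
  fderiv ℝ w x (EuclideanSpace.single j 1)

/-- A compact domain with smooth boundary, given by a smooth defining function `r`:
the domain is `{r ≤ 0}`, and `r` has no critical point on its zero set. -/
structure SmoothDomain (d : ℕ) where
  r : Pt d → ℝ
  smooth : ContDiff ℝ ∞ r
  compact : IsCompact {x | r x ≤ 0}
  regular : ∀ x, r x = 0 → gradient r x ≠ 0

namespace SmoothDomain

variable {d : ℕ} (D : SmoothDomain d)

/-- The compact set `Ω`. -/
def Om : Set (Pt d) := {x | D.r x ≤ 0}

/-- The boundary `∂Ω`. -/
def bdry : Set (Pt d) := frontier D.Om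

/-- The outward unit normal (meaningful on the boundary). -/
def normal (x : Pt d) : Pt d := ‖gradient D.r x‖⁻¹ • gradient D.r x

/-- Lebesgue measure on `Ω`. -/
def vol : Measure (Pt d) := volume.restrict D.Om

/-- The surface measure `dS` on `∂Ω`: the `(d-1)`-dimensional Hausdorff measure, normalised so as
to agree with Lebesgue measure on hyperplanes. -/
def surf : Measure (Pt d) := (μHE[d - 1] : Measure (Pt d)).restrict D.bdry

/-- The measure `dt dS` on the lateral boundary `(0,T) × ∂Ω`. -/
def lat (T : ℝ) : Measure (ℝ × Pt d) := (volume.restrict (Ioo 0 T)).prod D.surf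

/-- `L²(Ω)ᵈ`. -/
abbrev L2Om := Lp (Vec d) 2 D.vol

/-- `L²(∂Ω)ᵈ`. -/
abbrev L2bdry := Lp (Vec d) 2 D.surf

/-- `L²((0,T) × ∂Ω)ᵈ`. -/
abbrev L2lat (T : ℝ) := Lp (Vec d) 2 (D.lat T)

theorem isCompact_Om : IsCompact D.Om := D.compact

theorem isCompact_bdry : IsCompact D.bdry :=
  D.isCompact_Om.of_isClosed_subset isClosed_frontier D.isCompact_Om.isClosed.frontier_subset

theorem bdry_subset : D.bdry ⊆ D.Om := D.isCompact_Om.isClosed.frontier_subset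

theorem r_eq_zero {x : Pt d} (hx : x ∈ D.bdry) : D.r x = 0 :=
  frontier_le_subset_eq D.smooth.continuous continuous_const hx

theorem surf_finite_near {x : Pt d} (hx : x ∈ D.bdry) :
    (μHE[d - 1] : Measure (Pt d)).FiniteAtFilter (𝓝[D.bdry] x) := by
  have h0 := D.r_eq_zero hx
  have hs : HasStrictFDerivAt D.r (fderiv ℝ D.r x) x :=
    D.smooth.contDiffAt.hasStrictFDerivAt (by simp)
  set f' := fderiv ℝ D.r x with hf'
  have hne : (f' : Pt d →ₗ[ℝ] ℝ) ≠ 0 := by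
    intro h
    apply D.regular x h0
    have : f' = 0 := by
      ext v
      exact congrArg (fun L => L v) h
    simp [gradient, ← hf', this]
  have hsurj : (f' : Pt d →ₗ[ℝ] ℝ).range = ⊤ :=
    LinearMap.range_eq_top.2 (LinearMap.surjective hne)
  have hdim : Module.finrank ℝ (f' : Pt d →ₗ[ℝ] ℝ).ker = d - 1 := by
    have := (f' : Pt d →ₗ[ℝ] ℝ).finrank_range_add_finrank_ker
    rw [hsurj] at this
    simp at this
    omega
  obtain ⟨K, s, hs0, hK⟩ := (hs.to_implicitFunction hsurj).exists_lipschitzOnWith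
  set e := hs.implicitToOpenPartialHomeomorph D.r f' hsurj with he
  set s' := s ∩ Metric.ball 0 1 with hs'
  have hs'0 : s' ∈ 𝓝 (0 : (f' : Pt d →ₗ[ℝ] ℝ).ker) := inter_mem hs0 (Metric.ball_mem_nhds _ one_pos)
  have hcont : ContinuousAt (fun y => (e y).2) x :=
    (e.continuousAt (hs.mem_implicitToOpenPartialHomeomorph_source hsurj)).snd
  have hex : (e x).2 = 0 := by
    rw [he, hs.implicitToOpenPartialHomeomorph_self hsurj]
  have hev : ∀ᶠ y in 𝓝 x, (e y).2 ∈ s' := by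
    have h : s' ∈ 𝓝 ((e x).2) := by rw [hex]; exact hs'0
    exact hcont h
  have hev2 := hs.eq_implicitFunction hsurj
  refine ⟨hs.implicitFunction D.r f' hsurj (D.r x) '' s', ?_, ?_⟩
  · filter_upwards [nhdsWithin_le_nhds hev, nhdsWithin_le_nhds hev2, self_mem_nhdsWithin]
      with y h1 h2 h3
    refine ⟨(e y).2, h1, ?_⟩
    rw [h0, ← D.r_eq_zero h3]
    exact h2
  · rw [Measure.euclideanHausdorffMeasure_def]
    rw [Measure.smul_apply]
    refine ENNReal.mul_lt_top ENNReal.coe_lt_top ?_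
    refine lt_of_le_of_lt ((hK.mono inter_subset_left).hausdorffMeasure_image_le
      (Nat.cast_nonneg _)) ?_
    refine ENNReal.mul_lt_top (by simp) ?_
    rw [← hdim]
    exact (Metric.isBounded_ball.subset inter_subset_right).measure_lt_top

instance : IsFiniteMeasure D.surf :=
  ⟨by
    rw [surf, Measure.restrict_apply_univ]
    exact D.isCompact_bdry.measure_lt_top_of_nhdsWithin fun x hx => D.surf_finite_near hx⟩

instance : IsFiniteMeasure D.vol :=
  ⟨by
    rw [vol, Measure.restrict_apply_univ]
    exact D.isCompact_Om.measure_lt_top⟩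

instance (T : ℝ) : IsFiniteMeasure (D.lat T) := by
  unfold lat; infer_instance


theorem ae_vol_mem : ∀ᵐ x ∂D.vol, x ∈ D.Om :=
  ae_restrict_mem D.isCompact_Om.isClosed.measurableSet

theorem memLp_vol {w : Pt d → Vec d} (hw : ContinuousOn w D.Om) : MemLp w 2 D.vol := by
  obtain ⟨C, hC⟩ := D.isCompact_Om.exists_bound_of_continuousOn hw
  refine MemLp.of_bound (hw.aestronglyMeasurable D.isCompact_Om.isClosed.measurableSet) C ?_
  filter_upwards [D.ae_vol_mem] with x hx using hC x hx

theorem memLp_surf {w : Pt d → Vec d} (hw : ContinuousOn w D.bdry) : MemLp w 2 D.surf := by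
  obtain ⟨C, hC⟩ := D.isCompact_bdry.exists_bound_of_continuousOn hw
  refine MemLp.of_bound (hw.aestronglyMeasurable isClosed_frontier.measurableSet) C ?_
  filter_upwards [ae_restrict_mem (isClosed_frontier (s := D.Om)).measurableSet] with x hx
    using hC x hx

theorem lat_eq (T : ℝ) : D.lat T =
    ((volume : Measure ℝ).prod ((μHE[d - 1] : Measure (Pt d)).restrict D.bdry)).restrict
      (Ioo 0 T ×ˢ D.bdry) := by
  have : IsFiniteMeasure ((μHE[d - 1] : Measure (Pt d)).restrict D.bdry) :=
    inferInstanceAs (IsFiniteMeasure D.surf)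
  have hm : MeasurableSet D.bdry := isClosed_frontier.measurableSet
  rw [← Measure.prod_restrict, Measure.restrict_restrict hm, inter_self]
  rfl

theorem ae_lat_mem (T : ℝ) : ∀ᵐ p ∂D.lat T, p ∈ Ioo 0 T ×ˢ D.bdry := by
  rw [lat_eq]
  exact ae_restrict_mem (measurableSet_Ioo.prod isClosed_frontier.measurableSet)

theorem memLp_lat {T : ℝ} {f : ℝ × Pt d → Vec d}
    (hf : ContinuousOn f (Icc 0 T ×ˢ D.bdry)) : MemLp f 2 (D.lat T) := by
  obtain ⟨C, hC⟩ := (isCompact_Icc.prod D.isCompact_bdry).exists_bound_of_continuousOn hf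
  have hsub : Ioo 0 T ×ˢ D.bdry ⊆ Icc 0 T ×ˢ D.bdry := prod_mono Ioo_subset_Icc_self subset_rfl
  refine MemLp.of_bound ?_ C ?_
  · rw [lat_eq]
    exact (hf.mono hsub).aestronglyMeasurable
      (measurableSet_Ioo.prod isClosed_frontier.measurableSet)
  · filter_upwards [D.ae_lat_mem T] with x hx using hC x (hsub hx)

theorem continuousOn_normal : ContinuousOn D.normal D.bdry := by
  have h : Continuous (gradient D.r) := by
    unfold gradient
    exact (LinearIsometryEquiv.continuous _).comp (D.smooth.continuous_fderiv (by simp))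
  refine ContinuousOn.smul (ContinuousOn.inv₀ h.norm.continuousOn ?_) h.continuousOn
  intro x hx
  exact norm_ne_zero_iff.2 (D.regular x (D.r_eq_zero hx))

end SmoothDomain

section Fields

variable {d : ℕ}

theorem continuous_pderiv {w : Pt d → Vec d} (hw : ContDiff ℝ ∞ w) (j : Fin d) :
    Continuous (pderiv j w) :=
  (hw.continuous_fderiv (by simp)).clm_apply continuous_const

theorem pderiv_add {v w : Pt d → Vec d} (hv : ContDiff ℝ ∞ v) (hw : ContDiff ℝ ∞ w) (j : Fin d) :
    pderiv j (v + w) = pderiv j v + pderiv j w := by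
  ext1 x
  simp [pderiv, fderiv_add ((hv.differentiable (by simp)) x) ((hw.differentiable (by simp)) x)]

theorem pderiv_smul {w : Pt d → Vec d} (hw : ContDiff ℝ ∞ w) (c : ℂ) (j : Fin d) :
    pderiv j (c • w) = c • pderiv j w := by
  ext1 x
  simp [pderiv, fderiv_const_smul ((hw.differentiable (by simp)) x) c]

/-- The space `C^∞(ℝᵈ)ᵈ`; its elements restrict to the elements of `C^∞(Ω)ᵈ`. -/
def smoothFields (d : ℕ) : Submodule ℂ (Pt d → Vec d) where
  carrier := {w | ContDiff ℝ ∞ w}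
  add_mem' := by
    intro v w hv hw
    have hv' : ContDiff ℝ ∞ v := hv
    exact hv'.add hw
  zero_mem' := (contDiff_const : ContDiff ℝ ∞ fun _ : Pt d => (0 : Vec d))
  smul_mem' := by
    intro c w hw
    have hw' : ContDiff ℝ ∞ w := hw
    exact hw'.const_smul c

theorem smoothFields_contDiff (w : smoothFields d) : ContDiff ℝ ∞ (w : Pt d → Vec d) := w.2

end Fields

namespace SmoothDomain

variable {d : ℕ} (D : SmoothDomain d)

/-- The map sending a smooth field `w` to the triple `(w|_Ω, (∂ⱼw|_Ω)ⱼ, w|_{∂Ω})`. -/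
def jet : smoothFields d →ₗ[ℂ] D.L2Om × (Fin d → D.L2Om) × D.L2bdry where
  toFun w :=
    ((D.memLp_vol (smoothFields_contDiff w).continuous.continuousOn).toLp,
      fun j => (D.memLp_vol (continuous_pderiv w.2 j).continuousOn).toLp,
      (D.memLp_surf (smoothFields_contDiff w).continuous.continuousOn).toLp)
  map_add' v w := by
    refine Prod.ext ?_ (Prod.ext ?_ ?_)
    · exact MemLp.toLp_add (D.memLp_vol (smoothFields_contDiff v).continuous.continuousOn)
        (D.memLp_vol (smoothFields_contDiff w).continuous.continuousOn)
    · funext j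
      exact (MemLp.toLp_congr (D.memLp_vol (continuous_pderiv (v + w).2 j).continuousOn) _
        (by rw [← pderiv_add v.2 w.2]; rfl)).trans (MemLp.toLp_add
        (D.memLp_vol (continuous_pderiv v.2 j).continuousOn)
        (D.memLp_vol (continuous_pderiv w.2 j).continuousOn))
    · exact MemLp.toLp_add (D.memLp_surf (smoothFields_contDiff v).continuous.continuousOn)
        (D.memLp_surf (smoothFields_contDiff w).continuous.continuousOn)
  map_smul' c w := by
    refine Prod.ext ?_ (Prod.ext ?_ ?_)
    · exact MemLp.toLp_const_smul c (D.memLp_vol (smoothFields_contDiff w).continuous.continuousOn)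
    · funext j
      exact (MemLp.toLp_congr (D.memLp_vol (continuous_pderiv (c • w).2 j).continuousOn) _
        (by rw [← pderiv_smul w.2]; rfl)).trans
        (MemLp.toLp_const_smul c (D.memLp_vol (continuous_pderiv w.2 j).continuousOn))
    · exact MemLp.toLp_const_smul c (D.memLp_surf (smoothFields_contDiff w).continuous.continuousOn)

/-- The Sobolev space `H¹(Ω)ᵈ` as the completion of the smooth fields on `Ω` in the `H¹`-norm,
with gradient and boundary trace obtained by continuous extension: `(u, (Gⱼ)ⱼ, g)` belongs to
this space iff `u ∈ H¹(Ω)ᵈ`, `∂ⱼu = Gⱼ` and `u|_{∂Ω} = g`. -/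
def H1Trace : Submodule ℂ (D.L2Om × (Fin d → D.L2Om) × D.L2bdry) :=
  (LinearMap.range D.jet).topologicalClosure

end SmoothDomain

/-- A compact domain with smooth boundary together with a density `ρ` and Lamé parameters `μ, λ`
satisfying the standing assumptions (by compactness, positivity of the continuous functions on `Ω`
gives the uniform bounds). -/
structure ElasticMedium (d : ℕ) extends SmoothDomain d where
  rho : Pt d → ℝ
  mu : Pt d → ℝ
  lam : Pt d → ℝ
  rho_smooth : ContDiffOn ℝ ∞ rho toSmoothDomain.Om
  mu_smooth : ContDiffOn ℝ 1 mu toSmoothDomain.Om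
  lam_smooth : ContDiffOn ℝ 1 lam toSmoothDomain.Om
  rho_pos : ∀ x ∈ toSmoothDomain.Om, 0 < rho x
  mu_pos : ∀ x ∈ toSmoothDomain.Om, 0 < mu x
  elliptic : ∀ x ∈ toSmoothDomain.Om, 0 < d * lam x + 2 * mu x

/-- The space `C₀^∞((0,T) × ∂Ω)ᵈ` of boundary data: functions on the lateral boundary that are
smooth up to the end times (restrictions of smooth functions on space-time) and satisfy
`f(0,x) = 0`. Only the values on `[0,T] × ∂Ω` matter. -/
def boundaryData {d : ℕ} (D : SmoothDomain d) (T : ℝ) : Submodule ℂ (ℝ × Pt d → Vec d) where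
  carrier := {f | (∃ F : ℝ × Pt d → Vec d, ContDiff ℝ ∞ F ∧ EqOn f F (Icc 0 T ×ˢ D.bdry)) ∧
    ∀ x ∈ D.bdry, f (0, x) = 0}
  add_mem' := by
    rintro f g ⟨⟨F, hF, hfF⟩, hf⟩ ⟨⟨G, hG, hgG⟩, hg⟩
    refine ⟨⟨F + G, hF.add hG, fun p hp => ?_⟩, fun x hx => ?_⟩
    · simp [hfF hp, hgG hp]
    · simp [hf x hx, hg x hx]
  zero_mem' := ⟨⟨0, contDiff_const, fun _ _ => rfl⟩, fun _ _ => rfl⟩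
  smul_mem' := by
    rintro c f ⟨⟨F, hF, hfF⟩, hf⟩
    refine ⟨⟨c • F, hF.const_smul c, fun p hp => ?_⟩, fun x hx => ?_⟩
    · simp [hfF hp]
    · simp [hf x hx]

theorem boundaryData_continuousOn {d : ℕ} {D : SmoothDomain d} {T : ℝ}
    {f : ℝ × Pt d → Vec d} (hf : f ∈ boundaryData D T) : ContinuousOn f (Icc 0 T ×ˢ D.bdry) := by
  obtain ⟨⟨F, hF, hfF⟩, -⟩ := hf
  exact hF.continuous.continuousOn.congr hfF

/-- The inclusion `C₀^∞((0,T) × ∂Ω)ᵈ → L²((0,T) × ∂Ω)ᵈ`. -/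
def dataToL2 {d : ℕ} (D : SmoothDomain d) (T : ℝ) : boundaryData D T →ₗ[ℂ] D.L2lat T where
  toFun f := (D.memLp_lat (boundaryData_continuousOn f.2)).toLp
  map_add' _ _ := MemLp.toLp_add _ _
  map_smul' _ _ := MemLp.toLp_const_smul _ _

theorem dotc_add_left {d : ℕ} (a b c : Vec d) : dotc (a + b) c = dotc a c + dotc b c := by
  simp [dotc, add_mul, Finset.sum_add_distrib]

theorem dotc_add_right {d : ℕ} (a b c : Vec d) : dotc a (b + c) = dotc a b + dotc a c := by
  simp [dotc, mul_add, Finset.sum_add_distrib]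

theorem dotc_smul_left {d : ℕ} (c : ℂ) (a b : Vec d) : dotc (c • a) b = c * dotc a b := by
  simp [dotc, mul_assoc, Finset.mul_sum]

theorem dotc_smul_right {d : ℕ} (c : ℂ) (a b : Vec d) : dotc a (c • b) = c * dotc a b := by
  simp [dotc, mul_left_comm, Finset.mul_sum]

theorem integrable_dotc {α : Type*} [MeasurableSpace α] {m : Measure α} {d : ℕ} {f g : α → Vec d}
    (hf : MemLp f 2 m) (hg : MemLp g 2 m) : Integrable (fun x => dotc (f x) (g x)) m := by
  have hc : ∀ i : Fin d, ∀ {h : α → Vec d}, MemLp h 2 m → MemLp (fun x => h x i) 2 m := by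
    intro i h hh
    exact (EuclideanSpace.proj (𝕜 := ℂ) i).comp_memLp' hh
  exact integrable_finsetSum _ fun i _ => (hc i hf).integrable_mul (hc i hg)

/-- The bilinear pairing `⟨f, h⟩ = ∫ f · h` on `L²`. -/
def pairL2 {α : Type*} [MeasurableSpace α] (m : Measure α) (d : ℕ) :
    Lp (Vec d) 2 m →ₗ[ℂ] Lp (Vec d) 2 m →ₗ[ℂ] ℂ :=
  LinearMap.mk₂ ℂ (fun f h => ∫ x, dotc (f x) (h x) ∂m)
    (by
      intro f g h
      rw [← integral_add (integrable_dotc (Lp.memLp f) (Lp.memLp h))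
        (integrable_dotc (Lp.memLp g) (Lp.memLp h))]
      refine integral_congr_ae ?_
      filter_upwards [Lp.coeFn_add f g] with x hx
      rw [hx, Pi.add_apply, dotc_add_left])
    (by
      intro c f h
      rw [smul_eq_mul, ← integral_const_mul]
      refine integral_congr_ae ?_
      filter_upwards [Lp.coeFn_smul c f] with x hx
      rw [hx, Pi.smul_apply, dotc_smul_left])
    (by
      intro f g h
      rw [← integral_add (integrable_dotc (Lp.memLp f) (Lp.memLp g))
        (integrable_dotc (Lp.memLp f) (Lp.memLp h))]
      refine integral_congr_ae ?_
      filter_upwards [Lp.coeFn_add g h] with x hx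
      rw [hx, Pi.add_apply, dotc_add_right])
    (by
      intro c f h
      rw [smul_eq_mul, ← integral_const_mul]
      refine integral_congr_ae ?_
      filter_upwards [Lp.coeFn_smul c h] with x hx
      rw [hx, Pi.smul_apply, dotc_smul_right])

theorem continuous_pairL2 {α : Type*} [MeasurableSpace α] (m : Measure α) (d : ℕ)
    (h : Lp (Vec d) 2 m) : Continuous fun f : Lp (Vec d) 2 m => pairL2 m d f h := by
  have hs : MemLp (fun x => (WithLp.toLp 2 fun i => starRingEnd ℂ (h x i) : Vec d)) 2 m := by
    have hcont : Continuous fun v : Vec d => (WithLp.toLp 2 fun i => starRingEnd ℂ (v i) : Vec d) :=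
      (PiLp.continuous_toLp 2 _).comp (continuous_pi fun i =>
        Complex.continuous_conj.comp (EuclideanSpace.proj (𝕜 := ℂ) i).continuous)
    refine (Lp.memLp h).of_le (hcont.comp_aestronglyMeasurable
      (Lp.aestronglyMeasurable h)) (Eventually.of_forall fun x => ?_)
    simp [EuclideanSpace.norm_eq]
  have : ∀ f : Lp (Vec d) 2 m, pairL2 m d f h = inner ℂ hs.toLp f := by
    intro f
    rw [L2.inner_def]
    refine integral_congr_ae ?_
    filter_upwards [hs.coeFn_toLp] with x hx
    rw [hx]
    simp [PiLp.inner_apply, dotc]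
  simp only [this]
  exact continuous_const.inner continuous_id

namespace ElasticMedium

variable {d : ℕ} (M : ElasticMedium d)

/-- The `ρ`-weighted pairing `(u, w)_{L²(Ω; ρ dx)} = ∫_Ω (u · w) ρ dx`. -/
def massForm (u : M.L2Om) (w : Pt d → Vec d) : ℂ :=
  ∫ x, (M.rho x : ℂ) * dotc (u x) (w x) ∂M.vol

/-- The stress tensor `μ(G + Gᵀ) + λ (tr G) I` at `x`, where column `j` of the displacement
gradient is `G j = ∂ⱼ u`. -/
def stress (x : Pt d) (G : Fin d → Vec d) (i j : Fin d) : ℂ :=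
  (M.mu x : ℂ) * (G j i + G i j) + if i = j then (M.lam x : ℂ) * ∑ k, G k k else 0

/-- The elastic energy form `∫_Ω (μ(∇u + ∇uᵀ) + λ (∇·u) I) : ∇w dx`, where `G j = ∂ⱼu`. -/
def energyForm (G : Fin d → M.L2Om) (w : Pt d → Vec d) : ℂ :=
  ∫ x, ∑ i, ∑ j, M.stress x (fun k => G k x) i j * pderiv j w x i ∂M.vol

theorem continuousOn_stress {w : Pt d → Vec d} (hw : ContDiff ℝ ∞ w) (i j : Fin d) :
    ContinuousOn (fun x => M.stress x (fun k => pderiv k w x) i j) M.Om := by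
  have h1 : ContinuousOn (fun x => (M.mu x : ℂ)) M.Om :=
    Complex.continuous_ofReal.comp_continuousOn M.mu_smooth.continuousOn
  have h2 : ContinuousOn (fun x => (M.lam x : ℂ)) M.Om :=
    Complex.continuous_ofReal.comp_continuousOn M.lam_smooth.continuousOn
  have h3 : ∀ k l : Fin d, ContinuousOn (fun x => pderiv k w x l) M.Om := fun k l =>
    ((EuclideanSpace.proj (𝕜 := ℂ) l).continuous.comp (continuous_pderiv hw k)).continuousOn
  unfold stress
  refine (h1.mul ((h3 _ _).add (h3 _ _))).add ?_
  split_ifs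
  · exact h2.mul (continuousOn_finsetSum _ fun k _ => h3 k k)
  · exact continuousOn_const

theorem continuousOn_toLp {s : Set (Pt d)} {g : Fin d → Pt d → ℂ}
    (hg : ∀ i, ContinuousOn (g i) s) :
    ContinuousOn (fun x => (WithLp.toLp 2 fun i => g i x : Vec d)) s :=
  (PiLp.continuous_toLp 2 _).comp_continuousOn (continuousOn_pi.2 hg)

/-- For fixed `w`, the mass form is a bounded linear functional on `L²(Ω)`. -/
theorem massForm_eq {w : Pt d → Vec d} (hw : ContDiff ℝ ∞ w) :
    ∃ h : M.L2Om, ∀ u : M.L2Om, M.massForm u w = pairL2 M.vol d u h := by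
  have hc : ContinuousOn (fun x => (M.rho x : ℂ) • w x) M.Om :=
    (Complex.continuous_ofReal.comp_continuousOn M.rho_smooth.continuousOn).smul
      hw.continuous.continuousOn
  refine ⟨(M.memLp_vol hc).toLp, fun u => integral_congr_ae ?_⟩
  filter_upwards [(M.memLp_vol hc).coeFn_toLp] with x hx
  rw [hx, dotc_smul_right]

theorem stress_symm (x : Pt d) (G H : Fin d → Vec d) :
    ∑ i, ∑ j, M.stress x G i j * H j i = ∑ j, dotc (G j)
      (WithLp.toLp 2 fun i => M.stress x H i j) := by
  have h1 : ∑ i, ∑ j, G i j * H j i = ∑ i, ∑ j, G j i * H i j := Finset.sum_comm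
  have h2 : ∑ i, ∑ j, G j i * H j i = ∑ i, ∑ j, G i j * H i j := Finset.sum_comm
  simp only [stress, dotc, add_mul, mul_add, mul_assoc, Finset.sum_add_distrib, ite_mul, zero_mul,
    mul_ite, mul_zero, Finset.sum_ite_eq, Finset.mem_univ, if_true, Finset.sum_ite_eq',
    ← Finset.mul_sum, ← Finset.sum_mul, mul_left_comm _ (M.mu x : ℂ) _,
    mul_left_comm _ (M.lam x : ℂ) _]
  rw [h1, h2]

/-- For fixed `w`, the energy form is a bounded linear functional of the gradient. -/
theorem energyForm_eq {w : Pt d → Vec d} (hw : ContDiff ℝ ∞ w) :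
    ∃ h : Fin d → M.L2Om, ∀ G : Fin d → M.L2Om,
      M.energyForm G w = ∑ j, pairL2 M.vol d (G j) (h j) := by
  have hc : ∀ j, ContinuousOn (fun x => (WithLp.toLp 2 fun i =>
      M.stress x (fun k => pderiv k w x) i j : Vec d)) M.Om := fun j =>
    continuousOn_toLp fun i => M.continuousOn_stress hw i j
  refine ⟨fun j => (M.memLp_vol (hc j)).toLp, fun G => ?_⟩
  have : ∀ j, pairL2 M.vol d (G j) (M.memLp_vol (hc j)).toLp =
      ∫ x, dotc (G j x) (WithLp.toLp 2 fun i =>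
        M.stress x (fun k => pderiv k w x) i j) ∂M.vol := fun j => by
    refine integral_congr_ae ?_
    filter_upwards [(M.memLp_vol (hc j)).coeFn_toLp] with x hx
    rw [hx]
  simp only [this]
  rw [← integral_finsetSum _ fun j _ => integrable_dotc (Lp.memLp (G j)) (M.memLp_vol (hc j))]
  exact integral_congr_ae (Eventually.of_forall fun x => M.stress_symm x _ _)

/-- The surface traction `μ ∂_ν w + μ (∇w)ᵀ ν + λ (∇·w) ν` of a smooth field (used on `∂Ω`). -/
def traction (w : Pt d → Vec d) (x : Pt d) : Vec d :=
  WithLp.toLp 2 fun i =>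
    (M.mu x : ℂ) * ∑ j, pderiv j w x i * (M.normal x j : ℂ)
      + (M.mu x : ℂ) * ∑ j, pderiv i w x j * (M.normal x j : ℂ)
      + (M.lam x : ℂ) * (∑ k, pderiv k w x k) * (M.normal x i : ℂ)

end ElasticMedium

/-- A field of class `C([0,T]; H¹(Ω)) ∩ C¹([0,T]; L²(Ω))`: the field `u`, its time derivative
`ut`, its spatial partial derivatives `Du · j = ∂ⱼu`, and its boundary trace `tr`. -/
structure EnergyField {d : ℕ} (D : SmoothDomain d) (T : ℝ) where
  u : ℝ → D.L2Om
  ut : ℝ → D.L2Om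
  Du : ℝ → Fin d → D.L2Om
  tr : ℝ → D.L2bdry
  mem_H1 : ∀ t ∈ Icc 0 T, (u t, Du t, tr t) ∈ D.H1Trace
  Du_cont : ContinuousOn Du (Icc 0 T)
  deriv_u : ∀ t ∈ Icc 0 T, HasDerivWithinAt u (ut t) (Icc 0 T) t
  ut_cont : ContinuousOn ut (Icc 0 T)

namespace EnergyField

variable {d : ℕ} {M : ElasticMedium d} {T : ℝ}

/-- The linear combination `c • U + V` of two fields. -/
def lin (c : ℂ) (U V : EnergyField M.toSmoothDomain T) : EnergyField M.toSmoothDomain T where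
  u t := c • U.u t + V.u t
  ut t := c • U.ut t + V.ut t
  Du t := c • U.Du t + V.Du t
  tr t := c • U.tr t + V.tr t
  mem_H1 t ht := Submodule.add_mem _ (Submodule.smul_mem _ c (U.mem_H1 t ht)) (V.mem_H1 t ht)
  Du_cont := (U.Du_cont.const_smul c).add V.Du_cont
  deriv_u t ht := ((U.deriv_u t ht).const_smul c).add (V.deriv_u t ht)
  ut_cont := (U.ut_cont.const_smul c).add V.ut_cont

/-- The zero field. -/
def zero (D : SmoothDomain d) (T : ℝ) : EnergyField D T where
  u _ := 0
  ut _ := 0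
  Du _ := 0
  tr _ := 0
  mem_H1 _ _ := Submodule.zero_mem _
  Du_cont := continuousOn_const
  deriv_u _ _ := hasDerivWithinAt_const _ _ _
  ut_cont := continuousOn_const

/-- The value at the test function `η(t) w(x)` of the distribution
`ρ ∂ₜ²u - ∇·(μ(∇u + ∇uᵀ)) - ∇(λ ∇·u)`, after integrating by parts once in time and, without
boundary term, once in space. -/
def weakForm (U : EnergyField M.toSmoothDomain T) (η : ℝ → ℂ) (w : Pt d → Vec d) : ℂ :=
  ∫ t in (0 : ℝ)..T, (η t * M.energyForm (U.Du t) w - deriv η t * M.massForm (U.ut t) w)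

theorem weakForm_integrable (hT : 0 < T) (U : EnergyField M.toSmoothDomain T) {η : ℝ → ℂ}
    (hη : ContDiff ℝ ∞ η) {w : Pt d → Vec d} (hw : ContDiff ℝ ∞ w) :
    IntervalIntegrable (fun t => η t * M.energyForm (U.Du t) w - deriv η t * M.massForm (U.ut t) w)
      volume 0 T := by
  obtain ⟨h, hh⟩ := M.massForm_eq hw
  obtain ⟨g, hg⟩ := M.energyForm_eq hw
  refine ContinuousOn.intervalIntegrable ?_
  rw [uIcc_of_le hT.le]
  simp only [hh, hg]
  refine (hη.continuous.continuousOn.mul (continuousOn_finsetSum _ fun j _ => ?_)).sub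
    ((hη.continuous_deriv (by simp)).continuousOn.mul ?_)
  · exact (continuous_pairL2 _ d (g j)).comp_continuousOn
      ((continuous_apply j).comp_continuousOn U.Du_cont)
  · exact (continuous_pairL2 _ d h).comp_continuousOn U.ut_cont

theorem weakForm_lin (hT : 0 < T) (c : ℂ) (U V : EnergyField M.toSmoothDomain T) {η : ℝ → ℂ}
    (hη : ContDiff ℝ ∞ η) {w : Pt d → Vec d} (hw : ContDiff ℝ ∞ w) :
    (lin c U V).weakForm η w = c * U.weakForm η w + V.weakForm η w := by
  unfold weakForm
  rw [← intervalIntegral.integral_const_mul, ← intervalIntegral.integral_add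
    ((U.weakForm_integrable hT hη hw).const_mul c) (V.weakForm_integrable hT hη hw)]
  obtain ⟨h, hh⟩ := M.massForm_eq hw
  obtain ⟨g, hg⟩ := M.energyForm_eq hw
  congr 1
  funext t
  simp only [hh, hg, lin, Pi.add_apply, Pi.smul_apply, map_add, map_smul, LinearMap.add_apply,
    LinearMap.smul_apply, smul_eq_mul, Finset.sum_add_distrib, ← Finset.mul_sum]
  ring

theorem weakForm_zero (η : ℝ → ℂ) (w : Pt d → Vec d) (hw : ContDiff ℝ ∞ w) :
    (zero M.toSmoothDomain T).weakForm η w = 0 := by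
  obtain ⟨h, hh⟩ := M.massForm_eq hw
  obtain ⟨g, hg⟩ := M.energyForm_eq hw
  simp [weakForm, zero, hh, hg]

/-- `u` solves `ρ ∂ₜ²u = ∇·(μ(∇u + ∇uᵀ)) + ∇(λ ∇·u)` in `(0,T) × Ω` in the weak sense: tested
against `η(t) w(x)` with `η ∈ C_c^∞(0,T)` and `w` smooth with support in the interior of `Ω`. -/
def SolvesWave (U : EnergyField M.toSmoothDomain T) : Prop :=
  ∀ η : ℝ → ℂ, ContDiff ℝ ∞ η → tsupport η ⊆ Ioo 0 T →
    ∀ w : Pt d → Vec d, ContDiff ℝ ∞ w → tsupport w ⊆ interior M.Om → U.weakForm η w = 0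

/-- `U` is a finite-energy solution of the initial-boundary value problem with boundary values
`f`: it solves the wave equation weakly, `u(0) = ∂ₜu(0) = 0`, and `u = f` on `(0,T) × ∂Ω`. -/
def IsSolution (U : EnergyField M.toSmoothDomain T) (f : ℝ × Pt d → Vec d) : Prop :=
  U.SolvesWave ∧ U.u 0 = 0 ∧ U.ut 0 = 0 ∧
    ∀ t ∈ Ioo 0 T, (U.tr t : Pt d → Vec d) =ᵐ[M.surf] fun x => f (t, x)

/-- `k ∈ L²((0,T) × ∂Ω)` is the surface traction `T_ν u` of the weak solution `u` on the lateral
boundary. As `∇u(t)` is only in `L²(Ω)`, the traction is the weak conormal derivative, defined by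
Green's formula with test functions `η(t) w(x)` that need not vanish on `∂Ω`. -/
def HasTraction (U : EnergyField M.toSmoothDomain T) (k : M.L2lat T) : Prop :=
  ∀ η : ℝ → ℂ, ContDiff ℝ ∞ η → tsupport η ⊆ Ioo 0 T →
    ∀ w : Pt d → Vec d, ContDiff ℝ ∞ w →
      U.weakForm η w = ∫ p, η p.1 * dotc (k p) (w p.2) ∂(M.lat T)

theorem integrable_traction (k : M.L2lat T) {η : ℝ → ℂ} (hη : ContDiff ℝ ∞ η)
    {w : Pt d → Vec d} (hw : ContDiff ℝ ∞ w) :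
    Integrable (fun p => η p.1 * dotc (k p) (w p.2)) (M.lat T) := by
  have hc : Continuous fun p : ℝ × Pt d => η p.1 • w p.2 :=
    (hη.continuous.comp continuous_fst).smul (hw.continuous.comp continuous_snd)
  simp only [← dotc_smul_right]
  exact integrable_dotc (Lp.memLp k) (M.memLp_lat hc.continuousOn)

theorem HasTraction.lin (hT : 0 < T) (c : ℂ) {U V : EnergyField M.toSmoothDomain T}
    {k l : M.L2lat T} (hU : U.HasTraction k) (hV : V.HasTraction l) :
    (EnergyField.lin c U V).HasTraction (c • k + l) := by
  intro η hη hη' w hw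
  rw [weakForm_lin hT c U V hη hw, hU η hη hη' w hw, hV η hη hη' w hw, ← integral_const_mul,
    ← integral_add ((integrable_traction k hη hw).const_mul c) (integrable_traction l hη hw)]
  refine integral_congr_ae ?_
  filter_upwards [Lp.coeFn_add (c • k) l, Lp.coeFn_smul c k] with p h1 h2
  rw [h1, Pi.add_apply, h2, Pi.smul_apply, dotc_add_left, dotc_smul_left]
  ring

theorem IsSolution.lin (hT : 0 < T) (c : ℂ) {U V : EnergyField M.toSmoothDomain T}
    {f g : ℝ × Pt d → Vec d} (hU : U.IsSolution f) (hV : V.IsSolution g) :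
    (EnergyField.lin c U V).IsSolution (c • f + g) := by
  refine ⟨fun η hη hη' w hw hw' => ?_, ?_, ?_, fun t ht => ?_⟩
  · rw [weakForm_lin hT c U V hη hw, hU.1 η hη hη' w hw hw', hV.1 η hη hη' w hw hw']
    simp
  · simp [EnergyField.lin, hU.2.1, hV.2.1]
  · simp [EnergyField.lin, hU.2.2.1, hV.2.2.1]
  · filter_upwards [Lp.coeFn_add (c • U.tr t) (V.tr t), Lp.coeFn_smul c (U.tr t),
      hU.2.2.2 t ht, hV.2.2.2 t ht] with x h1 h2 h3 h4
    change (c • U.tr t + V.tr t : M.L2bdry) x = _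
    rw [h1, Pi.add_apply, h2, Pi.smul_apply, h3, h4]
    rfl

theorem HasTraction.zero : (zero M.toSmoothDomain T).HasTraction 0 := by
  intro η hη hη' w hw
  rw [weakForm_zero η w hw, eq_comm]
  refine integral_eq_zero_of_ae ?_
  filter_upwards [Lp.coeFn_zero (Vec d) 2 (M.lat T)] with p hp
  have h0 : dotc (0 : Vec d) (w p.2) = 0 := by simp [dotc]
  rw [hp, Pi.zero_apply, h0, mul_zero]
  rfl

theorem IsSolution.zero : (zero M.toSmoothDomain T).IsSolution 0 :=
  ⟨fun η _ _ w hw _ => weakForm_zero η w hw, rfl, rfl, fun _ _ => Lp.coeFn_zero _ _ _⟩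

end EnergyField

/-- The graph of the displacement-to-traction map: all pairs `(f, k)` of a boundary datum `f` and
`k ∈ L²((0,T) × ∂Ω)` such that the problem with boundary values `f` has a finite-energy solution
with surface traction `k`. -/
def dnGraph {d : ℕ} (M : ElasticMedium d) {T : ℝ} (hT : 0 < T) :
    Submodule ℂ (boundaryData M.toSmoothDomain T × M.L2lat T) where
  carrier := {p | ∃ U : EnergyField M.toSmoothDomain T,
    U.IsSolution (p.1 : ℝ × Pt d → Vec d) ∧ U.HasTraction p.2}
  add_mem' := by
    rintro ⟨f, k⟩ ⟨g, l⟩ ⟨U, hU, hUk⟩ ⟨V, hV, hVl⟩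
    refine ⟨EnergyField.lin 1 U V, ?_, ?_⟩
    · simpa using hU.lin hT 1 hV
    · simpa using hUk.lin hT 1 hVl
  zero_mem' := ⟨EnergyField.zero _ T, EnergyField.IsSolution.zero, EnergyField.HasTraction.zero⟩
  smul_mem' := by
    rintro c ⟨f, k⟩ ⟨U, hU, hUk⟩
    refine ⟨EnergyField.lin c U (EnergyField.zero _ T), ?_, ?_⟩
    · simpa using hU.lin hT c EnergyField.IsSolution.zero
    · simpa using hUk.lin hT c EnergyField.HasTraction.zero

/-- The displacement-to-traction map `Λ_{ρ,T} : f ↦ T_ν u_f`, a linear operator from boundary data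
in `C₀^∞((0,T) × ∂Ω)` to `L²((0,T) × ∂Ω)`, as the linear (partial) map with the graph above. -/
def dnMap {d : ℕ} (M : ElasticMedium d) {T : ℝ} (hT : 0 < T) :
    boundaryData M.toSmoothDomain T →ₗ.[ℂ] M.L2lat T :=
  (dnGraph M hT).toLinearPMap

/-- The dual of the domain of `Λ_{ρ,T}`. The value of a functional `ℓ` at `f` is the duality
pairing `⟨f, ℓ⟩`, which extends the bilinear `L²((0,T) × ∂Ω)` pairing through `l2ToDual`. -/
abbrev DataDual {d : ℕ} (M : ElasticMedium d) {T : ℝ} (hT : 0 < T) :=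
  Module.Dual ℂ (dnMap M hT).domain

/-- The embedding of `L²((0,T) × ∂Ω)` into the dual: `h ↦ (f ↦ ∫ f · h dS dt)`. -/
def l2ToDual {d : ℕ} (M : ElasticMedium d) {T : ℝ} (hT : 0 < T) :
    M.L2lat T →ₗ[ℂ] DataDual M hT :=
  ((pairL2 (M.lat T) d).comp
    ((dataToL2 M.toSmoothDomain T).comp (dnMap M hT).domain.subtype)).flip

/-- The adjoint `Λ*_{ρ,T}` of `Λ_{ρ,T}` with respect to the bilinear pairing:
`⟨f, Λ* h⟩ = ⟨Λ f, h⟩` for `h ∈ L²((0,T) × ∂Ω)` and every `f` in the domain of `Λ`. -/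
def dnAdjoint {d : ℕ} (M : ElasticMedium d) {T : ℝ} (hT : 0 < T) :
    M.L2lat T →ₗ[ℂ] DataDual M hT :=
  ((pairL2 (M.lat T) d).comp (dnMap M hT).toFun).flip

/-- The time integration `(𝓘 h)(t, x) = ∫_t^T h(s, x) ds`. -/
def timeInt {d : ℕ} (T : ℝ) (h : ℝ × Pt d → Vec d) (p : ℝ × Pt d) : Vec d :=
  ∫ s in p.1..T, h (s, p.2)

/-- The trace `T₀φ = φ|_{∂Ω}`, as a function on the lateral boundary that is constant in time. -/
def trace0 {d : ℕ} (φ : Pt d → Vec d) (p : ℝ × Pt d) : Vec d := φ p.2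

/-- The trace `T₁φ`, the surface traction of `φ` on `∂Ω`, as a function on the lateral boundary
that is constant in time. -/
def trace1 {d : ℕ} (M : ElasticMedium d) (φ : Pt d → Vec d) (p : ℝ × Pt d) : Vec d :=
  M.traction φ p.2

theorem memLp_timeInt {d : ℕ} (D : SmoothDomain d) (T : ℝ) {g : Pt d → Vec d}
    (hg : ContinuousOn g D.bdry) : MemLp (timeInt T fun p => g p.2) 2 (D.lat T) := by
  refine D.memLp_lat ?_
  have h : ∀ p : ℝ × Pt d, timeInt T (fun p => g p.2) p = (T - p.1) • g p.2 := fun p => by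
    simp [timeInt]
  simp only [funext h]
  exact (continuousOn_const.sub continuousOn_fst).smul
    (hg.comp continuousOn_snd fun p hp => hp.2)

theorem continuousOn_traction {d : ℕ} (M : ElasticMedium d) {φ : Pt d → Vec d}
    (hφ : ContDiff ℝ ∞ φ) : ContinuousOn (M.traction φ) M.bdry := by
  have h1 : ContinuousOn (fun x => (M.mu x : ℂ)) M.bdry :=
    Complex.continuous_ofReal.comp_continuousOn (M.mu_smooth.continuousOn.mono M.bdry_subset)
  have h2 : ContinuousOn (fun x => (M.lam x : ℂ)) M.bdry :=
    Complex.continuous_ofReal.comp_continuousOn (M.lam_smooth.continuousOn.mono M.bdry_subset)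
  have h3 : ∀ k l : Fin d, ContinuousOn (fun x => pderiv k φ x l) M.bdry := fun k l =>
    ((EuclideanSpace.proj (𝕜 := ℂ) l).continuous.comp (continuous_pderiv hφ k)).continuousOn
  have h4 : ∀ k : Fin d, ContinuousOn (fun x => (M.normal x k : ℂ)) M.bdry := fun k =>
    Complex.continuous_ofReal.comp_continuousOn
      ((EuclideanSpace.proj (𝕜 := ℝ) k).continuous.comp_continuousOn M.continuousOn_normal)
  refine ElasticMedium.continuousOn_toLp fun i => ?_
  exact ((h1.mul (continuousOn_finsetSum _ fun j _ => (h3 j i).mul (h4 j))).add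
    (h1.mul (continuousOn_finsetSum _ fun j _ => (h3 i j).mul (h4 j)))).add
    ((h2.mul (continuousOn_finsetSum _ fun k _ => h3 k k)).mul (h4 i))

/-- `𝓘 T₀ φ` as an element of `L²((0,T) × ∂Ω)`. -/
def intTrace0 {d : ℕ} (M : ElasticMedium d) (T : ℝ) (φ : smoothFields d) : M.L2lat T :=
  (memLp_timeInt M.toSmoothDomain T (smoothFields_contDiff φ).continuous.continuousOn :
    MemLp (timeInt T (trace0 (φ : Pt d → Vec d))) 2 (M.lat T)).toLp

/-- `𝓘 T₁ φ` as an element of `L²((0,T) × ∂Ω)`. -/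
def intTrace1 {d : ℕ} (M : ElasticMedium d) (T : ℝ) (φ : smoothFields d) : M.L2lat T :=
  (memLp_timeInt M.toSmoothDomain T (continuousOn_traction M (smoothFields_contDiff φ)) :
    MemLp (timeInt T (trace1 M (φ : Pt d → Vec d))) 2 (M.lat T)).toLp

/-- The operator `𝓚(Λ_{ρ,T}) = Λ*_{ρ,T} 𝓘 T₀ - 𝓘 T₁` applied to `φ`. -/
def opK {d : ℕ} (M : ElasticMedium d) {T : ℝ} (hT : 0 < T) (φ : smoothFields d) : DataDual M hT :=
  dnAdjoint M hT (intTrace0 M T φ) - l2ToDual M hT (intTrace1 M T φ)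

/-- The complex frequency `θ = (ξ + iη)/2`. -/
def freq {d : ℕ} (ξ η : Pt d) : Vec d :=
  WithLp.toLp 2 fun j => ((ξ j : ℂ) + Complex.I * (η j : ℂ)) / 2

/-- The function `φ(x) = ι e^{iθ·x}`. -/
def expField {d : ℕ} (ι θ : Vec d) : smoothFields d :=
  ⟨fun x => Complex.exp (Complex.I * ∑ j, θ j * (x j : ℂ)) • ι, by
    have h : ∀ j : Fin d, ContDiff ℝ ∞ fun x : Pt d => (x j : ℂ) := fun j =>
      Complex.ofRealCLM.contDiff.comp (EuclideanSpace.proj (𝕜 := ℝ) j).contDiff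
    exact ((contDiff_const.mul (ContDiff.sum fun j _ => contDiff_const.mul (h j))).cexp).smul
      contDiff_const⟩

/-- The condition
`i(θ ιᵀ + ι θᵀ)∇μ + i(ι·θ)∇λ - μ(θ·θ)ι - (λ+μ)(ι·θ)θ = 0` on `Ω`. -/
def CGOCondition {d : ℕ} (M : ElasticMedium d) (ι θ : Vec d) : Prop :=
  ∀ x ∈ M.Om, ∀ i : Fin d,
    Complex.I * ∑ j, (θ i * ι j + ι i * θ j)
        * (fderivWithin ℝ M.mu M.Om x (EuclideanSpace.single j 1) : ℂ)
      + Complex.I * dotc ι θ * (fderivWithin ℝ M.lam M.Om x (EuclideanSpace.single i 1) : ℂ)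
      - (M.mu x : ℂ) * dotc θ θ * ι i
      - ((M.lam x : ℂ) + (M.mu x : ℂ)) * dotc ι θ * θ i = 0

end ElasticWave

end

/-! ### Weak derivatives in time -/

namespace ElasticWave

/-! Write `a(u,w)` for the elastic energy form and `k` for the traction of `u = u_f`. Integrating
the weak equation once in time gives `(ρ uₜ(t), w) + ∫₀ᵗ a(u,w) = ∫₀ᵗ ∫_{∂Ω} k·w`. A second
integration up to `T` turns the double primitive into the weight `T - s`: `(ρ u(T), w) = ∫₀ᵀ (T - s)
(∫_{∂Ω} k·w - a(u(s),w)) ds` (`HasTraction.massForm_u`). The condition on `ι` and `θ` makes the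
stress of `φ` divergence free, so for `w = φ` Green's formula replaces `a(u(s),φ)` by `∫_{∂Ω}
f(s)·T_νφ` (`energyForm_expField`). On functions constant in time `𝓘` is multiplication by `T - s`,
so the two terms are `⟨Λf, 𝓘T₀φ⟩` and `⟨f, 𝓘T₁φ⟩`.

Two ingredients carry most of the work.

The first is Green's formula, that is, the divergence theorem on `{r ≤ 0}` with Hausdorff surface
measure, for fields that are `C¹` in the interior only (`integral_divergence`). The field is
multiplied by a cutoff that is a function of `r/δ` and integrated by parts in the whole space. What
remains is an average over a layer of width of order `δ`, and this tends to the integral of the flux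
of `∇r` against `|∇r|⁻¹ dS`. For affine `r` this limit is Fubini's theorem. In general, `r` is
affine in charts that are `K`-Lipschitz in both directions; these distort volume and surface measure
by powers of `K`, and `K` tends to 1.

The second is that the graph defining `Λ` is single-valued: zero boundary data force zero traction.
As `uₜ` is merely in `L²`, it is not an admissible test field. Instead the time-integrated equation
is tested with `u(t)` itself, which shows that `(ρu,u) + a(∫₀ᵗu, ∫₀ᵗu)` is conserved. The field
`u(t)` is a limit of smooth fields whose traces tend to zero in `L²(∂Ω)`, and the traction is in
`L²`, so the boundary term disappears. Ellipticity then gives `u = 0` and makes the stress of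
`∫₀ᵗ∇u` vanish, hence `∫₀ᵗ∫_{∂Ω} k·w = 0` for all `t` and all smooth `w`, and `k = 0`. -/

theorem integral_mul_primitive {T : ℝ} (hT : 0 < T) {g c : ℝ → ℂ} (hg : Continuous g)
    (hc : IntervalIntegrable c volume 0 T) :
    ∫ t in (0 : ℝ)..T, g t * ∫ s in (0 : ℝ)..t, c s =
      ∫ s in (0 : ℝ)..T, (∫ t in s..T, g t) * c s := by
  have hc' : Integrable c (volume.restrict (Ioc 0 T)) :=
    (intervalIntegrable_iff_integrableOn_Ioc_of_le hT.le).1 hc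
  have hg' : Integrable g (volume.restrict (Ioc 0 T)) :=
    (hg.integrableOn_Icc.mono_set Ioc_subset_Icc_self)
  have hm : MeasurableSet {p : ℝ × ℝ | p.2 ≤ p.1} := measurableSet_le measurable_snd measurable_fst
  -- Fubini on the triangle `s ≤ t`, encoded by an indicator so that both iterated integrals run
  -- over the square.
  have hint : Integrable ({p : ℝ × ℝ | p.2 ≤ p.1}.indicator fun p => g p.1 * c p.2)
      ((volume.restrict (Ioc 0 T)).prod (volume.restrict (Ioc 0 T))) :=
    (hg'.mul_prod hc').indicator hm
  have hswap := integral_integral_swap (f := fun t s =>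
    ({p : ℝ × ℝ | p.2 ≤ p.1}.indicator fun p => g p.1 * c p.2) (t, s)) hint
  rw [intervalIntegral.integral_of_le hT.le, intervalIntegral.integral_of_le hT.le]
  refine Eq.trans (setIntegral_congr_fun measurableSet_Ioc fun t ht => ?_)
    (hswap.trans (setIntegral_congr_fun measurableSet_Ioc fun s hs => ?_))
  · have h1 : (fun s => ({p : ℝ × ℝ | p.2 ≤ p.1}.indicator fun p => g p.1 * c p.2) (t, s)) =
        (Iic t).indicator fun s => g t * c s := by
      funext s
      simp [indicator]
    rw [h1, integral_indicator measurableSet_Iic, Measure.restrict_restrict measurableSet_Iic,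
      integral_const_mul, intervalIntegral.integral_of_le ht.1.le]
    congr 3
    ext s
    simp only [mem_inter_iff, mem_Iic, mem_Ioc]
    exact ⟨fun h => ⟨h.2, h.1, h.2.trans ht.2⟩, fun h => ⟨h.2.1, h.1⟩⟩
  · have h1 : (fun t => ({p : ℝ × ℝ | p.2 ≤ p.1}.indicator fun p => g p.1 * c p.2) (t, s)) =
        (Ici s).indicator fun t => g t * c s := by
      funext t
      simp [indicator]
    rw [h1, integral_indicator measurableSet_Ici, Measure.restrict_restrict measurableSet_Ici,
      integral_mul_const, intervalIntegral.integral_of_le hs.2, ← integral_Icc_eq_integral_Ioc]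
    congr 3
    ext t
    simp only [mem_inter_iff, mem_Icc, mem_Ici, mem_Ioc]
    exact ⟨fun h => ⟨h.1, h.2.2⟩, fun h => ⟨h.1, hs.1.trans_le h.1, h.2⟩⟩

/-- Source of the weight `T - s`, which matches the weight produced by `𝓘` on functions constant in
time. -/
theorem integral_primitive {T : ℝ} (hT : 0 < T) {c : ℝ → ℂ}
    (hc : IntervalIntegrable c volume 0 T) :
    ∫ t in (0 : ℝ)..T, ∫ s in (0 : ℝ)..t, c s = ∫ s in (0 : ℝ)..T, ((T - s : ℝ) : ℂ) * c s := by
  simpa using integral_mul_primitive hT (continuous_const (y := (1 : ℂ))) hc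

/-- The primitive starting at the left end of the support is zero to the left of it, and zero mean
makes it return to zero beyond the right end. -/
theorem exists_primitive_of_tsupport_subset {T : ℝ} {ψ : ℝ → ℝ} (hψ : ContDiff ℝ ∞ ψ)
    (hs : tsupport ψ ⊆ Ioo 0 T) (hc : HasCompactSupport ψ) (h0 : ∫ x, ψ x = 0) :
    ∃ η : ℝ → ℝ, ContDiff ℝ ∞ η ∧ tsupport η ⊆ Ioo 0 T ∧ deriv η = ψ := by
  rcases (tsupport ψ).eq_empty_or_nonempty with he | hne
  · have hz : ψ = 0 := tsupport_eq_empty_iff.1 he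
    exact ⟨0, contDiff_const, by simp [tsupport], by rw [hz]; ext; simp⟩
  obtain ⟨a, ha, hamin⟩ := hc.isCompact.exists_isLeast hne
  obtain ⟨b, hb, hbmax⟩ := hc.isCompact.exists_isGreatest hne
  have hder : ∀ x, HasDerivAt (fun y => ∫ s in a..y, ψ s) (ψ x) x := fun x =>
    intervalIntegral.integral_hasDerivAt_right (hψ.continuous.intervalIntegrable _ _)
      (hψ.continuous.stronglyMeasurableAtFilter _ _) hψ.continuous.continuousAt
  have hzl : ∀ x, x < a → ψ x = 0 := fun x hx => by
    by_contra h
    exact absurd (hamin (subset_tsupport _ h)) (not_le.2 hx)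
  have hzr : ∀ x, b < x → ψ x = 0 := fun x hx => by
    by_contra h
    exact absurd (hbmax (subset_tsupport _ h)) (not_le.2 hx)
  have hd : deriv (fun y => ∫ s in a..y, ψ s) = ψ := funext fun x => (hder x).deriv
  refine ⟨fun y => ∫ s in a..y, ψ s, ?_, ?_, hd⟩
  · rw [contDiff_infty_iff_deriv, hd]
    exact ⟨fun x => (hder x).differentiableAt, hψ⟩
  · refine Subset.trans (closure_minimal ?_ isClosed_Icc)
      (fun x (hx : x ∈ Icc a b) => ⟨(hs ha).1.trans_le hx.1, hx.2.trans_lt (hs hb).2⟩)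
    intro y hy
    by_contra hn
    apply hy
    rcases not_and_or.1 hn with h | h
    · have hya : y < a := not_le.1 h
      simp only
      rw [intervalIntegral.integral_congr_ae (g := fun _ => 0)]
      · simp
      · rw [uIoc_of_ge hya.le]
        have : ∀ᵐ x : ℝ, x ≠ a := by simp [ae_iff]
        filter_upwards [this] with x hx hx2
        exact hzl x (lt_of_le_of_ne hx2.2 hx)
    · have hyb : b < y := not_le.1 h
      have hab : a ≤ b := hamin hb
      simp only
      rw [intervalIntegral.integral_of_le (hab.trans hyb.le), ← integral_Icc_eq_integral_Ioc,
        setIntegral_eq_integral_of_forall_compl_eq_zero, h0]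
      intro x hx
      rcases lt_or_ge x a with h1 | h1
      · exact hzl x h1
      · exact hzr x (lt_of_not_ge fun h2 => hx ⟨h1, h2.trans hyb.le⟩)

/-- The lemma of du Bois-Reymond. -/
theorem eqOn_const_of_integral_deriv_mul_eq_zero {T : ℝ} (hT : 0 < T) {M : ℝ → ℂ}
    (hM : ContinuousOn M (Icc 0 T))
    (h : ∀ η : ℝ → ℝ, ContDiff ℝ ∞ η → tsupport η ⊆ Ioo 0 T →
      ∫ t in (0 : ℝ)..T, ((deriv η t : ℝ) : ℂ) * M t = 0) :
    ∀ t ∈ Icc 0 T, M t = M 0 := by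
  -- Any smooth function of unit mass supported in `(0,T)` would do; the closed ball of radius `T/4`
  -- about `T/2` lies in this interval.
  let b : ContDiffBump (T / 2) := ⟨T / 8, T / 4, by positivity, by linarith⟩
  set φ₀ : ℝ → ℝ := b.normed volume with hφ₀
  have hb1 : ContDiff ℝ ∞ φ₀ := b.contDiff_normed
  have hb2 : tsupport φ₀ ⊆ Ioo 0 T := by
    rw [hφ₀, b.tsupport_normed_eq, Real.closedBall_eq_Icc]
    intro x hx
    change x ∈ Icc (T / 2 - T / 4) (T / 2 + T / 4) at hx
    exact ⟨by linarith [hx.1], by linarith [hx.2]⟩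
  have hb3 : HasCompactSupport φ₀ := b.hasCompactSupport_normed
  have hb4 : ∫ x, φ₀ x = 1 := b.integral_normed
  have hMi : IntervalIntegrable M volume 0 T := by
    apply ContinuousOn.intervalIntegrable
    rwa [uIcc_of_le hT.le]
  set C : ℂ := ∫ t in (0 : ℝ)..T, (φ₀ t : ℂ) * M t with hC
  have key : ∀ φ : ℝ → ℝ, ContDiff ℝ ∞ φ → HasCompactSupport φ → tsupport φ ⊆ Ioo 0 T →
      ∫ x, φ x • (M x - C) = 0 := by
    intro φ h1 h2 h3
    set I := ∫ x, φ x with hI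
    -- Subtracting `I * φ₀` removes the mean of `φ`, so the difference is the derivative of an
    -- admissible test function. The hypothesis then says that `M - C` is orthogonal to `φ`.
    obtain ⟨η, hη1, hη2, hη3⟩ := exists_primitive_of_tsupport_subset (T := T)
      (ψ := fun x => φ x - I * φ₀ x)
      (h1.sub (contDiff_const.mul hb1))
      (closure_minimal (fun x hx => by
        by_contra hn
        apply hx
        simp [image_eq_zero_of_notMem_tsupport fun h' => hn (Or.inl h'),
          image_eq_zero_of_notMem_tsupport fun h' => hn (Or.inr h')])
        ((isClosed_tsupport φ).union (isClosed_tsupport φ₀)) |>.trans (union_subset h3 hb2))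
      (h2.sub (hb3.mul_left (f := fun _ => I)))
      (by
        rw [integral_sub (h1.continuous.integrable_of_hasCompactSupport h2)
          ((hb1.continuous.integrable_of_hasCompactSupport hb3).const_mul I), integral_const_mul,
          hb4]
        simp [hI])
    have h4 := h η hη1 hη2
    simp only [hη3] at h4
    have hset : ∀ f : ℝ → ℂ, ∫ x, φ x • f x = ∫ t in (0 : ℝ)..T, (φ t : ℂ) * f t := by
      intro f
      rw [intervalIntegral.integral_of_le hT.le, setIntegral_eq_integral_of_forall_compl_eq_zero]
      · rfl
      · intro x hx
        have : φ x = 0 := by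
          by_contra hn
          exact hx (Ioo_subset_Ioc_self (h3 (subset_tsupport _ hn)))
        simp [this]
    have hφM : IntervalIntegrable (fun t => (φ t : ℂ) * M t) volume 0 T :=
      hMi.continuousOn_mul (Complex.continuous_ofReal.comp h1.continuous).continuousOn
    have hφ₀M : IntervalIntegrable (fun t => (φ₀ t : ℂ) * M t) volume 0 T :=
      hMi.continuousOn_mul (Complex.continuous_ofReal.comp hb1.continuous).continuousOn
    have hI2 : ∫ t in (0 : ℝ)..T, (φ t : ℂ) = I := by
      have := hset fun _ => 1
      simp only [mul_one] at this
      rw [← this, hI, ← integral_complex_ofReal]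
      simp
    rw [hset]
    simp only [mul_sub]
    have hφC : IntervalIntegrable (fun t => (φ t : ℂ) * C) volume 0 T :=
      ((Complex.continuous_ofReal.comp h1.continuous).mul continuous_const).intervalIntegrable _ _
    rw [intervalIntegral.integral_sub hφM hφC,
      intervalIntegral.integral_mul_const, hI2, hC, ← intervalIntegral.integral_const_mul,
      ← intervalIntegral.integral_sub hφM (hφ₀M.const_mul _), ← h4]
    refine intervalIntegral.integral_congr fun t _ => ?_
    simp only [Complex.ofReal_sub, Complex.ofReal_mul]
    ring
  have hae : ∀ᵐ x : ℝ, x ∈ Ioo 0 T → M x - C = 0 :=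
    isOpen_Ioo.ae_eq_zero_of_integral_contDiff_smul_eq_zero
      (((hM.mono Ioo_subset_Icc_self).sub continuousOn_const).locallyIntegrableOn
        measurableSet_Ioo) key
  -- Continuity upgrades the almost everywhere statement to a pointwise one on the open interval,
  -- and then to its closure.
  have heq : EqOn (fun x => M x - C) (fun _ => 0) (Ioo 0 T) :=
    Measure.eqOn_open_of_ae_eq ((ae_restrict_iff' measurableSet_Ioo).2 hae) isOpen_Ioo
      ((hM.mono Ioo_subset_Icc_self).sub continuousOn_const) continuousOn_const
  have heq2 : EqOn (fun x => M x - C) (fun _ => 0) (Icc 0 T) :=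
    heq.of_subset_closure (hM.sub continuousOn_const) continuousOn_const Ioo_subset_Icc_self
      (by rw [closure_Ioo hT.ne])
  intro t ht
  have e1 := heq2 ht
  have e2 := heq2 (left_mem_Icc.2 hT.le)
  simp only [sub_eq_zero] at e1 e2
  rw [e1, e2]

/-- If `m' = -c` in the sense of distributions on `(0,T)`, then `m` is a primitive of `-c`. -/
theorem eq_sub_integral_of_weak_deriv {T : ℝ} (hT : 0 < T) {m c : ℝ → ℂ}
    (hm : ContinuousOn m (Icc 0 T)) (hc : IntervalIntegrable c volume 0 T)
    (h : ∀ η : ℝ → ℝ, ContDiff ℝ ∞ η → tsupport η ⊆ Ioo 0 T →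
      ∫ t in (0 : ℝ)..T, (η t : ℂ) * c t = ∫ t in (0 : ℝ)..T, ((deriv η t : ℝ) : ℂ) * m t) :
    ∀ t ∈ Icc 0 T, m t = m 0 - ∫ s in (0 : ℝ)..t, c s := by
  have hN : ContinuousOn (fun t => ∫ s in (0 : ℝ)..t, c s) (Icc 0 T) := by
    have := intervalIntegral.continuousOn_primitive_interval' (b₁ := 0) (b₂ := T) (a := 0) hc
      left_mem_uIcc
    rwa [uIcc_of_le hT.le] at this
  -- The sum `m + ∫₀ᵗ c` has zero weak derivative: since `η T = 0`, Fubini gives `∫ η' ∫₀ᵗ c = -∫ η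
  -- c`, which cancels `∫ η' m` by `h`. No pointwise derivative of the primitive is used, because
  -- `c` is only integrable.
  have key := eqOn_const_of_integral_deriv_mul_eq_zero hT (hm.add hN) (by
    intro η hη hs
    have hd : Continuous fun t => ((deriv η t : ℝ) : ℂ) :=
      Complex.continuous_ofReal.comp (hη.continuous_deriv (by simp))
    have hηT : η T = 0 := by
      by_contra hn
      exact lt_irrefl _ (hs (subset_tsupport _ hn)).2
    have hi : ∀ f : ℝ → ℂ, ContinuousOn f (Icc 0 T) →
        IntervalIntegrable (fun t => ((deriv η t : ℝ) : ℂ) * f t) volume 0 T := fun f hf => by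
      apply ContinuousOn.intervalIntegrable
      rw [uIcc_of_le hT.le]
      exact hd.continuousOn.mul hf
    simp only [Pi.add_apply, mul_add]
    rw [intervalIntegral.integral_add (hi _ hm) (hi _ hN), integral_mul_primitive hT hd hc,
      ← h η hη hs, ← intervalIntegral.integral_add]
    · refine (intervalIntegral.integral_congr (g := fun _ => 0) fun s _ => ?_).trans (by simp)
      simp only
      rw [intervalIntegral.integral_ofReal, intervalIntegral.integral_deriv_eq_sub
        (fun x _ => (hη.differentiable (by simp)) x)
        ((hη.continuous_deriv (by simp)).intervalIntegrable _ _), hηT]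
      simp
    · exact hc.continuousOn_mul (Complex.continuous_ofReal.comp hη.continuous).continuousOn
    · refine hc.continuousOn_mul (Continuous.continuousOn ?_)
      have : (fun s => ∫ t in s..T, ((deriv η t : ℝ) : ℂ)) = fun s => -∫ t in T..s, ((deriv η t : ℝ) : ℂ) := by
        funext s
        rw [intervalIntegral.integral_symm]
      rw [this]
      exact (intervalIntegral.continuous_primitive (fun a b => hd.intervalIntegrable a b) T).neg)
  intro t ht
  have := key t ht
  simp only [Pi.add_apply, intervalIntegral.integral_same, add_zero] at this
  rw [← this]
  ring

end ElasticWave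

/-! ### Thin slabs along a hyperplane -/

namespace ElasticWave

/-- The support lies strictly to the left of `0`, so the weight `bumpKernel (r/δ)` lives where `-2δ
< r < -δ`. The layer stays inside `Ω` and off its boundary, where the fields are differentiable. -/
noncomputable def bumpKernel : ℝ → ℝ :=
  (⟨1 / 4, 1 / 2, by norm_num, by norm_num⟩ : ContDiffBump (-(3 / 2) : ℝ)).normed volume

theorem bumpKernel_nonneg (s : ℝ) : 0 ≤ bumpKernel s := ContDiffBump.nonneg_normed _ s

theorem continuous_bumpKernel : Continuous bumpKernel := ContDiffBump.continuous_normed _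

theorem integral_bumpKernel : ∫ s, bumpKernel s = 1 := ContDiffBump.integral_normed _

theorem integrable_bumpKernel : Integrable bumpKernel := ContDiffBump.integrable_normed _

theorem bumpKernel_eq_zero {s : ℝ} (hs : s ∉ Ioo (-2 : ℝ) (-1)) : bumpKernel s = 0 := by
  by_contra h
  have h1 : s ∈ Function.support bumpKernel := h
  rw [bumpKernel, ContDiffBump.support_normed_eq, Real.ball_eq_Ioo] at h1
  apply hs
  refine ⟨?_, ?_⟩
  · have := h1.1; norm_num at this; exact this
  · have := h1.2; norm_num at this; exact this

variable {d : ℕ}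

/-- Coordinates along and across the unit vector `v`, based at `x₀`, preserve the volume. -/
theorem measurePreserving_normal_coordinates {v : Pt d} (hv : ‖v‖ = 1) (x₀ : Pt d) :
    MeasurePreserving (fun p : ℝ × (Submodule.span ℝ {v})ᗮ => x₀ + (p.1 • v + (p.2 : Pt d)))
      (volume.prod volume) volume := by
  set s := Submodule.span ℝ {v}
  have h1 : MeasurePreserving (LinearIsometryEquiv.toSpanUnitSingleton v hv) volume volume :=
    LinearIsometryEquiv.measurePreserving _
  have h2 := (s.measurePreserving_measurableEquivProd (P := Pt d) x₀).symm
  rw [InnerProductSpace.euclideanHausdorffMeasure_eq_volume] at h2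
  have h3 := h2.comp (h1.prod (MeasurePreserving.id (volume : Measure sᗮ)))
  have h4 : (fun p : ℝ × sᗮ => x₀ + (p.1 • v + (p.2 : Pt d))) =
      (s.measurableEquivProd (P := Pt d) x₀).symm ∘
        Prod.map (LinearIsometryEquiv.toSpanUnitSingleton v hv) id := by
    funext p
    simp only [Function.comp, Prod.map, Submodule.measurableEquivProd_symm_apply, id,
      LinearIsometryEquiv.toSpanUnitSingleton_apply, vadd_eq_add]
    exact add_comm _ _
  rw [h4]
  exact h3

/-- Normalised Hausdorff measure is invariant under isometries and equals Lebesgue measure on a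
Euclidean space of the same dimension. -/
theorem integral_hyperplane {v : Pt d} (hv : ‖v‖ = 1) (x₀ : Pt d) (h : Pt d → ℝ) :
    ∫ y in {y : Pt d | inner ℝ v (y - x₀) = 0}, h y ∂(μHE[d - 1] : Measure (Pt d)) =
      ∫ y : (Submodule.span ℝ {v})ᗮ, h (x₀ + y) := by
  set s := Submodule.span ℝ {v} with hs
  have hi : Isometry fun y : sᗮ => x₀ + (y : Pt d) :=
    (isometry_add_left x₀).comp isometry_subtype_coe
  have hfin : Module.finrank ℝ sᗮ = d - 1 := by
    have h1 := s.finrank_add_finrank_orthogonal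
    rw [hs, finrank_span_singleton (by rw [← norm_ne_zero_iff, hv]; exact one_ne_zero)] at h1
    rw [finrank_euclideanSpace, Fintype.card_fin] at h1
    exact Nat.eq_sub_of_add_eq' h1
  have hr : range (fun y : sᗮ => x₀ + (y : Pt d)) = {y : Pt d | inner ℝ v (y - x₀) = 0} := by
    ext y
    simp only [mem_range, mem_ofPred_eq]
    constructor
    · rintro ⟨y, rfl⟩
      rw [add_sub_cancel_left]
      exact Submodule.mem_orthogonal_singleton_iff_inner_right.1 y.2
    · intro hy
      exact ⟨⟨y - x₀, Submodule.mem_orthogonal_singleton_iff_inner_right.2 hy⟩, by simp⟩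
  rw [← hr, ← hi.map_euclideanHausdorffMeasure,
    hi.isClosedEmbedding.measurableEmbedding.integral_map, ← hfin,
    InnerProductSpace.euclideanHausdorffMeasure_eq_volume]

/-- This is the coarea formula for the affine function `a⟨v, y - x₀⟩`. Slicing along `v` turns the
slab integral into a mollification, at scale `δ/a`, of the continuous function `J` of slice
integrals; the factor `a⁻¹` is the Jacobian of the rescaling. -/
theorem tendsto_integral_slab {v : Pt d} (hv : ‖v‖ = 1) (x₀ : Pt d) {a : ℝ}
    (ha : 0 < a) {h : Pt d → ℝ} (hc : Continuous h) (hs : HasCompactSupport h) :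
    Tendsto (fun δ : ℝ => ∫ y, δ⁻¹ * bumpKernel (a * inner ℝ v (y - x₀) / δ) * h y) (𝓝[>] 0)
      (𝓝 (a⁻¹ * ∫ y in {y : Pt d | inner ℝ v (y - x₀) = 0}, h y
        ∂(μHE[d - 1] : Measure (Pt d)))) := by
  set H := (Submodule.span ℝ {v})ᗮ with hH
  set J : ℝ → ℝ := fun t => ∫ y : H, h (x₀ + (t • v + y)) with hJ
  obtain ⟨M, hM⟩ := hs.exists_bound_of_continuous hc
  obtain ⟨R, hR⟩ := hs.isCompact.isBounded.subset_closedBall x₀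
  have horth : ∀ y : H, inner ℝ v (y : Pt d) = 0 := fun y =>
    Submodule.mem_orthogonal_singleton_iff_inner_right.1 y.2
  -- A majorant uniform in `t`: if `x₀ + t v + y` lies within `R` of `x₀`, then `‖y‖ ≤ R` because `y
  -- ⊥ v`.
  set bound : H → ℝ := (Metric.closedBall 0 R).indicator fun _ => M with hbd
  have hbi : Integrable bound :=
    (integrable_indicator_iff Metric.isClosed_closedBall.measurableSet).2
      (integrableOn_const (isCompact_closedBall _ _).measure_lt_top.ne)
  have hb : ∀ (t : ℝ) (y : H), ‖h (x₀ + (t • v + y))‖ ≤ bound y := by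
    intro t y
    by_cases hy : y ∈ Metric.closedBall (0 : H) R
    · rw [hbd, indicator_of_mem hy]
      exact hM _
    · rw [hbd, indicator_of_notMem hy, norm_le_zero_iff]
      apply image_eq_zero_of_notMem_tsupport
      intro hmem
      apply hy
      have h1 := hR hmem
      rw [mem_closedBall_iff_norm, add_sub_cancel_left] at h1
      rw [mem_closedBall_zero_iff]
      refine le_trans ?_ h1
      refine abs_le_of_sq_le_sq' ?_ (norm_nonneg _) |>.2
      have h2 := norm_add_sq_real (t • v) (y : Pt d)
      rw [real_inner_smul_left, horth y] at h2
      have : ‖y‖ = ‖(y : Pt d)‖ := rfl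
      rw [this]
      nlinarith [sq_nonneg ‖t • v‖]
  have hJc : Continuous J := continuous_of_dominated
    (fun t => (by fun_prop : Continuous fun y : H => h (x₀ + (t • v + y))).aestronglyMeasurable)
    (fun t => Eventually.of_forall (hb t)) hbi
    (Eventually.of_forall fun y => by fun_prop)
  have hJb : ∀ t, ‖J t‖ ≤ ∫ y, bound y := fun t =>
    norm_integral_le_of_norm_le hbi (Eventually.of_forall (hb t))
  have hJ0 : ∫ y in {y : Pt d | inner ℝ v (y - x₀) = 0}, h y ∂(μHE[d - 1] : Measure (Pt d))
      = J 0 := by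
    rw [integral_hyperplane hv]
    simp only [hJ, zero_smul, zero_add]
    rfl
  have hk : ∀ δ : ℝ, 0 < δ → ∫ y, δ⁻¹ * bumpKernel (a * inner ℝ v (y - x₀) / δ) * h y =
      a⁻¹ * ∫ t, bumpKernel t * J (δ / a * t) := by
    intro δ hδ
    have hmp := measurePreserving_normal_coordinates hv x₀
    have hint : Integrable fun y => δ⁻¹ * bumpKernel (a * inner ℝ v (y - x₀) / δ) * h y := by
      refine Continuous.integrable_of_hasCompactSupport ?_ hs.mul_left
      have := continuous_bumpKernel
      fun_prop
    have hint2 := hmp.integrable_comp_of_integrable hint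
    rw [← hmp.map_eq, integral_map hmp.aemeasurable (by
      rw [hmp.map_eq]; exact hint.aestronglyMeasurable)]
    refine (integral_prod _ hint2).trans ?_
    have e1 : ∀ t : ℝ, ∫ y : H, δ⁻¹ * bumpKernel (a * inner ℝ v ((x₀ + (t • v + (y : Pt d))) - x₀)
        / δ) * h (x₀ + (t • v + y)) = δ⁻¹ * (bumpKernel (a / δ * t) * J (δ / a * (a / δ * t))) := by
      intro t
      have e2 : δ / a * (a / δ * t) = t := by field_simp
      rw [e2, hJ, ← integral_const_mul, ← integral_const_mul]
      refine integral_congr_ae (Eventually.of_forall fun y => ?_)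
      simp only
      rw [add_sub_cancel_left, inner_add_right, horth y, real_inner_smul_right,
        real_inner_self_eq_norm_sq, hv]
      ring_nf
    refine (integral_congr_ae (Eventually.of_forall e1)).trans ?_
    rw [integral_const_mul, Measure.integral_comp_mul_left
      (fun t => bumpKernel t * J (δ / a * t)) (a / δ), abs_of_pos (by positivity), smul_eq_mul]
    field_simp
  rw [hJ0]
  have hlim : Tendsto (fun δ : ℝ => ∫ t, bumpKernel t * J (δ / a * t)) (𝓝[>] 0) (𝓝 (J 0)) := by
    have : J 0 = ∫ t, bumpKernel t * J 0 := by
      rw [integral_mul_const, integral_bumpKernel, one_mul]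
    rw [this]
    refine tendsto_integral_filter_of_dominated_convergence
      (fun t => bumpKernel t * ∫ y, bound y) ?_ ?_ (integrable_bumpKernel.mul_const _) ?_
    · exact Eventually.of_forall fun δ =>
        (continuous_bumpKernel.mul (hJc.comp (by fun_prop))).aestronglyMeasurable
    · refine Eventually.of_forall fun δ => Eventually.of_forall fun t => ?_
      rw [norm_mul, Real.norm_of_nonneg (bumpKernel_nonneg t)]
      exact mul_le_mul_of_nonneg_left (hJb _) (bumpKernel_nonneg t)
    · refine Eventually.of_forall fun t => ?_
      have h1 : Tendsto (fun δ : ℝ => J (δ / a * t)) (𝓝 0) (𝓝 (J 0)) := by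
        have : Continuous fun δ : ℝ => J (δ / a * t) := hJc.comp (by fun_prop)
        simpa using this.tendsto 0
      exact (h1.mono_left nhdsWithin_le_nhds).const_mul _
  refine (hlim.const_mul a⁻¹).congr' ?_
  filter_upwards [self_mem_nhdsWithin] with δ hδ
  exact (hk δ hδ).symm

end ElasticWave

/-! ### Nearly isometric charts and Hausdorff measure -/

namespace ElasticWave

variable {d : ℕ}

/-- Near a regular point, a smooth function `r` becomes affine in a chart that is arbitrarily close
to an isometry. -/
theorem exists_nearly_isometric_chart {r : Pt d → ℝ} (hr : ContDiff ℝ ∞ r) {x₀ : Pt d}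
    (hg : gradient r x₀ ≠ 0) {K : NNReal} (hK : 1 < K) :
    ∃ e : OpenPartialHomeomorph (Pt d) (Pt d), x₀ ∈ e.source ∧ Continuous e ∧
      (∀ x, ‖gradient r x₀‖ * inner ℝ (‖gradient r x₀‖⁻¹ • gradient r x₀) (e x - x₀) = r x) ∧
      LipschitzOnWith K e e.source ∧ LipschitzOnWith K e.symm e.target ∧
      ∀ x ∈ e.source, ‖gradient r x‖ ≤ K * ‖gradient r x₀‖ ∧
        ‖gradient r x₀‖ ≤ K * ‖gradient r x‖ := by
  set a := ‖gradient r x₀‖ with ha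
  have ha0 : 0 < a := norm_pos_iff.2 hg
  set v := a⁻¹ • gradient r x₀ with hv
  have hvn : ‖v‖ = 1 := by
    rw [hv, norm_smul, norm_inv, norm_norm, ← ha, inv_mul_cancel₀ ha0.ne']
  have hvv : inner ℝ v v = (1 : ℝ) := by rw [real_inner_self_eq_norm_sq, hvn]; norm_num
  -- `G` replaces the normal coordinate `⟨v, x - x₀⟩` by `r(x)/a` and keeps the tangential ones. Its
  -- derivative at `x₀` is the identity because `∇r(x₀) = a v`.
  set G : Pt d → Pt d := fun x => x + (a⁻¹ * r x - inner ℝ v (x - x₀)) • v with hG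
  have hGc : Continuous G := by
    have := hr.continuous
    fun_prop
  have hGr : ∀ x, a * inner ℝ v (G x - x₀) = r x := by
    intro x
    have : G x - x₀ = (x - x₀) + (a⁻¹ * r x - inner ℝ v (x - x₀)) • v := by
      simp only [hG]; abel
    rw [this, inner_add_right, real_inner_smul_right, hvv]
    field_simp
    ring
  have hder : HasStrictFDerivAt G
      ((ContinuousLinearEquiv.refl ℝ (Pt d) : Pt d ≃L[ℝ] Pt d) : Pt d →L[ℝ] Pt d) x₀ := by
    have hrs : HasStrictFDerivAt r (fderiv ℝ r x₀) x₀ := hr.contDiffAt.hasStrictFDerivAt (by simp)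
    have h1 : HasStrictFDerivAt (fun x => inner ℝ v (x - x₀)) (innerSL ℝ v) x₀ :=
      HasStrictFDerivAt.comp (f := fun x => x - x₀) (g := innerSL ℝ v) x₀
        (innerSL ℝ v).hasStrictFDerivAt ((hasStrictFDerivAt_id x₀).sub_const x₀)
    have h2 := (hasStrictFDerivAt_id x₀).add (((hrs.const_mul a⁻¹).sub h1).smul_const v)
    refine (show HasStrictFDerivAt G _ x₀ from h2).congr_fderiv ?_
    ext1 y
    have h3 : fderiv ℝ r x₀ y = inner ℝ (gradient r x₀) y := by
      rw [gradient, InnerProductSpace.toDual_symm_apply]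
    have h4 : (a⁻¹ • fderiv ℝ r x₀ - innerSL ℝ v) y = 0 := by
      rw [sub_apply, smul_apply, h3, innerSL_apply_apply,
        hv, real_inner_smul_left, smul_eq_mul, sub_self]
    rw [add_apply, ContinuousLinearMap.smulRight_apply, h4, zero_smul, add_zero]
    rfl
  -- With `c = 1 - K⁻¹`, the map `G` has Lipschitz constant `1 + c = 2 - K⁻¹ ≤ K`, and its inverse
  -- has `(1 - c)⁻¹ = K`.
  obtain ⟨s, hs, hap⟩ := hder.approximates_deriv_on_nhds (c := 1 - K⁻¹)
    (Or.inr (tsub_pos_of_lt (inv_lt_one_of_one_lt₀ hK)))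
  have hKr : (1 : ℝ) < K := by exact_mod_cast hK
  have hcr : ((1 - K⁻¹ : NNReal) : ℝ) = 1 - (K : ℝ)⁻¹ := by
    rw [NNReal.coe_sub (inv_le_one_of_one_le₀ hK.le)]
    simp
  have hgc : Continuous fun x => ‖gradient r x‖ := by
    have h : Continuous (gradient r) := by
      unfold gradient
      exact (LinearIsometryEquiv.continuous _).comp (hr.continuous_fderiv (by simp))
    exact h.norm
  have hn1 : ∀ᶠ x in 𝓝 x₀, ‖gradient r x‖ < K * a :=
    hgc.continuousAt.eventually_lt continuousAt_const (by nlinarith)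
  have hn2 : ∀ᶠ x in 𝓝 x₀, a < K * ‖gradient r x‖ :=
    continuousAt_const.eventually_lt (hgc.continuousAt.const_mul _) (by
      rw [← ha]; nlinarith)
  obtain ⟨u, hu, huo, hxu⟩ := mem_nhds_iff.1 (inter_mem hs (inter_mem hn1 hn2))
  set e := (hder.toOpenPartialHomeomorph G).restrOpen u huo with he
  have hec : (e : Pt d → Pt d) = G := rfl
  have hsrc : e.source ⊆ u := by
    rw [he, OpenPartialHomeomorph.restrOpen_source]
    exact inter_subset_right
  have hest : ∀ x ∈ e.source, ∀ y ∈ e.source, ‖(G x - G y) - (x - y)‖ ≤ (1 - (K : ℝ)⁻¹) * ‖x - y‖ := by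
    intro x hx y hy
    have := hap x (hu (hsrc hx)).1 y (hu (hsrc hy)).1
    rw [hcr] at this
    simpa using this
  have hKi : (K : ℝ) * (K : ℝ)⁻¹ = 1 := mul_inv_cancel₀ (by positivity)
  refine ⟨e, ?_, hGc, hGr, ?_, ?_, ?_⟩
  · rw [he, OpenPartialHomeomorph.restrOpen_source]
    exact ⟨hder.mem_toOpenPartialHomeomorph_source, hxu⟩
  · refine LipschitzOnWith.of_dist_le_mul fun x hx y hy => ?_
    rw [hec, dist_eq_norm, dist_eq_norm]
    have h1 := hest x hx y hy
    have h2 := norm_add_le ((G x - G y) - (x - y)) (x - y)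
    rw [sub_add_cancel] at h2
    have h3 : 2 - (K : ℝ)⁻¹ ≤ K := by
      have : 0 < (K : ℝ)⁻¹ := by positivity
      nlinarith [sq_nonneg ((K : ℝ) - 1)]
    nlinarith [norm_nonneg (x - y)]
  · refine LipschitzOnWith.of_dist_le_mul fun x hx y hy => ?_
    have h1 := hest _ (e.map_target hx) _ (e.map_target hy)
    rw [← hec, e.right_inv hx, e.right_inv hy] at h1
    rw [dist_eq_norm, dist_eq_norm]
    have h2 := norm_sub_norm_le (e.symm x - e.symm y) (x - y)
    rw [norm_sub_rev (e.symm x - e.symm y)] at h2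
    have h3 : (K : ℝ)⁻¹ * ‖e.symm x - e.symm y‖ ≤ ‖x - y‖ := by linarith
    calc ‖e.symm x - e.symm y‖ = K * ((K : ℝ)⁻¹ * ‖e.symm x - e.symm y‖) := by
          rw [← mul_assoc, hKi, one_mul]
      _ ≤ K * ‖x - y‖ := by gcongr
  · intro x hx
    exact ⟨(hu (hsrc hx)).2.1.le, (hu (hsrc hx)).2.2.le⟩

theorem euclideanHausdorffMeasure_image_le {f : Pt d → Pt d} {K : NNReal} {s : Set (Pt d)}
    (hf : LipschitzOnWith K f s) (n : ℕ) :
    (μHE[n] : Measure (Pt d)) (f '' s) ≤ K ^ n * (μHE[n] : Measure (Pt d)) s := by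
  have h := hf.hausdorffMeasure_image_le (d := n) (Nat.cast_nonneg n)
  rw [ENNReal.rpow_natCast] at h
  rw [Measure.euclideanHausdorffMeasure_def, Measure.smul_apply, Measure.smul_apply]
  simp only [ENNReal.smul_def, smul_eq_mul]
  rw [mul_left_comm]
  gcongr

/-- A chart that is `K`-Lipschitz in both directions distorts integrals with respect to
`n`-dimensional Hausdorff measure by a factor of at most `Kⁿ`. -/
theorem integral_chart_le (e : OpenPartialHomeomorph (Pt d) (Pt d)) (hec : Continuous e)
    {K : NNReal} (h1 : LipschitzOnWith K e e.source) (h2 : LipschitzOnWith K e.symm e.target)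
    (n : ℕ) {k : Pt d → ℝ} (hk : Measurable k) (hk0 : ∀ y, 0 ≤ k y)
    (hi : IntegrableOn (fun x => k (e x)) e.source (μHE[n] : Measure (Pt d))) :
    ∫ x in e.source, k (e x) ∂(μHE[n] : Measure (Pt d)) ≤
        K ^ n * ∫ y in e.target, k y ∂(μHE[n] : Measure (Pt d)) ∧
      ∫ y in e.target, k y ∂(μHE[n] : Measure (Pt d)) ≤
        K ^ n * ∫ x in e.source, k (e x) ∂(μHE[n] : Measure (Pt d)) := by
  set μ := (μHE[n] : Measure (Pt d))
  have himg : ∀ B : Set (Pt d), e.symm '' (e.target ∩ B) = e.source ∩ e ⁻¹' B := fun B => by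
    rw [e.symm_image_target_inter_eq, preimage_inter, ← inter_assoc,
      (inter_eq_left (s := e.source) (t := e ⁻¹' e.target)).2 e.source_subset_preimage_target]
  have himg2 : ∀ B : Set (Pt d), e '' (e.source ∩ e ⁻¹' B) = e.target ∩ B := fun B => by
    rw [← himg, ← image_comp]
    refine (image_congr fun y hy => ?_).trans (image_id _)
    exact e.right_inv hy.1
  -- The push-forward of `μ` on the source and `μ` on the target are comparable in both directions;
  -- each inequality uses the Lipschitz bound of one of `e.symm` and `e`. The integral bounds follow
  -- by monotonicity in the measure, which is where `0 ≤ k` enters.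
  have hc1 : (μ.restrict e.source).map e ≤ ((K ^ n : NNReal)) • μ.restrict e.target := by
    refine Measure.le_iff.2 fun B hB => ?_
    rw [Measure.map_apply hec.measurable hB, Measure.restrict_apply (hec.measurable hB),
      Measure.smul_apply, Measure.restrict_apply hB, inter_comm, ← himg, inter_comm B]
    have := euclideanHausdorffMeasure_image_le (h2.mono inter_subset_left : LipschitzOnWith K e.symm
      (e.target ∩ B)) n
    simpa [ENNReal.smul_def] using this
  have hc2 : μ.restrict e.target ≤ ((K ^ n : NNReal)) • (μ.restrict e.source).map e := by
    refine Measure.le_iff.2 fun B hB => ?_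
    rw [Measure.smul_apply, Measure.map_apply hec.measurable hB,
      Measure.restrict_apply (hec.measurable hB), Measure.restrict_apply hB, inter_comm,
      ← himg2, inter_comm _ e.source]
    have := euclideanHausdorffMeasure_image_le (h1.mono inter_subset_left : LipschitzOnWith K e
      (e.source ∩ e ⁻¹' B)) n
    simpa [ENNReal.smul_def] using this
  have hi1 : Integrable k ((μ.restrict e.source).map e) :=
    (integrable_map_measure hk.aestronglyMeasurable hec.aemeasurable).2 hi
  have hi2 : Integrable k (((K ^ n : NNReal)) • (μ.restrict e.source).map e) :=
    hi1.smul_measure_nnreal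
  have hi3 : Integrable k (μ.restrict e.target) := hi2.mono_measure hc2
  have hi4 : Integrable k (((K ^ n : NNReal)) • (μ.restrict e.target)) := hi3.smul_measure_nnreal
  have hmap : ∫ x in e.source, k (e x) ∂μ = ∫ y, k y ∂((μ.restrict e.source).map e) :=
    (integral_map hec.aemeasurable hk.aestronglyMeasurable).symm
  constructor
  · rw [hmap]
    refine (integral_mono_measure hc1 (Eventually.of_forall hk0) hi4).trans (le_of_eq ?_)
    rw [integral_smul_nnreal_measure, NNReal.smul_def]
    simp
  · rw [hmap]
    refine (integral_mono_measure hc2 (Eventually.of_forall hk0) hi2).trans (le_of_eq ?_)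
    rw [integral_smul_nnreal_measure, NNReal.smul_def]
    simp

end ElasticWave

/-! ### Boundary layers near one boundary point -/

namespace ElasticWave

variable {d : ℕ}

namespace SmoothDomain

variable (D : SmoothDomain d)

/-- A zero of `r` in the interior of `Ω` would be a local maximum, hence a critical point, which
regularity excludes. -/
theorem mem_bdry_iff {x : Pt d} : x ∈ D.bdry ↔ D.r x = 0 := by
  refine ⟨D.r_eq_zero, fun h => ?_⟩
  rw [bdry, D.isCompact_Om.isClosed.frontier_eq]
  refine ⟨le_of_eq h, fun hi => D.regular x h ?_⟩
  have hmax : IsLocalMax D.r x := by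
    filter_upwards [mem_interior_iff_mem_nhds.1 hi] with y hy
    rw [h]
    exact hy
  rw [gradient, hmax.fderiv_eq_zero, map_zero]

theorem mem_interior_of_neg {x : Pt d} (h : D.r x < 0) : x ∈ interior D.Om :=
  mem_interior.2 ⟨{y | D.r y < 0}, fun y (hy : D.r y < 0) => show D.r y ≤ 0 from hy.le,
    isOpen_lt D.smooth.continuous continuous_const, h⟩

theorem continuous_norm_gradient : Continuous fun x => ‖gradient D.r x‖ := by
  have h : Continuous (gradient D.r) := by
    unfold gradient
    exact (LinearIsometryEquiv.continuous _).comp (D.smooth.continuous_fderiv (by simp))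
  exact h.norm

/-- The mean of `G` over a thin layer inside `Ω` along the boundary, of width of order `δ`. -/
noncomputable def layerIntegral (G : Pt d → ℝ) (δ : ℝ) : ℝ :=
  ∫ x, δ⁻¹ * bumpKernel (D.r x / δ) * G x

/-- The limit of `layerIntegral` for thin layers. -/
noncomputable def surfaceIntegral (G : Pt d → ℝ) : ℝ :=
  ∫ x, G x * ‖gradient D.r x‖⁻¹ ∂D.surf

/-- In a nearly isometric chart the layer becomes a slab around a hyperplane, whose limit is known.
The constant collects `K ^ d` from the volume, `K ^ (d - 1)` from the surface measure and `K` from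
freezing `|∇r|` at `x₀`; `ε` absorbs the distance of the slab integral to its limit. -/
theorem exists_layer_comparison (hd : 1 ≤ d) {x₀ : Pt d} (hx₀ : x₀ ∈ D.bdry) {K : NNReal}
    (hK : 1 < K) : ∃ U : Set (Pt d), IsOpen U ∧ x₀ ∈ U ∧ ∀ g : Pt d → ℝ, Continuous g →
      (∀ x, 0 ≤ g x) → HasCompactSupport g → tsupport g ⊆ U → ∀ ε > 0, ∀ᶠ δ in 𝓝[>] (0 : ℝ),
        D.layerIntegral g δ ≤ K ^ (2 * d) * D.surfaceIntegral g + ε ∧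
        D.surfaceIntegral g ≤ K ^ (2 * d) * D.layerIntegral g δ + ε := by
  have hg0 := D.regular x₀ (D.r_eq_zero hx₀)
  obtain ⟨e, hxe, hec, her, hl1, hl2, hgr⟩ := exists_nearly_isometric_chart D.smooth hg0 hK
  set a := ‖gradient D.r x₀‖ with ha
  have ha0 : 0 < a := norm_pos_iff.2 hg0
  set v := a⁻¹ • gradient D.r x₀ with hv
  have hvn : ‖v‖ = 1 := by
    rw [hv, norm_smul, norm_inv, norm_norm, ← ha, inv_mul_cancel₀ ha0.ne']
  have hK0 : (1 : ℝ) < K := by exact_mod_cast hK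
  refine ⟨e.source, e.open_source, hxe, fun g hgc hg hgs hgU ε hε => ?_⟩
  -- `h` is `g` read in the chart and extended by zero. The extension is continuous because the
  -- support of `g` is compact inside the chart domain.
  set h : Pt d → ℝ := e.target.indicator fun y => g (e.symm y) with hh
  have hhe : ∀ x ∈ e.source, h (e x) = g x := fun x hx => by
    rw [hh, indicator_of_mem (e.map_source hx), e.left_inv hx]
  have hh0 : ∀ y, 0 ≤ h y := fun y => indicator_nonneg (fun _ _ => hg _) y
  have hcomp : IsCompact (e '' tsupport g) := hgs.isCompact.image hec
  have hhz : ∀ y, y ∉ e '' tsupport g → h y = 0 := by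
    intro y hy
    by_cases hyt : y ∈ e.target
    · rw [hh, indicator_of_mem hyt]
      refine image_eq_zero_of_notMem_tsupport fun h1 => hy ⟨_, h1, e.right_inv hyt⟩
    · rw [hh, indicator_of_notMem hyt]
  have hhs : HasCompactSupport h := HasCompactSupport.intro hcomp hhz
  have hhc : Continuous h := by
    refine continuous_iff_continuousAt.2 fun y => ?_
    by_cases hyt : y ∈ e.target
    · have h1 : ContinuousAt (fun y => g (e.symm y)) y :=
        hgc.continuousAt.comp (e.continuousAt_symm hyt)
      refine h1.congr ?_
      filter_upwards [e.open_target.mem_nhds hyt] with z hz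
      rw [hh, indicator_of_mem hz]
    · have hy : y ∈ (e '' tsupport g)ᶜ := fun ⟨x, hx, hxy⟩ => hyt (hxy ▸ e.map_source (hgU hx))
      refine (continuousAt_const (y := (0 : ℝ))).congr ?_
      filter_upwards [hcomp.isClosed.isOpen_compl.mem_nhds hy] with z hz
      exact (hhz z hz).symm
  have hgz : ∀ x, x ∉ e.source → g x = 0 := fun x hx =>
    image_eq_zero_of_notMem_tsupport fun h1 => hx (hgU h1)
  set μ := (μHE[d - 1] : Measure (Pt d)) with hμ
  set P : Set (Pt d) := {y | inner ℝ v (y - x₀) = 0} with hP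
  have hPm : MeasurableSet P :=
    (isClosed_eq (by fun_prop) continuous_const).measurableSet
  have hbm : MeasurableSet D.bdry := isClosed_frontier.measurableSet
  -- the surface terms
  have hPe : ∀ x, e x ∈ P ↔ x ∈ D.bdry := fun x => by
    rw [D.mem_bdry_iff, ← her x, hP, mem_ofPred_eq, mul_eq_zero, or_iff_right ha0.ne']
  have hk1 : ∀ x ∈ e.source, P.indicator h (e x) = D.bdry.indicator g x := fun x hx => by
    by_cases hxb : x ∈ D.bdry
    · rw [indicator_of_mem hxb, indicator_of_mem ((hPe x).2 hxb), hhe x hx]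
    · rw [indicator_of_notMem hxb, indicator_of_notMem fun hc => hxb ((hPe x).1 hc)]
  have hgint : Integrable g D.surf :=
    hgc.integrable_of_hasCompactSupport hgs
  have hgint2 : Integrable (D.bdry.indicator g) μ := (integrable_indicator_iff hbm).2 hgint
  have hsurf := integral_chart_le e hec hl1 hl2 (d - 1) (k := P.indicator h)
    (hhc.measurable.indicator hPm) (fun y => indicator_nonneg (fun _ _ => hh0 _) y)
    ((hgint2.integrableOn (s := e.source)).congr_fun (fun x hx => (hk1 x hx).symm)
      e.open_source.measurableSet)
  have hs1 : ∫ x in e.source, P.indicator h (e x) ∂μ = ∫ x, g x ∂D.surf := by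
    rw [setIntegral_congr_fun e.open_source.measurableSet hk1,
      setIntegral_eq_integral_of_forall_compl_eq_zero, integral_indicator hbm]
    · rfl
    · intro x hx
      rw [indicator_apply_eq_zero]
      exact fun _ => hgz x hx
  have hs2 : ∫ y in e.target, P.indicator h y ∂μ = ∫ y in P, h y ∂μ := by
    rw [setIntegral_eq_integral_of_forall_compl_eq_zero, integral_indicator hPm]
    intro y hy
    rw [indicator_apply_eq_zero]
    exact fun _ => by rw [hh, indicator_of_notMem hy]
  rw [hs1, hs2] at hsurf
  set B := ∫ x, g x ∂D.surf with hB
  set L := ∫ y in P, h y ∂μ with hL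
  have hB0 : 0 ≤ B := integral_nonneg hg
  have hL0 : 0 ≤ L := integral_nonneg hh0
  -- the layer terms
  have hvol : ∀ δ > 0, D.layerIntegral g δ ≤
        K ^ d * ∫ y, δ⁻¹ * bumpKernel (a * inner ℝ v (y - x₀) / δ) * h y ∧
      ∫ y, δ⁻¹ * bumpKernel (a * inner ℝ v (y - x₀) / δ) * h y ≤
        K ^ d * D.layerIntegral g δ := by
    intro δ hδ
    have hbk := continuous_bumpKernel
    have hrc := D.smooth.continuous
    have hkk : ∀ x ∈ e.source, δ⁻¹ * bumpKernel (a * inner ℝ v (e x - x₀) / δ) * h (e x) =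
        δ⁻¹ * bumpKernel (D.r x / δ) * g x := fun x hx => by rw [hhe x hx, her x]
    have hi : Integrable fun x => δ⁻¹ * bumpKernel (D.r x / δ) * g x :=
      Continuous.integrable_of_hasCompactSupport (by fun_prop) hgs.mul_left
    have h1 := integral_chart_le e hec hl1 hl2 d
      (k := fun y => δ⁻¹ * bumpKernel (a * inner ℝ v (y - x₀) / δ) * h y)
      (by fun_prop : Continuous _).measurable
      (fun y => mul_nonneg (mul_nonneg (by positivity) (bumpKernel_nonneg _)) (hh0 y))
      (by
        rw [EuclideanSpace.euclideanHausdorffMeasure_eq_volume]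
        exact (hi.integrableOn (s := e.source)).congr_fun (fun x hx => (hkk x hx).symm)
          e.open_source.measurableSet)
    rw [EuclideanSpace.euclideanHausdorffMeasure_eq_volume,
      setIntegral_congr_fun e.open_source.measurableSet hkk,
      setIntegral_eq_integral_of_forall_compl_eq_zero (s := e.source),
      setIntegral_eq_integral_of_forall_compl_eq_zero (s := e.target)] at h1
    · exact h1
    · intro y hy
      rw [hh, indicator_of_notMem hy, mul_zero]
    · intro x hx
      rw [hgz x hx, mul_zero]
  have hQ := tendsto_integral_slab hvn x₀ ha0 hhc hhs
  rw [← hP, ← hμ, ← hL] at hQ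
  -- the gradient factor
  have hgrad : ∀ x ∈ e.source, a⁻¹ ≤ K * ‖gradient D.r x‖⁻¹ ∧ ‖gradient D.r x‖⁻¹ ≤ K * a⁻¹ := by
    intro x hx
    obtain ⟨h1, h2⟩ := hgr x hx
    have h3 : 0 < ‖gradient D.r x‖ := by
      by_contra hn
      have : ‖gradient D.r x‖ = 0 := le_antisymm (not_lt.1 hn) (norm_nonneg _)
      rw [this, mul_zero] at h2
      exact absurd h2 (not_le.2 ha0)
    constructor
    · rw [← div_eq_mul_inv, inv_eq_one_div, div_le_div_iff₀ ha0 h3, one_mul]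
      exact h1
    · rw [← div_eq_mul_inv, inv_eq_one_div, div_le_div_iff₀ h3 ha0, one_mul]
      exact h2
  have hSint : Integrable (fun x => g x * ‖gradient D.r x‖⁻¹) D.surf := by
    refine (memLp_one_iff_integrable.1 ?_)
    have hcon : ContinuousOn (fun x => g x * ‖gradient D.r x‖⁻¹) D.bdry :=
      hgc.continuousOn.mul (D.continuous_norm_gradient.continuousOn.inv₀ fun x hx =>
        norm_ne_zero_iff.2 (D.regular x (D.r_eq_zero hx)))
    obtain ⟨C, hC⟩ := D.isCompact_bdry.exists_bound_of_continuousOn hcon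
    refine MemLp.of_bound (hcon.aestronglyMeasurable hbm) C ?_
    filter_upwards [ae_restrict_mem hbm] with x hx using hC x hx
  have hS1 : a⁻¹ * B ≤ K * D.surfaceIntegral g := by
    rw [hB, surfaceIntegral, ← integral_const_mul, ← integral_const_mul]
    refine integral_mono (hgint.const_mul _) (hSint.const_mul _) fun x => ?_
    by_cases hx : x ∈ e.source
    · have := mul_le_mul_of_nonneg_left (hgrad x hx).1 (hg x)
      simp only
      linarith
    · simp [hgz x hx]
  have hS2 : D.surfaceIntegral g ≤ K * (a⁻¹ * B) := by
    rw [hB, surfaceIntegral, ← integral_const_mul, ← integral_const_mul]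
    refine integral_mono hSint ((hgint.const_mul _).const_mul _) fun x => ?_
    by_cases hx : x ∈ e.source
    · have := mul_le_mul_of_nonneg_left (hgrad x hx).2 (hg x)
      simp only
      linarith
    · simp [hgz x hx]
  have hKd : (0 : ℝ) < K ^ d := by positivity
  -- The error in the slab limit is multiplied by `K ^ d` when returning to the layer.
  set ε' := ε / K ^ d with hε'
  have hε0 : 0 < ε' := by positivity
  have hKe : (K : ℝ) ^ d * ε' = ε := by rw [hε']; field_simp
  have hdd : (K : ℝ) ^ d = K * K ^ (d - 1) := by
    rw [← pow_succ', Nat.sub_add_cancel hd]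
  have hd2 : (K : ℝ) ^ (2 * d) = K ^ d * K ^ d := by rw [two_mul, pow_add]
  filter_upwards [self_mem_nhdsWithin, hQ.eventually_lt_const (lt_add_of_pos_right _ hε0),
    hQ.eventually_const_lt (sub_lt_self _ hε0)] with δ hδ hq1 hq2
  obtain ⟨hv1, hv2⟩ := hvol δ hδ
  set Q := ∫ y, δ⁻¹ * bumpKernel (a * inner ℝ v (y - x₀) / δ) * h y
  have hai : 0 < a⁻¹ := by positivity
  constructor
  · calc D.layerIntegral g δ ≤ K ^ d * Q := hv1
      _ ≤ K ^ d * (a⁻¹ * L + ε') := by gcongr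
      _ = K ^ d * (a⁻¹ * L) + ε := by rw [mul_add, hKe]
      _ ≤ K ^ d * (a⁻¹ * (K ^ (d - 1) * B)) + ε := by gcongr; exact hsurf.2
      _ = K ^ d * K ^ (d - 1) * (a⁻¹ * B) + ε := by ring
      _ ≤ K ^ d * K ^ (d - 1) * (K * D.surfaceIntegral g) + ε := by gcongr
      _ = K ^ (2 * d) * D.surfaceIntegral g + ε := by rw [hd2, hdd]; ring
  · calc D.surfaceIntegral g ≤ K * (a⁻¹ * B) := hS2
      _ ≤ K * (a⁻¹ * (K ^ (d - 1) * L)) := by gcongr; exact hsurf.1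
      _ = K ^ d * (a⁻¹ * L) := by rw [hdd]; ring
      _ ≤ K ^ d * (Q + ε') := by gcongr; linarith
      _ = K ^ d * Q + ε := by rw [mul_add, hKe]
      _ ≤ K ^ d * (K ^ d * D.layerIntegral g δ) + ε := by gcongr
      _ = K ^ (2 * d) * D.layerIntegral g δ + ε := by rw [hd2]; ring

end SmoothDomain

end ElasticWave

/-! ### Limit of boundary layers on the whole domain -/

namespace ElasticWave

variable {d : ℕ}

namespace SmoothDomain

variable (D : SmoothDomain d)

/-- A neighbourhood of the boundary contains all thin layers inside `Ω` along the boundary. -/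
theorem eventually_layer_subset {N : Set (Pt d)} (hN : D.bdry ⊆ interior N) :
    ∀ᶠ δ in 𝓝[>] (0 : ℝ), ∀ x, D.r x ∈ Ioo (-(2 * δ)) 0 → x ∈ N := by
  have hc : IsCompact (D.Om \ interior N) := D.isCompact_Om.diff isOpen_interior
  have hneg : ∀ x ∈ D.Om \ interior N, D.r x < 0 := fun x hx =>
    lt_of_le_of_ne (show D.r x ≤ 0 from hx.1) fun h => hx.2 (hN (D.mem_bdry_iff.2 h))
  -- Away from the boundary, on the compact set `Ω` minus the interior of `N`, the function `r` is
  -- bounded above by a negative constant.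
  obtain ⟨m, hm, hmx⟩ : ∃ m < 0, ∀ x ∈ D.Om \ interior N, D.r x ≤ m := by
    rcases (D.Om \ interior N).eq_empty_or_nonempty with he | hne
    · exact ⟨-1, by norm_num, by simp [he]⟩
    · obtain ⟨x, hx, hmax⟩ := hc.exists_isMaxOn hne D.smooth.continuous.continuousOn
      exact ⟨D.r x, hneg x hx, fun y hy => hmax hy⟩
  filter_upwards [Ioo_mem_nhdsGT (show (0 : ℝ) < -m / 2 by linarith)] with δ hδ x hx
  by_contra hn
  have := hmx x ⟨show D.r x ≤ 0 from hx.2.le, fun hi => hn (interior_subset hi)⟩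
  linarith [hx.1, hδ.2]

theorem layer_weight_eq_zero {δ : ℝ} (hδ : 0 < δ) {x : Pt d} (hx : D.r x ∉ Ioo (-(2 * δ)) 0) :
    bumpKernel (D.r x / δ) = 0 := by
  apply bumpKernel_eq_zero
  rintro ⟨h1, h2⟩
  apply hx
  rw [lt_div_iff₀ hδ] at h1
  rw [div_lt_iff₀ hδ] at h2
  exact ⟨by linarith, by linarith⟩

theorem integrable_layer {G : Pt d → ℝ} (hG : Continuous G) {δ : ℝ} (hδ : 0 < δ) :
    Integrable fun x => δ⁻¹ * bumpKernel (D.r x / δ) * G x := by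
  have hbk := continuous_bumpKernel
  have hrc := D.smooth.continuous
  refine Continuous.integrable_of_hasCompactSupport (by fun_prop)
    (HasCompactSupport.intro D.isCompact_Om fun x hx => ?_)
  rw [D.layer_weight_eq_zero hδ fun h => hx (show D.r x ≤ 0 from h.2.le)]
  simp

theorem integrable_surface {G : Pt d → ℝ} (hG : Continuous G) :
    Integrable (fun x => G x * ‖gradient D.r x‖⁻¹) D.surf := by
  have hbm : MeasurableSet D.bdry := isClosed_frontier.measurableSet
  refine (memLp_one_iff_integrable.1 ?_)
  have hcon : ContinuousOn (fun x => G x * ‖gradient D.r x‖⁻¹) D.bdry :=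
    hG.continuousOn.mul (D.continuous_norm_gradient.continuousOn.inv₀ fun x hx =>
      norm_ne_zero_iff.2 (D.regular x (D.r_eq_zero hx)))
  obtain ⟨C, hC⟩ := D.isCompact_bdry.exists_bound_of_continuousOn hcon
  refine MemLp.of_bound (hcon.aestronglyMeasurable hbm) C ?_
  filter_upwards [ae_restrict_mem hbm] with x hx using hC x hx

/-- The local comparisons are summed over a finite partition of unity that equals one on a
neighbourhood of the boundary; thin layers lie in this neighbourhood, so nothing is lost. -/
theorem eventually_layer_comparison (hd : 1 ≤ d) {K : NNReal} (hK : 1 < K) {G : Pt d → ℝ}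
    (hG : Continuous G) (hG0 : ∀ x, 0 ≤ G x) {ε : ℝ} (hε : 0 < ε) :
    ∀ᶠ δ in 𝓝[>] (0 : ℝ),
      D.layerIntegral G δ ≤ K ^ (2 * d) * D.surfaceIntegral G + ε ∧
      D.surfaceIntegral G ≤ K ^ (2 * d) * D.layerIntegral G δ + ε := by
  choose! U hUo hUx hU using fun x (hx : x ∈ D.bdry) => D.exists_layer_comparison hd hx hK
  obtain ⟨t, ht, hcov⟩ := D.isCompact_bdry.elim_nhds_subcover U
    fun x hx => (hUo x hx).mem_nhds (hUx x hx)
  obtain ⟨N, hNc, hN1, hN2⟩ := exists_compact_between D.isCompact_bdry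
    (isOpen_biUnion fun x hx => hUo x (ht x hx)) hcov
  let s : Fin t.card → Set (Pt d) := fun i => U (t.equivFin.symm i)
  obtain ⟨f, hf1, hf2, hf3, hf4⟩ := exists_continuous_sum_one_of_isOpen_isCompact (s := s)
    (fun i => hUo _ (ht _ (t.equivFin.symm i).2)) hNc (by
      intro x hx
      obtain ⟨y, hy, hxy⟩ := mem_iUnion₂.1 (hN2 hx)
      exact mem_iUnion.2 ⟨t.equivFin ⟨y, hy⟩, by simpa [s] using hxy⟩)
  have hsum : ∀ x ∈ N, ∑ i, f i x * G x = G x := fun x hx => by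
    have := hf2 hx
    simp only [Finset.sum_apply, Pi.one_apply] at this
    rw [← Finset.sum_mul, this, one_mul]
  have hfc : ∀ i, Continuous fun x => f i x * G x := fun i => (f i).continuous.mul hG
  -- The added one keeps `ε'` positive when the cover is empty.
  set ε' := ε / ((t.card : ℝ) + 1) with hε'
  have hε0 : 0 < ε' := by positivity
  have hne : (t.card : ℝ) * ε' ≤ ε := by
    rw [hε', mul_div_assoc', div_le_iff₀ (by positivity)]
    nlinarith
  have hall : ∀ i, ∀ᶠ δ in 𝓝[>] (0 : ℝ),
      D.layerIntegral (fun x => f i x * G x) δ ≤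
        K ^ (2 * d) * D.surfaceIntegral (fun x => f i x * G x) + ε' ∧
      D.surfaceIntegral (fun x => f i x * G x) ≤
        K ^ (2 * d) * D.layerIntegral (fun x => f i x * G x) δ + ε' := fun i =>
    hU _ (ht _ (t.equivFin.symm i).2) (fun x => f i x * G x) (hfc i)
      (fun x => mul_nonneg (hf3 i x).1 (hG0 x)) (hf4 i).mul_right
      ((closure_mono (Function.support_mul_subset_left _ _)).trans (hf1 i)) ε' hε0
  have hS : D.surfaceIntegral G = ∑ i, D.surfaceIntegral (fun x => f i x * G x) := by
    unfold surfaceIntegral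
    rw [← integral_finsetSum _ fun i _ => D.integrable_surface (hfc i)]
    refine integral_congr_ae ?_
    filter_upwards [ae_restrict_mem (isClosed_frontier (s := D.Om)).measurableSet] with x hx
    rw [← Finset.sum_mul, hsum x (interior_subset (hN1 hx))]
  filter_upwards [eventually_all.2 hall, D.eventually_layer_subset hN1, self_mem_nhdsWithin]
    with δ h1 h2 hδ
  have hF : D.layerIntegral G δ = ∑ i, D.layerIntegral (fun x => f i x * G x) δ := by
    unfold layerIntegral
    rw [← integral_finsetSum _ fun i _ => D.integrable_layer (hfc i) hδ]
    refine integral_congr_ae (Eventually.of_forall fun x => ?_)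
    simp only
    rw [← Finset.mul_sum]
    by_cases hx : D.r x ∈ Ioo (-(2 * δ)) 0
    · rw [hsum x (h2 x hx)]
    · rw [D.layer_weight_eq_zero hδ hx]
      simp
  have hcard : ∑ _i : Fin t.card, ε' = t.card * ε' := by simp
  constructor
  · rw [hF, hS]
    refine (Finset.sum_le_sum fun i _ => (h1 i).1).trans ?_
    rw [Finset.sum_add_distrib, ← Finset.mul_sum, hcard]
    gcongr
  · rw [hF, hS]
    refine (Finset.sum_le_sum fun i _ => (h1 i).2).trans ?_
    rw [Finset.sum_add_distrib, ← Finset.mul_sum, hcard]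
    gcongr

/-- The integrals do not depend on `K`, so the comparison may be used with `K` so close to `1` that
the factor `K ^ (2 * d)` does not cross a given strict bound; half of the remaining gap serves as
the error. -/
theorem tendsto_layerIntegral_of_nonneg (hd : 1 ≤ d) {G : Pt d → ℝ} (hG : Continuous G)
    (hG0 : ∀ x, 0 ≤ G x) :
    Tendsto (D.layerIntegral G) (𝓝[>] 0) (𝓝 (D.surfaceIntegral G)) := by
  set S := D.surfaceIntegral G with hS
  have hpow : Tendsto (fun K : ℝ => K ^ (2 * d)) (𝓝[>] 1) (𝓝 1) := by
    have : Continuous fun K : ℝ => K ^ (2 * d) := by fun_prop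
    simpa using (this.tendsto 1).mono_left nhdsWithin_le_nhds
  have hK1 : ∀ᶠ K : ℝ in 𝓝[>] 1, 1 < K := self_mem_nhdsWithin
  refine tendsto_order.2 ⟨fun b hb => ?_, fun b hb => ?_⟩
  · have h1 : Tendsto (fun K : ℝ => K ^ (2 * d) * b) (𝓝[>] 1) (𝓝 (1 * b)) := hpow.mul_const b
    rw [one_mul] at h1
    obtain ⟨K, hK, hKb⟩ := (hK1.and (h1.eventually_lt_const hb)).exists
    lift K to NNReal using (zero_le_one.trans hK.le)
    have hp : (0 : ℝ) < (K : ℝ) ^ (2 * d) := by positivity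
    filter_upwards [D.eventually_layer_comparison hd (by exact_mod_cast hK) hG hG0
      (half_pos (sub_pos.2 hKb))] with δ hδ
    refine lt_of_mul_lt_mul_left (?_ : (K : ℝ) ^ (2 * d) * b < _) hp.le
    linarith [hδ.2]
  · have h1 : Tendsto (fun K : ℝ => K ^ (2 * d) * S) (𝓝[>] 1) (𝓝 (1 * S)) := hpow.mul_const S
    rw [one_mul] at h1
    obtain ⟨K, hK, hKb⟩ := (hK1.and (h1.eventually_lt_const hb)).exists
    lift K to NNReal using (zero_le_one.trans hK.le)
    filter_upwards [D.eventually_layer_comparison hd (by exact_mod_cast hK) hG hG0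
      (half_pos (sub_pos.2 hKb))] with δ hδ
    linarith [hδ.1]

theorem tendsto_layerIntegral (hd : 1 ≤ d) {G : Pt d → ℝ} (hG : Continuous G) :
    Tendsto (D.layerIntegral G) (𝓝[>] 0) (𝓝 (D.surfaceIntegral G)) := by
  have hp : Continuous fun x => max (G x) 0 := hG.max continuous_const
  have hn : Continuous fun x => max (-G x) 0 := hG.neg.max continuous_const
  have h1 := D.tendsto_layerIntegral_of_nonneg hd hp
    fun x => le_max_right _ _
  have h2 := D.tendsto_layerIntegral_of_nonneg hd hn
    fun x => le_max_right _ _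
  have hsplit : ∀ x, G x = max (G x) 0 - max (-G x) 0 := fun x => by
    rcases le_total 0 (G x) with h | h
    · rw [max_eq_left h, max_eq_right (by linarith)]; ring
    · rw [max_eq_right h, max_eq_left (by linarith)]; ring
  have hS : D.surfaceIntegral G = D.surfaceIntegral (fun x => max (G x) 0) -
      D.surfaceIntegral (fun x => max (-G x) 0) := by
    unfold surfaceIntegral
    rw [← integral_sub (D.integrable_surface hp) (D.integrable_surface hn)]
    refine integral_congr_ae (Eventually.of_forall fun x => ?_)
    simp only
    rw [← sub_mul, ← hsplit]
  rw [hS]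
  refine (h1.sub h2).congr' ?_
  filter_upwards [self_mem_nhdsWithin] with δ hδ
  unfold layerIntegral
  rw [← integral_sub (D.integrable_layer hp hδ) (D.integrable_layer hn hδ)]
  refine integral_congr_ae (Eventually.of_forall fun x => ?_)
  simp only
  rw [← mul_sub, ← hsplit]

end SmoothDomain

end ElasticWave

/-! ### The divergence theorem -/

namespace ElasticWave

variable {d : ℕ}

/-- A decreasing `C¹` step function with derivative `-bumpKernel`. -/
noncomputable def stepKernel (s : ℝ) : ℝ := ∫ t in s..0, bumpKernel t

theorem hasDerivAt_stepKernel (s : ℝ) : HasDerivAt stepKernel (-bumpKernel s) s :=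
  intervalIntegral.integral_hasDerivAt_left (continuous_bumpKernel.intervalIntegrable _ _)
    (continuous_bumpKernel.stronglyMeasurableAtFilter _ _) continuous_bumpKernel.continuousAt

theorem continuous_stepKernel : Continuous stepKernel :=
  continuous_iff_continuousAt.2 fun s => (hasDerivAt_stepKernel s).continuousAt

theorem stepKernel_eq_zero {s : ℝ} (hs : -1 ≤ s) : stepKernel s = 0 := by
  refine (intervalIntegral.integral_congr fun t ht => bumpKernel_eq_zero fun h => ?_).trans
    (intervalIntegral.integral_zero)
  rcases le_total s 0 with h0 | h0
  · rw [uIcc_of_le h0] at ht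
    linarith [ht.1, h.2]
  · rw [uIcc_of_ge h0] at ht
    linarith [ht.1, h.2]

theorem stepKernel_eq_one {s : ℝ} (hs : s ≤ -2) : stepKernel s = 1 := by
  rw [stepKernel, intervalIntegral.integral_of_le (by linarith),
    setIntegral_eq_integral_of_forall_compl_eq_zero, integral_bumpKernel]
  intro t ht
  exact bumpKernel_eq_zero fun h => ht ⟨by linarith [h.1], by linarith [h.2]⟩

theorem abs_stepKernel_le (s : ℝ) : |stepKernel s| ≤ 1 := by
  rcases le_total (-1) s with h | h
  · simp [stepKernel_eq_zero h]
  · rw [stepKernel, intervalIntegral.integral_of_le (by linarith),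
      abs_of_nonneg (integral_nonneg bumpKernel_nonneg), ← integral_bumpKernel]
    exact setIntegral_le_integral integrable_bumpKernel (Eventually.of_forall bumpKernel_nonneg)

namespace SmoothDomain

variable (D : SmoothDomain d)

/-- Finite `(d-1)`-dimensional Hausdorff measure forces the `d`-dimensional measure to vanish. In
dimension zero the boundary is empty, since a gradient cannot be nonzero there. -/
theorem vol_bdry : D.vol D.bdry = 0 := by
  rcases Nat.eq_zero_or_pos d with rfl | hd
  · have hb : D.bdry = ∅ := by
      refine eq_empty_of_forall_notMem fun x hx => D.regular x (D.r_eq_zero hx) ?_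
      exact Subsingleton.elim _ _
    rw [hb, measure_empty]
  · refine le_antisymm ((Measure.restrict_apply_le _ _).trans (le_of_eq ?_)) bot_le
    rw [← EuclideanSpace.euclideanHausdorffMeasure_eq_volume]
    refine (Measure.euclideanHausdorffMeasure_zero_or_top (Nat.sub_lt hd one_pos) D.bdry).resolve_right
      fun h => ?_
    have h1 : D.surf univ = ⊤ := by rw [surf, Measure.restrict_apply_univ, h]
    exact measure_ne_top D.surf univ h1

theorem ae_vol_neg : ∀ᵐ x ∂D.vol, D.r x < 0 := by
  have h1 : ∀ᵐ x ∂D.vol, x ∉ D.bdry := measure_eq_zero_iff_ae_notMem.1 D.vol_bdry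
  filter_upwards [h1, D.ae_vol_mem] with x hx hx2
  exact lt_of_le_of_ne hx2 fun h => hx (D.mem_bdry_iff.2 h)

/-- The complex version of `tendsto_layerIntegral`. -/
theorem tendsto_layerIntegral_complex (hd : 1 ≤ d) {G : Pt d → ℂ} (hG : Continuous G) :
    Tendsto (fun δ : ℝ => ∫ x, ((δ⁻¹ * bumpKernel (D.r x / δ) : ℝ) : ℂ) * G x) (𝓝[>] 0)
      (𝓝 (∫ x, G x * ((‖gradient D.r x‖⁻¹ : ℝ) : ℂ) ∂D.surf)) := by
  have hre : Continuous fun x => (G x).re := Complex.continuous_re.comp hG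
  have him : Continuous fun x => (G x).im := Complex.continuous_im.comp hG
  have h := ((Complex.continuous_ofReal.tendsto _).comp (D.tendsto_layerIntegral hd hre)).add
    (((Complex.continuous_ofReal.tendsto _).comp (D.tendsto_layerIntegral hd him)).mul_const
      Complex.I)
  have hS : ∫ x, G x * ((‖gradient D.r x‖⁻¹ : ℝ) : ℂ) ∂D.surf =
      (D.surfaceIntegral fun x => (G x).re) + (D.surfaceIntegral fun x => (G x).im) * Complex.I := by
    unfold surfaceIntegral
    rw [← integral_complex_ofReal, ← integral_complex_ofReal, ← integral_mul_const, ← integral_add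
      (D.integrable_surface hre).ofReal ((D.integrable_surface him).ofReal.mul_const _)]
    refine integral_congr_ae (Eventually.of_forall fun x => ?_)
    simp only
    conv_lhs => rw [← Complex.re_add_im (G x)]
    push_cast
    ring
  rw [hS]
  refine h.congr' ?_
  filter_upwards [self_mem_nhdsWithin] with δ hδ
  simp only [Function.comp, layerIntegral]
  rw [← integral_complex_ofReal, ← integral_complex_ofReal, ← integral_mul_const, ← integral_add
    (D.integrable_layer hre hδ).ofReal ((D.integrable_layer him hδ).ofReal.mul_const _)]
  refine integral_congr_ae (Eventually.of_forall fun x => ?_)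
  simp only
  conv_rhs => rw [← Complex.re_add_im (G x)]
  push_cast
  ring

/-- Cutting off near the boundary turns continuity inside `Ω` into continuity everywhere. -/
theorem continuous_step_mul {Y : Pt d → ℂ} (hY : ContinuousOn Y (interior D.Om)) {δ : ℝ}
    (hδ : 0 < δ) : Continuous fun x => (stepKernel (D.r x / δ) : ℂ) * Y x := by
  have hr := D.smooth.continuous
  have hs := continuous_stepKernel
  refine continuous_iff_continuousAt.2 fun x => ?_
  rcases lt_or_ge (D.r x) 0 with h | h
  · exact ContinuousAt.mul (Complex.continuous_ofReal.comp (hs.comp (hr.div_const δ))).continuousAt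
      (hY.continuousAt (isOpen_interior.mem_nhds (D.mem_interior_of_neg h)))
  · refine (continuousAt_const (y := (0 : ℂ))).congr ?_
    filter_upwards [(isOpen_lt continuous_const hr).mem_nhds
      (show -δ < D.r x by linarith)] with y hy
    rw [stepKernel_eq_zero, Complex.ofReal_zero, zero_mul]
    rw [le_div_iff₀ hδ]
    linarith [show -δ < D.r y from hy]

theorem step_eq_zero_of_notMem {δ : ℝ} (hδ : 0 < δ) {x : Pt d} (hx : x ∉ D.Om) :
    stepKernel (D.r x / δ) = 0 := by
  have : 0 < D.r x := not_le.1 hx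
  exact stepKernel_eq_zero (by linarith [div_pos this hδ])

theorem integrable_step_mul {Y : Pt d → ℂ} (hY : ContinuousOn Y (interior D.Om)) {δ : ℝ}
    (hδ : 0 < δ) : Integrable fun x => (stepKernel (D.r x / δ) : ℂ) * Y x :=
  (D.continuous_step_mul hY hδ).integrable_of_hasCompactSupport
    (HasCompactSupport.intro D.isCompact_Om fun x hx => by
      rw [D.step_eq_zero_of_notMem hδ hx, Complex.ofReal_zero, zero_mul])

/-- Integration by parts in the whole space leaves no boundary term: the cutoff has its support in
the interior of `Ω`, where `Y` is `C¹`. Only the derivative of the cutoff survives, and it is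
concentrated on the layer. -/
theorem integral_step_mul_fderiv {Y : Pt d → ℂ} (hY : ContDiffOn ℝ 1 Y (interior D.Om)) {δ : ℝ}
    (hδ : 0 < δ) (e : Pt d) :
    ∫ x, (stepKernel (D.r x / δ) : ℂ) * fderiv ℝ Y x e =
      ∫ x, ((δ⁻¹ * bumpKernel (D.r x / δ) : ℝ) : ℂ) * ((fderiv ℝ D.r x e : ℝ) * Y x) := by
  have hr := D.smooth.continuous
  have hder : ∀ x, HasFDerivAt (fun x => (stepKernel (D.r x / δ) : ℂ))
      (Complex.ofRealCLM.comp ((-bumpKernel (D.r x / δ)) • (δ⁻¹ • fderiv ℝ D.r x))) x := by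
    intro x
    have h1 : HasFDerivAt (fun x => D.r x / δ) (δ⁻¹ • fderiv ℝ D.r x) x := by
      simpa [div_eq_mul_inv] using
        ((D.smooth.differentiable (by simp)) x).hasFDerivAt.mul_const δ⁻¹
    exact Complex.ofRealCLM.hasFDerivAt.comp x
      ((hasDerivAt_stepKernel _).comp_hasFDerivAt x h1)
  have hdiff : Differentiable ℝ fun x => (stepKernel (D.r x / δ) : ℂ) :=
    fun x => (hder x).differentiableAt
  have hfd : ∀ x, fderiv ℝ (fun x => (stepKernel (D.r x / δ) : ℂ)) x e * Y x =
      -(((δ⁻¹ * bumpKernel (D.r x / δ) : ℝ) : ℂ) * ((fderiv ℝ D.r x e : ℝ) * Y x)) := by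
    intro x
    rw [(hder x).fderiv]
    simp
    ring
  have hYd : ContinuousOn (fun x => fderiv ℝ Y x e) (interior D.Om) :=
    (hY.continuousOn_fderiv_of_isOpen isOpen_interior le_rfl).clm_apply continuousOn_const
  have hsupp : tsupport (fun x => (stepKernel (D.r x / δ) : ℂ)) ⊆ interior D.Om := by
    refine (closure_minimal (t := {x | D.r x ≤ -δ}) (fun x hx => ?_)
      (isClosed_le hr continuous_const)).trans fun x hx => D.mem_interior_of_neg ?_
    · by_contra hn
      apply hx
      simp only
      rw [stepKernel_eq_zero, Complex.ofReal_zero]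
      rw [le_div_iff₀ hδ]
      have : -δ < D.r x := not_le.1 hn
      linarith
    · linarith [show D.r x ≤ -δ from hx]
  have key := integral_mul_fderiv_eq_neg_fderiv_mul_of_integrable (𝕜 := ℂ) (μ := volume) (v := e)
    (f := fun x => (stepKernel (D.r x / δ) : ℂ)) (g := Y) ?_ (D.integrable_step_mul hYd hδ)
    (D.integrable_step_mul hY.continuousOn hδ) (fun x _ => hdiff x) (fun x hx =>
      (hY.differentiableOn (by simp)).differentiableAt (isOpen_interior.mem_nhds (hsupp hx)))
  · rw [key, ← integral_neg]
    refine integral_congr_ae (Eventually.of_forall fun x => ?_)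
    simp only
    rw [hfd, neg_neg]
  · simp only [hfd]
    refine Integrable.neg (Continuous.integrable_of_hasCompactSupport ?_
      (HasCompactSupport.intro D.isCompact_Om fun x hx => ?_))
    · refine continuous_iff_continuousAt.2 fun x => ?_
      have hbk := continuous_bumpKernel
      have hfr : Continuous fun x => fderiv ℝ D.r x e :=
        (D.smooth.continuous_fderiv (by simp)).clm_apply continuous_const
      rcases lt_or_ge (D.r x) 0 with h | h
      · refine ContinuousAt.mul (Continuous.continuousAt (by fun_prop)) (ContinuousAt.mul
          (Continuous.continuousAt (by fun_prop)) (hY.continuousOn.continuousAt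
            (isOpen_interior.mem_nhds (D.mem_interior_of_neg h))))
      · refine (continuousAt_const (y := (0 : ℂ))).congr ?_
        filter_upwards [(isOpen_lt continuous_const hr).mem_nhds
          (show -δ < D.r x by linarith)] with y hy
        have hy' : -δ < D.r y := hy
        rw [bumpKernel_eq_zero]
        · simp
        · intro hc
          have := hc.2
          rw [div_lt_iff₀ hδ] at this
          linarith
    · rw [D.layer_weight_eq_zero hδ fun h => hx (show D.r x ≤ 0 from h.2.le)]
      simp

theorem normal_apply (x : Pt d) (j : Fin d) :
    D.normal x j = ‖gradient D.r x‖⁻¹ * fderiv ℝ D.r x (EuclideanSpace.single j 1) := by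
  have h : fderiv ℝ D.r x (EuclideanSpace.single j 1) = gradient D.r x j := by
    have : fderiv ℝ D.r x (EuclideanSpace.single j 1) =
        inner ℝ (gradient D.r x) (EuclideanSpace.single j 1) := by
      rw [gradient, InnerProductSpace.toDual_symm_apply]
    rw [this, EuclideanSpace.inner_single_right]
    simp
  rw [h]
  rfl

/-- The divergence theorem on a compact domain with smooth boundary, for fields that are
continuous on `Ω` and continuously differentiable in the interior. -/
theorem integral_divergence (hd : 1 ≤ d) {X : Fin d → Pt d → ℂ}
    (hX : ∀ j, ContinuousOn (X j) D.Om) (hX1 : ∀ j, ContDiffOn ℝ 1 (X j) (interior D.Om))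
    {q : Pt d → ℂ} (hq : ContinuousOn q D.Om)
    (hdiv : ∀ x ∈ interior D.Om, ∑ j, fderiv ℝ (X j) x (EuclideanSpace.single j 1) = q x) :
    ∫ x, q x ∂D.vol = ∫ x, ∑ j, X j x * (D.normal x j : ℂ) ∂D.surf := by
  have hfr : ∀ j : Fin d, Continuous fun x => fderiv ℝ D.r x (EuclideanSpace.single j 1) :=
    fun j => (D.smooth.continuous_fderiv (by simp)).clm_apply continuous_const
  have hGc : ContinuousOn (fun x => ∑ j, (fderiv ℝ D.r x (EuclideanSpace.single j 1) : ℂ) * X j x)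
      D.Om :=
    continuousOn_finsetSum _ fun j _ =>
      (Complex.continuous_ofReal.comp (hfr j)).continuousOn.mul (hX j)
  -- The layer limit is stated for functions continuous on the whole space, so the flux of `∇r` is
  -- extended by Tietze. The values outside `Ω` never enter, as both the layers and the boundary lie
  -- in `Ω`.
  obtain ⟨Gt, hGt⟩ := ContinuousMap.exists_restrict_eq D.isCompact_Om.isClosed
    (⟨_, continuousOn_iff_continuous_domRestrict.1 hGc⟩ : C(D.Om, ℂ))
  have hG : ∀ x ∈ D.Om, Gt x = ∑ j, (fderiv ℝ D.r x (EuclideanSpace.single j 1) : ℂ) * X j x :=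
    fun x hx => congrArg (fun F : C(D.Om, ℂ) => F ⟨x, hx⟩) hGt
  have hlim := D.tendsto_layerIntegral_complex hd Gt.continuous
  have hR : ∫ x, Gt x * ((‖gradient D.r x‖⁻¹ : ℝ) : ℂ) ∂D.surf =
      ∫ x, ∑ j, X j x * (D.normal x j : ℂ) ∂D.surf := by
    refine integral_congr_ae ?_
    filter_upwards [ae_restrict_mem (isClosed_frontier (s := D.Om)).measurableSet] with x hx
    rw [hG x (D.bdry_subset hx), Finset.sum_mul]
    refine Finset.sum_congr rfl fun j _ => ?_
    rw [D.normal_apply]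
    push_cast
    ring
  rw [hR] at hlim
  have hparts : ∀ δ > 0, ∫ x, ((δ⁻¹ * bumpKernel (D.r x / δ) : ℝ) : ℂ) * Gt x =
      ∫ x, (stepKernel (D.r x / δ) : ℂ) * q x ∂D.vol := by
    intro δ hδ
    have h1 : ∀ x, ((δ⁻¹ * bumpKernel (D.r x / δ) : ℝ) : ℂ) * Gt x =
        ∑ j, ((δ⁻¹ * bumpKernel (D.r x / δ) : ℝ) : ℂ) *
          ((fderiv ℝ D.r x (EuclideanSpace.single j 1) : ℝ) * X j x) := fun x => by
      by_cases hx : D.r x ∈ Ioo (-(2 * δ)) 0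
      · rw [hG x (show D.r x ≤ 0 from hx.2.le), Finset.mul_sum]
      · rw [D.layer_weight_eq_zero hδ hx]
        simp
    have hfd : ∀ j, ContinuousOn (fun x => fderiv ℝ (X j) x (EuclideanSpace.single j 1))
        (interior D.Om) := fun j =>
      ((hX1 j).continuousOn_fderiv_of_isOpen isOpen_interior le_rfl).clm_apply continuousOn_const
    have hi : ∀ j, Integrable fun x => ((δ⁻¹ * bumpKernel (D.r x / δ) : ℝ) : ℂ) *
          ((fderiv ℝ D.r x (EuclideanSpace.single j 1) : ℝ) * X j x) := by
      intro j
      obtain ⟨Y, hY⟩ := ContinuousMap.exists_restrict_eq D.isCompact_Om.isClosed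
        (⟨_, continuousOn_iff_continuous_domRestrict.1 (hX j)⟩ : C(D.Om, ℂ))
      have hY' : ∀ x ∈ D.Om, Y x = X j x :=
        fun x hx => congrArg (fun F : C(D.Om, ℂ) => F ⟨x, hx⟩) hY
      have heq : (fun x => ((δ⁻¹ * bumpKernel (D.r x / δ) : ℝ) : ℂ) *
          ((fderiv ℝ D.r x (EuclideanSpace.single j 1) : ℝ) * X j x)) =
          fun x => ((δ⁻¹ * bumpKernel (D.r x / δ) : ℝ) : ℂ) *
          ((fderiv ℝ D.r x (EuclideanSpace.single j 1) : ℝ) * Y x) := by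
        funext x
        by_cases hx : D.r x ∈ Ioo (-(2 * δ)) 0
        · rw [hY' x (show D.r x ≤ 0 from hx.2.le)]
        · rw [D.layer_weight_eq_zero hδ hx]
          simp
      rw [heq]
      have hbk := continuous_bumpKernel
      have hr := D.smooth.continuous
      have hfj := hfr j
      refine Continuous.integrable_of_hasCompactSupport (by fun_prop)
        (HasCompactSupport.intro D.isCompact_Om fun x hx => ?_)
      rw [D.layer_weight_eq_zero hδ fun h => hx (show D.r x ≤ 0 from h.2.le)]
      simp
    simp only [h1]
    rw [integral_finsetSum _ fun j _ => hi j]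
    simp only [← D.integral_step_mul_fderiv (hX1 _) hδ]
    rw [← integral_finsetSum _ fun j _ => D.integrable_step_mul (hfd j) hδ]
    have hz : ∀ x, x ∉ D.Om → ∑ j, (stepKernel (D.r x / δ) : ℂ) *
        fderiv ℝ (X j) x (EuclideanSpace.single j 1) = 0 := fun x hx => by
      rw [D.step_eq_zero_of_notMem hδ hx]
      simp
    rw [← setIntegral_eq_integral_of_forall_compl_eq_zero hz]
    refine integral_congr_ae ?_
    filter_upwards [D.ae_vol_neg] with x hx
    rw [← Finset.mul_sum, hdiv x (D.mem_interior_of_neg hx)]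
  -- The cutoffs are bounded by `1` and equal `1` for small `δ` at each point with `r < 0`, hence
  -- almost everywhere on `Ω`.
  have hlim2 : Tendsto (fun δ : ℝ => ∫ x, (stepKernel (D.r x / δ) : ℂ) * q x ∂D.vol) (𝓝[>] 0)
      (𝓝 (∫ x, q x ∂D.vol)) := by
    obtain ⟨C, hC⟩ := D.isCompact_Om.exists_bound_of_continuousOn hq
    have hqm : AEStronglyMeasurable q D.vol :=
      hq.aestronglyMeasurable D.isCompact_Om.isClosed.measurableSet
    refine tendsto_integral_filter_of_dominated_convergence (fun _ => C) ?_ ?_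
      (integrable_const C) ?_
    · refine Eventually.of_forall fun δ => AEStronglyMeasurable.mul ?_ hqm
      have hs := continuous_stepKernel
      have hr := D.smooth.continuous
      exact (by fun_prop : Continuous fun x =>
        (stepKernel (D.r x / δ) : ℂ)).aestronglyMeasurable
    · refine Eventually.of_forall fun δ => ?_
      filter_upwards [D.ae_vol_mem] with x hx
      rw [norm_mul, Complex.norm_real, Real.norm_eq_abs]
      calc _ ≤ 1 * ‖q x‖ := by gcongr; exact abs_stepKernel_le _
        _ ≤ C := by rw [one_mul]; exact hC x hx
    · filter_upwards [D.ae_vol_neg] with x hx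
      refine tendsto_const_nhds.congr' ?_
      filter_upwards [Ioo_mem_nhdsGT (show (0 : ℝ) < -D.r x / 2 by linarith)] with δ hδ
      rw [stepKernel_eq_one, Complex.ofReal_one, one_mul]
      rw [div_le_iff₀ hδ.1]
      linarith [hδ.2]
  refine tendsto_nhds_unique hlim2 (hlim.congr' ?_)
  filter_upwards [self_mem_nhdsWithin] with δ hδ
  exact hparts δ hδ

end SmoothDomain

end ElasticWave

/-! ### Plane waves and Green's formula -/

namespace ElasticWave

variable {d : ℕ}

theorem hasFDerivAt_coord (j : Fin d) (x : Pt d) :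
    HasFDerivAt (fun x : Pt d => (x j : ℂ))
      (Complex.ofRealCLM.comp (EuclideanSpace.proj (𝕜 := ℝ) j)) x :=
  (Complex.ofRealCLM.comp (EuclideanSpace.proj (𝕜 := ℝ) j : Pt d →L[ℝ] ℝ)).hasFDerivAt

/-- The plane wave `e^{iθ·x}`. -/
noncomputable def planeWave (θ : Vec d) (x : Pt d) : ℂ :=
  Complex.exp (Complex.I * ∑ j, θ j * (x j : ℂ))

theorem contDiff_planeWave (θ : Vec d) : ContDiff ℝ ∞ (planeWave θ) := by
  have h : ∀ j : Fin d, ContDiff ℝ ∞ fun x : Pt d => (x j : ℂ) := fun j =>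
    Complex.ofRealCLM.contDiff.comp (EuclideanSpace.proj (𝕜 := ℝ) j).contDiff
  exact (contDiff_const.mul (ContDiff.sum fun j _ => contDiff_const.mul (h j))).cexp

theorem fderiv_planeWave (θ : Vec d) (x : Pt d) (k : Fin d) :
    fderiv ℝ (planeWave θ) x (EuclideanSpace.single k 1) =
      Complex.I * θ k * planeWave θ x := by
  have h1 : HasFDerivAt (fun x : Pt d => Complex.I * ∑ j, θ j * (x j : ℂ))
      (Complex.I • ∑ j, θ j • Complex.ofRealCLM.comp (EuclideanSpace.proj (𝕜 := ℝ) j)) x :=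
    (HasFDerivAt.fun_sum fun j _ => (hasFDerivAt_coord j x).const_mul (θ j)).const_mul Complex.I
  have h2 : HasFDerivAt (planeWave θ) _ x := h1.cexp
  rw [h2.fderiv]
  simp only [smul_apply, sum_apply, ContinuousLinearMap.comp_apply, smul_eq_mul]
  have h3 : ∑ j, θ j * Complex.ofRealCLM ((EuclideanSpace.proj (𝕜 := ℝ) j : Pt d →L[ℝ] ℝ)
      (EuclideanSpace.single k 1)) = θ k := by
    rw [Finset.sum_eq_single k]
    · simp
    · intro j _ hj
      simp [hj]
    · simp
  rw [h3]
  simp only [planeWave]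
  ring

theorem pderiv_expField (ι θ : Vec d) (k : Fin d) (x : Pt d) :
    pderiv k (expField ι θ : Pt d → Vec d) x = (Complex.I * θ k * planeWave θ x) • ι := by
  have h : HasFDerivAt (expField ι θ : Pt d → Vec d)
      ((fderiv ℝ (planeWave θ) x).smulRight ι) x :=
    (((contDiff_planeWave θ).differentiable (by simp)) x).hasFDerivAt.smul_const ι
  rw [pderiv, h.fderiv, ContinuousLinearMap.smulRight_apply, fderiv_planeWave]

namespace ElasticMedium

variable (M : ElasticMedium d)

theorem stress_expField (ι θ : Vec d) (x : Pt d) (i j : Fin d) :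
    M.stress x (fun k => pderiv k (expField ι θ : Pt d → Vec d) x) i j =
      (M.mu x : ℂ) * (planeWave θ x * (Complex.I * (θ j * ι i + θ i * ι j))) +
        (M.lam x : ℂ) * (planeWave θ x * (if i = j then Complex.I * dotc ι θ else 0)) := by
  simp only [stress, pderiv_expField, PiLp.smul_apply, smul_eq_mul]
  congr 1
  · ring
  · split_ifs
    · congr 1
      simp only [dotc, Finset.mul_sum]
      exact Finset.sum_congr rfl fun k _ => by ring
    · simp

theorem contDiffOn_stress_expField (ι θ : Vec d) (i j : Fin d) :
    ContDiffOn ℝ 1 (fun x => M.stress x (fun k => pderiv k (expField ι θ : Pt d → Vec d) x) i j)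
      (interior M.Om) := by
  simp only [stress_expField]
  have h1 : ContDiffOn ℝ 1 (fun x => (M.mu x : ℂ)) (interior M.Om) :=
    Complex.ofRealCLM.contDiff.comp_contDiffOn (M.mu_smooth.mono interior_subset)
  have h2 : ContDiffOn ℝ 1 (fun x => (M.lam x : ℂ)) (interior M.Om) :=
    Complex.ofRealCLM.contDiff.comp_contDiffOn (M.lam_smooth.mono interior_subset)
  have h3 : ContDiffOn ℝ 1 (planeWave θ) (interior M.Om) :=
    ((contDiff_planeWave θ).of_le (by simp)).contDiffOn
  exact (h1.mul (h3.mul contDiffOn_const)).add (h2.mul (h3.mul contDiffOn_const))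

/-- The complex geometrical optics condition says that the stress of `ι e^{iθ·x}` is divergence
free. -/
theorem divergence_stress_expField {ι θ : Vec d} (h : CGOCondition M ι θ) {x : Pt d}
    (hx : x ∈ interior M.Om) (i : Fin d) :
    ∑ j, fderiv ℝ (fun x => M.stress x (fun k => pderiv k (expField ι θ : Pt d → Vec d) x) i j) x
      (EuclideanSpace.single j 1) = 0 := by
  have hn : M.Om ∈ 𝓝 x := mem_interior_iff_mem_nhds.1 hx
  have hmu : HasFDerivAt (fun x => (M.mu x : ℂ))
      (Complex.ofRealCLM.comp (fderivWithin ℝ M.mu M.Om x)) x :=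
    Complex.ofRealCLM.hasFDerivAt.comp x
      (((M.mu_smooth.differentiableOn (by simp)) x (interior_subset hx)).hasFDerivWithinAt.hasFDerivAt
        hn)
  have hlam : HasFDerivAt (fun x => (M.lam x : ℂ))
      (Complex.ofRealCLM.comp (fderivWithin ℝ M.lam M.Om x)) x :=
    Complex.ofRealCLM.hasFDerivAt.comp x
      (((M.lam_smooth.differentiableOn (by simp)) x (interior_subset hx)).hasFDerivWithinAt.hasFDerivAt
        hn)
  have hE : HasFDerivAt (planeWave θ) (fderiv ℝ (planeWave θ) x) x :=
    (((contDiff_planeWave θ).differentiable (by simp)) x).hasFDerivAt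
  set m : Fin d → ℂ := fun j =>
    (fderivWithin ℝ M.mu M.Om x (EuclideanSpace.single j 1) : ℂ) with hm
  set l : Fin d → ℂ := fun j =>
    (fderivWithin ℝ M.lam M.Om x (EuclideanSpace.single j 1) : ℂ) with hl
  set E := planeWave θ x with hEx
  -- By the product rule, the derivative of the wave contributes a second factor `I`, so the terms
  -- without derivatives of the coefficients carry the sign `I * I = -1`.
  have hd : ∀ j, fderiv ℝ (fun x => M.stress x (fun k => pderiv k
      (expField ι θ : Pt d → Vec d) x) i j) x (EuclideanSpace.single j 1) =
      E * (Complex.I * ((θ i * ι j + ι i * θ j) * m j) +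
        (if i = j then Complex.I * dotc ι θ * l j else 0) -
        (M.mu x : ℂ) * (θ j * θ j * ι i + ι j * θ j * θ i) -
        (if i = j then (M.lam x : ℂ) * dotc ι θ * θ j else 0)) := by
    intro j
    simp only [stress_expField]
    have := (hmu.mul (hE.mul_const (Complex.I * (θ j * ι i + θ i * ι j)))).add
      (hlam.mul (hE.mul_const (if i = j then Complex.I * dotc ι θ else 0)))
    refine (congrArg (fun L : Pt d →L[ℝ] ℂ => L (EuclideanSpace.single j 1)) this.fderiv).trans ?_
    simp only [add_apply, smul_apply, ContinuousLinearMap.comp_apply, fderiv_planeWave,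
      smul_eq_mul, Complex.ofRealCLM_apply, ← hEx]
    have hI := Complex.I_mul_I
    split_ifs with hij
    · simp only [hm, hl]
      linear_combination (E * (M.mu x : ℂ) * (θ j * θ j * ι i + ι j * θ j * θ i) +
        E * (M.lam x : ℂ) * dotc ι θ * θ j) * hI
    · simp only [hm]
      linear_combination (E * (M.mu x : ℂ) * (θ j * θ j * ι i + ι j * θ j * θ i)) * hI
  simp only [hd]
  rw [← Finset.mul_sum]
  have hc := h x (interior_subset hx) i
  have hs : ∑ j, (Complex.I * ((θ i * ι j + ι i * θ j) * m j) +
        (if i = j then Complex.I * dotc ι θ * l j else 0) -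
        (M.mu x : ℂ) * (θ j * θ j * ι i + ι j * θ j * θ i) -
        (if i = j then (M.lam x : ℂ) * dotc ι θ * θ j else 0)) = 0 := by
    rw [Finset.sum_sub_distrib, Finset.sum_sub_distrib, Finset.sum_add_distrib,
      Finset.sum_ite_eq, Finset.sum_ite_eq, if_pos (Finset.mem_univ _), if_pos (Finset.mem_univ _),
      ← Finset.mul_sum, ← Finset.mul_sum, Finset.sum_add_distrib, ← Finset.sum_mul,
      ← Finset.sum_mul, ← hc]
    simp only [dotc, hm, hl]
    ring
  rw [hs, mul_zero]

/-- Green's formula for smooth fields. -/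
theorem energyForm_jet_expField (hd : 1 ≤ d) {ι θ : Vec d} (h : CGOCondition M ι θ)
    (w : smoothFields d) :
    M.energyForm (M.jet w).2.1 (expField ι θ : Pt d → Vec d) =
      ∫ x, dotc ((w : Pt d → Vec d) x) (M.traction (expField ι θ : Pt d → Vec d) x) ∂M.surf := by
  set φ : Pt d → Vec d := (expField ι θ : Pt d → Vec d) with hφ
  have hφc : ContDiff ℝ ∞ φ := smoothFields_contDiff _
  set σ : Fin d → Fin d → Pt d → ℂ := fun i j x => M.stress x (fun k => pderiv k φ x) i j with hσ
  have hσc : ∀ i j, ContinuousOn (σ i j) M.Om := fun i j => M.continuousOn_stress hφc i j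
  have hσ1 : ∀ i j, ContDiffOn ℝ 1 (σ i j) (interior M.Om) :=
    fun i j => M.contDiffOn_stress_expField ι θ i j
  have hw : ContDiff ℝ ∞ (w : Pt d → Vec d) := smoothFields_contDiff w
  have hwi : ∀ i, ContDiff ℝ ∞ fun x => (w : Pt d → Vec d) x i := fun i =>
    ((EuclideanSpace.proj (𝕜 := ℂ) i).restrictScalars ℝ).contDiff.comp hw
  have hwf : ∀ i x e, fderiv ℝ (fun x => (w : Pt d → Vec d) x i) x e =
      (fderiv ℝ (w : Pt d → Vec d) x e) i := fun i x e => by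
    have := (((EuclideanSpace.proj (𝕜 := ℂ) i).restrictScalars ℝ).hasFDerivAt
      (x := (w : Pt d → Vec d) x)).comp x ((hw.differentiable (by simp)) x).hasFDerivAt
    exact congrArg (fun L : Pt d →L[ℝ] ℂ => L e) this.fderiv
  -- The field is `Xⱼ = ∑ᵢ wᵢ σᵢⱼ(φ)`. Its divergence is `∇w : σ(φ)` because `σ(φ)` is divergence
  -- free, and symmetry of the energy form identifies this with `σ(w) : ∇φ`.
  have hdivthm := M.integral_divergence hd
    (X := fun j x => ∑ i, (w : Pt d → Vec d) x i * σ i j x)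
    (fun j => continuousOn_finsetSum _ fun i _ => (hwi i).continuous.continuousOn.mul (hσc i j))
    (fun j => ContDiffOn.sum fun i _ => ((hwi i).of_le (by simp)).contDiffOn.mul (hσ1 i j))
    (q := fun x => ∑ j, dotc (pderiv j (w : Pt d → Vec d) x) (WithLp.toLp 2 fun i => σ i j x))
    (continuousOn_finsetSum _ fun j _ => continuousOn_finsetSum _ fun i _ =>
      ((EuclideanSpace.proj (𝕜 := ℂ) i).continuous.comp
        (continuous_pderiv hw j)).continuousOn.mul (hσc i j))
    (by
      intro x hx
      have e1 : ∀ j, fderiv ℝ (fun x => ∑ i, (w : Pt d → Vec d) x i * σ i j x) x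
          (EuclideanSpace.single j 1) = ∑ i, (pderiv j (w : Pt d → Vec d) x i * σ i j x +
            (w : Pt d → Vec d) x i * fderiv ℝ (σ i j) x (EuclideanSpace.single j 1)) := by
        intro j
        have hs : HasFDerivAt (fun x => ∑ i, (w : Pt d → Vec d) x i * σ i j x)
            (∑ i, ((w : Pt d → Vec d) x i • fderiv ℝ (σ i j) x +
              σ i j x • fderiv ℝ (fun x => (w : Pt d → Vec d) x i) x)) x :=
          HasFDerivAt.fun_sum fun i _ =>
            (((hwi i).differentiable (by simp)) x).hasFDerivAt.mul
              (((hσ1 i j).differentiableOn (by simp)).differentiableAt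
                (isOpen_interior.mem_nhds hx)).hasFDerivAt
        rw [hs.fderiv, sum_apply]
        refine Finset.sum_congr rfl fun i _ => ?_
        rw [add_apply, smul_apply, smul_apply, hwf, smul_eq_mul, smul_eq_mul, pderiv]
        ring
      simp only [e1, Finset.sum_add_distrib]
      rw [Finset.sum_comm (f := fun j i => (w : Pt d → Vec d) x i *
        fderiv ℝ (σ i j) x (EuclideanSpace.single j 1))]
      simp only [← Finset.mul_sum]
      rw [Finset.sum_eq_zero (f := fun i => (w : Pt d → Vec d) x i *
        ∑ j, fderiv ℝ (σ i j) x (EuclideanSpace.single j 1)) fun i _ => by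
          rw [M.divergence_stress_expField h hx i, mul_zero], add_zero]
      rfl)
  have hL : M.energyForm (M.jet w).2.1 φ =
      ∫ x, ∑ j, dotc (pderiv j (w : Pt d → Vec d) x) (WithLp.toLp 2 fun i => σ i j x) ∂M.vol := by
    refine integral_congr_ae ?_
    have : ∀ᵐ x ∂M.vol, ∀ j, ((M.jet w).2.1 j : Pt d → Vec d) x = pderiv j (w : Pt d → Vec d) x :=
      ae_all_iff.2 fun j => (M.memLp_vol (continuous_pderiv w.2 j).continuousOn).coeFn_toLp
    filter_upwards [this] with x hx
    simp only [hx]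
    exact M.stress_symm x _ _
  rw [hL, hdivthm]
  refine integral_congr_ae (Eventually.of_forall fun x => ?_)
  simp only [Finset.sum_mul, dotc]
  rw [Finset.sum_comm]
  refine Finset.sum_congr rfl fun i _ => ?_
  simp only [traction, hσ, stress, add_mul, mul_add, ite_mul, mul_ite, zero_mul, mul_zero,
    Finset.sum_add_distrib, Finset.sum_ite_eq, Finset.mem_univ, if_true, Finset.mul_sum,
    Finset.sum_mul]
  congr 1
  · congr 1 <;> exact Finset.sum_congr rfl fun j _ => by ring
  · exact Finset.sum_congr rfl fun j _ => by ring

theorem traction_memLp {w : Pt d → Vec d} (hw : ContDiff ℝ ∞ w) :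
    MemLp (M.traction w) 2 M.surf :=
  M.memLp_surf (continuousOn_traction M hw)

/-- Green's formula for `H¹` fields. -/
theorem energyForm_expField (hd : 1 ≤ d) {ι θ : Vec d} (h : CGOCondition M ι θ)
    {p : M.L2Om × (Fin d → M.L2Om) × M.L2bdry} (hp : p ∈ M.H1Trace) :
    M.energyForm p.2.1 (expField ι θ : Pt d → Vec d) =
      ∫ x, dotc (p.2.2 x) (M.traction (expField ι θ : Pt d → Vec d) x) ∂M.surf := by
  have hφc : ContDiff ℝ ∞ (expField ι θ : Pt d → Vec d) := smoothFields_contDiff _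
  have hpair : ∀ g : M.L2bdry, ∫ x, dotc (g x) (M.traction (expField ι θ : Pt d → Vec d) x) ∂M.surf
      = pairL2 M.surf d g (M.traction_memLp hφc).toLp := fun g => by
    refine integral_congr_ae ?_
    filter_upwards [(M.traction_memLp hφc).coeFn_toLp] with x hx
    rw [hx]
  obtain ⟨g, hg⟩ := M.energyForm_eq hφc
  rw [hpair]
  -- Both sides are continuous in the triple (field, gradient, trace), so the identity passes from
  -- smooth fields to their closure.
  have hcl : IsClosed {p : M.L2Om × (Fin d → M.L2Om) × M.L2bdry |
      M.energyForm p.2.1 (expField ι θ : Pt d → Vec d) =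
        pairL2 M.surf d p.2.2 (M.traction_memLp hφc).toLp} := by
    simp only [hg]
    refine isClosed_eq (continuous_finsetSum _ fun j _ => ?_) ?_
    · exact (continuous_pairL2 M.vol d (g j)).comp
        ((continuous_apply j).comp (continuous_fst.comp continuous_snd))
    · exact (continuous_pairL2 M.surf d _).comp (continuous_snd.comp continuous_snd)
  refine closure_minimal ?_ hcl hp
  rintro _ ⟨w, rfl⟩
  change M.energyForm (M.jet w).2.1 _ = _
  rw [M.energyForm_jet_expField hd h w, ← hpair]
  refine integral_congr_ae ?_
  filter_upwards [(M.memLp_surf (smoothFields_contDiff w).continuous.continuousOn).coeFn_toLp]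
    with x hx
  exact congrArg (fun v => dotc v _) hx.symm

end ElasticMedium

end ElasticWave

/-! ### The weak formulation integrated in time -/

namespace ElasticWave

variable {d : ℕ}

theorem SmoothDomain.integral_lat (D : SmoothDomain d) {T : ℝ} (hT : 0 < T) {F : ℝ × Pt d → ℂ}
    (hF : Integrable F (D.lat T)) :
    ∫ p, F p ∂D.lat T = ∫ t in (0 : ℝ)..T, ∫ x, F (t, x) ∂D.surf := by
  rw [intervalIntegral.integral_of_le hT.le, integral_Ioc_eq_integral_Ioo]
  exact integral_prod _ hF

theorem SmoothDomain.intervalIntegrable_lat (D : SmoothDomain d) {T : ℝ} (hT : 0 < T)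
    {F : ℝ × Pt d → ℂ} (hF : Integrable F (D.lat T)) :
    IntervalIntegrable (fun t => ∫ x, F (t, x) ∂D.surf) volume 0 T := by
  rw [intervalIntegrable_iff_integrableOn_Ioo_of_le hT.le]
  exact hF.integral_prod_left

/-- The bilinear pairing with a fixed second factor, as a continuous linear functional. -/
noncomputable def pairRight {α : Type*} [MeasurableSpace α] (m : Measure α) (h : Lp (Vec d) 2 m) :
    Lp (Vec d) 2 m →L[ℂ] ℂ :=
  ⟨(pairL2 m d).flip h, continuous_pairL2 m d h⟩

namespace ElasticMedium

variable (M : ElasticMedium d)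

theorem exists_massForm_clm {w : Pt d → Vec d} (hw : ContDiff ℝ ∞ w) :
    ∃ L : M.L2Om →L[ℂ] ℂ, ∀ u, L u = M.massForm u w := by
  obtain ⟨h, hh⟩ := M.massForm_eq hw
  exact ⟨pairRight M.vol h, fun u => (hh u).symm⟩

theorem exists_energyForm_clm {w : Pt d → Vec d} (hw : ContDiff ℝ ∞ w) :
    ∃ L : (Fin d → M.L2Om) →L[ℂ] ℂ, ∀ G, L G = M.energyForm G w := by
  obtain ⟨h, hh⟩ := M.energyForm_eq hw
  refine ⟨∑ j, (pairRight M.vol (h j)).comp (ContinuousLinearMap.proj j), fun G => ?_⟩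
  rw [hh, sum_apply]
  rfl

end ElasticMedium

namespace EnergyField

variable {M : ElasticMedium d} {T : ℝ}

theorem integrable_traction_pairing (k : M.L2lat T) {w : Pt d → Vec d} (hw : ContDiff ℝ ∞ w) :
    Integrable (fun p : ℝ × Pt d => dotc (k p) (w p.2)) (M.lat T) := by
  simpa using integrable_traction k (contDiff_const (c := (1 : ℂ))) hw

/-- The weak formulation, integrated in time. -/
theorem HasTraction.massForm_ut (hT : 0 < T) {U : EnergyField M.toSmoothDomain T} {k : M.L2lat T}
    (hk : U.HasTraction k) (h0 : U.ut 0 = 0) {w : Pt d → Vec d} (hw : ContDiff ℝ ∞ w) :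
    IntervalIntegrable (fun t => M.energyForm (U.Du t) w) volume 0 T ∧
    ∀ t ∈ Icc 0 T, M.massForm (U.ut t) w = -∫ s in (0 : ℝ)..t,
      (M.energyForm (U.Du s) w - ∫ x, dotc (k (s, x)) (w x) ∂M.surf) := by
  obtain ⟨L, hL⟩ := M.exists_massForm_clm hw
  obtain ⟨A, hA⟩ := M.exists_energyForm_clm hw
  have hki := integrable_traction_pairing k hw
  have hm : ContinuousOn (fun t => M.massForm (U.ut t) w) (Icc 0 T) := by
    simp only [← hL]
    exact L.continuous.comp_continuousOn U.ut_cont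
  have ha : IntervalIntegrable (fun t => M.energyForm (U.Du t) w) volume 0 T := by
    apply ContinuousOn.intervalIntegrable
    rw [uIcc_of_le hT.le]
    simp only [← hA]
    exact A.continuous.comp_continuousOn U.Du_cont
  have hb := M.intervalIntegrable_lat hT hki
  refine ⟨ha, fun t ht => ?_⟩
  -- The weak formulation says that the distributional derivative of `(ρ uₜ, w)` is the boundary
  -- pairing minus the energy form. The boundary pairing is only known to be integrable in time.
  rw [eq_sub_integral_of_weak_deriv hT hm (ha.sub hb) (fun η hη hs => ?_) t ht]
  · rw [h0, ← hL, map_zero, zero_sub]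
  · have hηc : ContDiff ℝ ∞ fun t => (η t : ℂ) := Complex.ofRealCLM.contDiff.comp hη
    have hηs : tsupport (fun t => (η t : ℂ)) ⊆ Ioo 0 T :=
      (closure_mono (Function.support_subset_iff'.2 fun x hx => by
        simp [Function.notMem_support.1 hx])).trans hs
    have hd : ∀ t, deriv (fun t => (η t : ℂ)) t = ((deriv η t : ℝ) : ℂ) := fun t =>
      (((hη.differentiable (by simp)) t).hasDerivAt.ofReal_comp).deriv
    have key := hk _ hηc hηs w hw
    rw [weakForm] at key
    simp only [hd] at key
    have hηa : IntervalIntegrable (fun t => (η t : ℂ) * M.energyForm (U.Du t) w) volume 0 T :=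
      ha.continuousOn_mul hηc.continuous.continuousOn
    have hηb : IntervalIntegrable (fun t => (η t : ℂ) *
        ∫ x, dotc (k (t, x)) (w x) ∂M.surf) volume 0 T :=
      hb.continuousOn_mul hηc.continuous.continuousOn
    have hηm : IntervalIntegrable (fun t => ((deriv η t : ℝ) : ℂ) * M.massForm (U.ut t) w)
        volume 0 T := by
      apply ContinuousOn.intervalIntegrable
      rw [uIcc_of_le hT.le]
      exact (Complex.continuous_ofReal.comp (hη.continuous_deriv (by simp))).continuousOn.mul hm
    rw [intervalIntegral.integral_sub hηa hηm, M.integral_lat hT (integrable_traction k hηc hw)]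
      at key
    simp only [integral_const_mul] at key
    simp only [mul_sub]
    rw [intervalIntegral.integral_sub hηa hηb, ← key]
    ring

/-- The second time integration, and the core of the identity: it holds for every smooth `w`, before
any property of `φ` is used. The double primitive collapses to the weight `T - s`. -/
theorem HasTraction.massForm_u (hT : 0 < T) {U : EnergyField M.toSmoothDomain T} {k : M.L2lat T}
    (hk : U.HasTraction k) (hu0 : U.u 0 = 0) (h0 : U.ut 0 = 0) {w : Pt d → Vec d}
    (hw : ContDiff ℝ ∞ w) :
    M.massForm (U.u T) w =
      (∫ s in (0 : ℝ)..T, ((T - s : ℝ) : ℂ) * ∫ x, dotc (k (s, x)) (w x) ∂M.surf) -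
        ∫ s in (0 : ℝ)..T, ((T - s : ℝ) : ℂ) * M.energyForm (U.Du s) w := by
  obtain ⟨L, hL⟩ := M.exists_massForm_clm hw
  obtain ⟨ha, hm⟩ := hk.massForm_ut hT h0 hw
  have hb := M.intervalIntegrable_lat hT (integrable_traction_pairing k hw)
  have hder : ∀ t ∈ Ioo 0 T, HasDerivAt (fun t => M.massForm (U.u t) w)
      (M.massForm (U.ut t) w) t := fun t ht => by
    simp only [← hL]
    exact (L.restrictScalars ℝ).hasFDerivAt.comp_hasDerivAt t
      ((U.deriv_u t (Ioo_subset_Icc_self ht)).hasDerivAt (Icc_mem_nhds ht.1 ht.2))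
  have hcu : ContinuousOn (fun t => M.massForm (U.u t) w) (Icc 0 T) := by
    simp only [← hL]
    exact L.continuous.comp_continuousOn fun t ht => (U.deriv_u t ht).continuousWithinAt
  have hcut : ContinuousOn (fun t => M.massForm (U.ut t) w) (uIcc 0 T) := by
    rw [uIcc_of_le hT.le]
    simp only [← hL]
    exact L.continuous.comp_continuousOn U.ut_cont
  have hftc := intervalIntegral.integral_eq_sub_of_hasDerivAt_of_le hT.le hcu hder
    hcut.intervalIntegrable
  have hz : M.massForm (U.u 0) w = 0 := by rw [hu0, ← hL, map_zero]
  rw [hz, sub_zero] at hftc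
  have hcT : Continuous fun s : ℝ => ((T - s : ℝ) : ℂ) := by fun_prop
  rw [← hftc, intervalIntegral.integral_congr (g := fun t => -∫ s in (0 : ℝ)..t,
      (M.energyForm (U.Du s) w - ∫ x, dotc (k (s, x)) (w x) ∂M.surf))
    (fun t ht => hm t (by rwa [uIcc_of_le hT.le] at ht)), intervalIntegral.integral_neg,
    integral_primitive hT (ha.sub hb), ← intervalIntegral.integral_sub
      (hb.continuousOn_mul hcT.continuousOn) (ha.continuousOn_mul hcT.continuousOn),
    ← intervalIntegral.integral_neg]
  refine intervalIntegral.integral_congr fun s _ => ?_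
  simp only
  ring

end EnergyField

end ElasticWave

/-! ### Density and stress operators, ellipticity -/

namespace ElasticWave

variable {d : ℕ}

theorem SmoothDomain.exists_mulOp (D : SmoothDomain d) {C : Pt d → Vec d →L[ℂ] Vec d}
    (hC : ContinuousOn C D.Om) :
    ∃ A : D.L2Om →L[ℂ] D.L2Om, ∀ u, A u =ᵐ[D.vol] fun x => C x (u x) := by
  obtain ⟨B, hB⟩ := D.isCompact_Om.exists_bound_of_continuousOn hC
  have hm : MemLp C ⊤ D.vol := by
    refine memLp_top_of_bound (hC.aestronglyMeasurable D.isCompact_Om.isClosed.measurableSet) B ?_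
    filter_upwards [D.ae_vol_mem] with x hx using hB x hx
  refine ⟨(ContinuousLinearMap.id ℂ (Vec d →L[ℂ] Vec d)).holderL D.vol ⊤ 2 2 hm.toLp, fun u => ?_⟩
  filter_upwards [(ContinuousLinearMap.id ℂ (Vec d →L[ℂ] Vec d)).coeFn_holder (r := 2) hm.toLp u,
    hm.coeFn_toLp] with x h1 h2
  rw [ContinuousLinearMap.holderL_apply_apply, h1, h2]
  rfl

/-- Componentwise complex conjugation. -/
noncomputable def conjVec : Vec d →L[ℝ] Vec d :=
  LinearMap.toContinuousLinearMap
    { toFun := fun v => WithLp.toLp 2 fun i => starRingEnd ℂ (v i)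
      map_add' := fun v w => by ext i; simp
      map_smul' := fun c v => by ext i; simp }

theorem conjVec_apply (v : Vec d) (i : Fin d) : conjVec v i = starRingEnd ℂ (v i) := rfl

theorem dotc_conjVec (a b : Vec d) : dotc a (conjVec b) = inner ℂ b a := by
  simp [dotc, PiLp.inner_apply, conjVec_apply]

namespace ElasticMedium

variable (M : ElasticMedium d)

theorem exists_densityOp :
    ∃ A : M.L2Om →L[ℂ] M.L2Om, ∀ u, A u =ᵐ[M.vol] fun x => (M.rho x : ℂ) • u x := by
  obtain ⟨A, hA⟩ := M.exists_mulOp (C := fun x => (M.rho x : ℂ) • ContinuousLinearMap.id ℂ (Vec d))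
    ((Complex.continuous_ofReal.comp_continuousOn M.rho_smooth.continuousOn).smul continuousOn_const)
  exact ⟨A, hA⟩

/-- Realising the stress by bounded operators on `L²` allows the energy to be differentiated in time
by the chain rule. -/
theorem exists_stressOp :
    ∃ S : Fin d → (Fin d → M.L2Om) →L[ℂ] M.L2Om, ∀ j G, S j G =ᵐ[M.vol] fun x =>
      (WithLp.toLp 2 fun i => M.stress x (fun k => G k x) i j : Vec d) := by
  have h1 : ContinuousOn (fun x => (M.mu x : ℂ)) M.Om :=
    Complex.continuous_ofReal.comp_continuousOn M.mu_smooth.continuousOn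
  have h2 : ContinuousOn (fun x => (M.lam x : ℂ)) M.Om :=
    Complex.continuous_ofReal.comp_continuousOn M.lam_smooth.continuousOn
  let e : Fin d → Fin d → Vec d →L[ℂ] Vec d := fun a b =>
    (EuclideanSpace.proj (𝕜 := ℂ) a).smulRight (EuclideanSpace.single b (1 : ℂ))
  have he : ∀ a b v i, e a b v i = if i = b then v a else 0 := fun a b v i => by
    simp [e]
  -- The coefficient of `G k` in column `j` of the stress. As `e a b v` puts `v a` into position
  -- `b`, summing over `k` makes `e j k` produce the transposed gradient and `e k j` the trace in
  -- the diagonal position.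
  choose A hA using fun j k => M.exists_mulOp (C := fun x =>
      (M.mu x : ℂ) • ((if j = k then ContinuousLinearMap.id ℂ (Vec d) else 0) + e j k) +
        (M.lam x : ℂ) • e k j)
    ((h1.smul continuousOn_const).add (h2.smul continuousOn_const))
  refine ⟨fun j => ∑ k, (A j k).comp (ContinuousLinearMap.proj k), fun j G => ?_⟩
  have hsum : (∑ k, (A j k).comp (ContinuousLinearMap.proj k : (Fin d → M.L2Om) →L[ℂ] M.L2Om)) G
      = ∑ k, A j k (G k) := by
    rw [sum_apply]
    rfl
  rw [hsum]
  have hc : ∀ᵐ x ∂M.vol, ∀ k, A j k (G k) x = ((M.mu x : ℂ) •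
      ((if j = k then ContinuousLinearMap.id ℂ (Vec d) else 0) + e j k) +
        (M.lam x : ℂ) • e k j) (G k x) := ae_all_iff.2 fun k => hA j k (G k)
  filter_upwards [hc, Lp.coeFn_finsetSum Finset.univ fun k => A j k (G k)] with x h3 h4
  rw [h4]
  ext i
  simp only [Finset.sum_apply, h3, add_apply, smul_apply, WithLp.ofLp_sum, PiLp.add_apply,
    PiLp.smul_apply, he, smul_eq_mul, stress, Finset.sum_add_distrib, mul_add, mul_ite, mul_zero,
    Finset.sum_ite_eq, Finset.mem_univ, if_true, Finset.mul_sum]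
  congr 1
  · congr 1
    rw [Finset.sum_eq_single j]
    · simp
    · intro k _ hk
      simp [Ne.symm hk]
    · simp
  · split_ifs <;> simp

theorem stress_conj (x : Pt d) (G : Fin d → Vec d) (i j : Fin d) :
    M.stress x (fun k => conjVec (G k)) i j = starRingEnd ℂ (M.stress x G i j) := by
  simp only [stress, conjVec_apply, map_add, map_mul, Complex.conj_ofReal, apply_ite (starRingEnd ℂ),
    map_sum, map_zero]

/-- The density of the elastic energy form. -/
noncomputable def stressForm (x : Pt d) (G H : Fin d → Vec d) : ℂ :=
  ∑ j, inner ℂ (H j) (WithLp.toLp 2 fun i => M.stress x G i j : Vec d)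

theorem stressForm_eq (x : Pt d) (G H : Fin d → Vec d) :
    M.stressForm x G H = ∑ i, ∑ j, M.stress x G i j * conjVec (H j) i := by
  rw [Finset.sum_comm]
  simp [stressForm, PiLp.inner_apply, conjVec_apply]

/-- Hermitian symmetry, from the symmetry of the elasticity tensor and real coefficients. It makes
the two halves of the derivative of the energy conjugate to each other. -/
theorem stressForm_conj (x : Pt d) (G H : Fin d → Vec d) :
    starRingEnd ℂ (M.stressForm x G H) = M.stressForm x H G := by
  rw [stressForm_eq, M.stress_symm x G (fun j => conjVec (H j)), stressForm, map_sum]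
  refine Finset.sum_congr rfl fun j _ => ?_
  simp [dotc, PiLp.inner_apply, M.stress_conj x H, mul_comm]

/-- The stress is symmetric and therefore pairs only with the symmetric part of the gradient;
averaging over the exchange of `i` and `j` yields the factor one half. -/
theorem stressForm_self (x : Pt d) (G : Fin d → Vec d) :
    (M.stressForm x G G).re = M.mu x / 2 * ∑ i, ∑ j, ‖G j i + G i j‖ ^ 2 +
      M.lam x * ‖∑ k, G k k‖ ^ 2 := by
  have h1 : ∑ i, ∑ j, (G j i + G i j) * starRingEnd ℂ (G j i) =
      ∑ i, ∑ j, (G j i + G i j) * starRingEnd ℂ (G i j) := by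
    rw [Finset.sum_comm]
    simp only [add_comm]
  have h2 : ∑ i, ∑ j, (G j i + G i j) * starRingEnd ℂ (G j i) =
      ((1 / 2 * ∑ i, ∑ j, ‖G j i + G i j‖ ^ 2 : ℝ) : ℂ) := by
    have h3 : (2 : ℂ) * ∑ i, ∑ j, (G j i + G i j) * starRingEnd ℂ (G j i) =
        ∑ i, ∑ j, (G j i + G i j) * starRingEnd ℂ (G j i + G i j) := by
      rw [two_mul]
      conv_lhs => enter [2]; rw [h1]
      simp only [← Finset.sum_add_distrib, map_add, mul_add]
    have h4 : ∑ i, ∑ j, (G j i + G i j) * starRingEnd ℂ (G j i + G i j) =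
        ((∑ i, ∑ j, ‖G j i + G i j‖ ^ 2 : ℝ) : ℂ) := by
      push_cast
      simp only [Complex.mul_conj']
    rw [h4] at h3
    push_cast at h3 ⊢
    rw [← h3]
    ring
  have h5 : M.stressForm x G G = (M.mu x : ℂ) * ∑ i, ∑ j, (G j i + G i j) * starRingEnd ℂ (G j i) +
      (M.lam x : ℂ) * ((∑ k, G k k) * starRingEnd ℂ (∑ k, G k k)) := by
    rw [stressForm_eq]
    simp only [stress, conjVec_apply, add_mul (M.mu x * _ : ℂ), ite_mul, zero_mul,
      Finset.sum_add_distrib, Finset.sum_ite_eq, Finset.mem_univ, if_true, mul_assoc,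
      ← Finset.mul_sum, map_sum]
  rw [h5, h2, Complex.mul_conj', Complex.add_re, ← Complex.ofReal_mul, Complex.ofReal_re,
    ← Complex.ofReal_pow, ← Complex.ofReal_mul, Complex.ofReal_re]
  ring

/-- Pointwise coercivity of the elastic energy in the symmetric gradient. -/
theorem exists_stressForm_lower_bound {x : Pt d} (hx : x ∈ M.Om) :
    ∃ c > 0, ∀ G : Fin d → Vec d,
      c * ∑ i, ∑ j, ‖G j i + G i j‖ ^ 2 ≤ (M.stressForm x G G).re := by
  have hmu := M.mu_pos x hx
  have hell := M.elliptic x hx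
  -- Cauchy–Schwarz gives the factor `d`, and the diagonal entries `2 G k k` of `G + Gᵀ` give the
  -- `4`. For `λ ≤ 0` the coefficient left over is `μ/2 + dλ/4 = (dλ + 2μ)/4`, positive by
  -- ellipticity.
  have htr : ∀ G : Fin d → Vec d,
      ‖∑ k, G k k‖ ^ 2 ≤ d / 4 * ∑ i, ∑ j, ‖G j i + G i j‖ ^ 2 := by
    intro G
    have h1 : ‖∑ k, G k k‖ ^ 2 ≤ d * ∑ k, ‖G k k‖ ^ 2 := by
      calc ‖∑ k, G k k‖ ^ 2 ≤ (∑ k, ‖G k k‖) ^ 2 := by gcongr; exact norm_sum_le _ _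
        _ ≤ _ := by
          have := sq_sum_le_card_mul_sum_sq (s := Finset.univ) (f := fun k : Fin d => ‖G k k‖)
          simpa using this
    have h2 : 4 * ∑ k, ‖G k k‖ ^ 2 ≤ ∑ i, ∑ j, ‖G j i + G i j‖ ^ 2 := by
      rw [Finset.mul_sum]
      refine Finset.sum_le_sum fun i _ => ?_
      refine le_trans (le_of_eq ?_) (Finset.single_le_sum (f := fun j => ‖G j i + G i j‖ ^ 2)
        (fun _ _ => by positivity) (Finset.mem_univ i))
      simp only
      rw [← two_mul, norm_mul]
      norm_num
      ring
    have hd0 : (0 : ℝ) ≤ d := Nat.cast_nonneg d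
    nlinarith
  rcases le_total 0 (M.lam x) with hl | hl
  · refine ⟨M.mu x / 2, by positivity, fun G => ?_⟩
    rw [stressForm_self]
    have := mul_nonneg hl (sq_nonneg ‖∑ k, G k k‖)
    linarith
  · refine ⟨(d * M.lam x + 2 * M.mu x) / 4, by positivity, fun G => ?_⟩
    rw [stressForm_self]
    have := mul_le_mul_of_nonpos_left (htr G) hl
    linarith

theorem stressForm_self_nonneg {x : Pt d} (hx : x ∈ M.Om) (G : Fin d → Vec d) :
    0 ≤ (M.stressForm x G G).re := by
  obtain ⟨c, hc, h⟩ := M.exists_stressForm_lower_bound hx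
  exact le_trans (by positivity) (h G)

/-- Vanishing energy only forces the symmetric gradient to vanish. This already determines the
stress, so no Korn inequality is needed. -/
theorem stress_eq_zero {x : Pt d} (hx : x ∈ M.Om) {G : Fin d → Vec d}
    (hG : (M.stressForm x G G).re = 0) (i j : Fin d) : M.stress x G i j = 0 := by
  obtain ⟨c, hc, h⟩ := M.exists_stressForm_lower_bound hx
  have h1 := h G
  rw [hG] at h1
  have h2 : ∑ i, ∑ j, ‖G j i + G i j‖ ^ 2 = 0 :=
    le_antisymm (nonpos_of_mul_nonpos_right h1 hc) (by positivity)
  have h3 : ∀ i j, G j i + G i j = 0 := fun i j => by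
    have h4 := (Finset.sum_eq_zero_iff_of_nonneg fun i _ => by positivity).1 h2 i (Finset.mem_univ i)
    have h5 := (Finset.sum_eq_zero_iff_of_nonneg fun j _ => by positivity).1 h4 j (Finset.mem_univ j)
    exact norm_eq_zero.1 (pow_eq_zero_iff (by norm_num) |>.1 h5)
  have h6 : ∑ k, G k k = 0 := Finset.sum_eq_zero fun k _ => by
    have := h3 k k
    rwa [← two_mul, mul_eq_zero, or_iff_right two_ne_zero] at this
  rw [stress, h3, h6]
  simp

end ElasticMedium

end ElasticWave

/-! ### Testing with fields of zero trace -/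

namespace ElasticWave

variable {d : ℕ}

theorem norm_dotc_le (a b : Vec d) {ε : ℝ} (hε : 0 < ε) :
    ‖dotc a b‖ ≤ 1 / 2 * (ε * ‖a‖ ^ 2 + ε⁻¹ * ‖b‖ ^ 2) := by
  rw [EuclideanSpace.norm_sq_eq, EuclideanSpace.norm_sq_eq, Finset.mul_sum, Finset.mul_sum,
    ← Finset.sum_add_distrib, Finset.mul_sum]
  refine (norm_sum_le _ _).trans (Finset.sum_le_sum fun i _ => ?_)
  rw [norm_mul]
  have h1 : ε * ε⁻¹ = 1 := mul_inv_cancel₀ hε.ne'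
  have h2 : 0 ≤ ε⁻¹ * (ε * ‖a i‖ - ‖b i‖) ^ 2 := by positivity
  have h3 : ε⁻¹ * (ε * ‖a i‖ - ‖b i‖) ^ 2 =
      ε * ‖a i‖ ^ 2 - 2 * (‖a i‖ * ‖b i‖) + ε⁻¹ * ‖b i‖ ^ 2 := by
    linear_combination (ε * ‖a i‖ ^ 2 - 2 * (‖a i‖ * ‖b i‖)) * h1
  linarith

theorem norm_sq_Lp_eq {α : Type*} [MeasurableSpace α] {m : Measure α} (f : Lp (Vec d) 2 m) :
    ‖f‖ ^ 2 = ∫ x, ‖f x‖ ^ 2 ∂m := by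
  have h := inner_self_eq_norm_sq_to_K (𝕜 := ℂ) f
  rw [L2.inner_def] at h
  simp only [inner_self_eq_norm_sq_to_K (𝕜 := ℂ)] at h
  have h2 : ((∫ x, ‖f x‖ ^ 2 ∂m : ℝ) : ℂ) = ((‖f‖ ^ 2 : ℝ) : ℂ) := by
    rw [← integral_complex_ofReal]
    push_cast
    exact h
  exact_mod_cast h2.symm

theorem integrable_norm_sq_Lp {α : Type*} [MeasurableSpace α] {m : Measure α}
    (f : Lp (Vec d) 2 m) : Integrable (fun x => ‖f x‖ ^ 2) m :=
  (Lp.memLp f).integrable_norm_pow (by norm_num)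

theorem contDiff_conjVec {w : Pt d → Vec d} (hw : ContDiff ℝ ∞ w) :
    ContDiff ℝ ∞ fun x => conjVec (w x) := conjVec.contDiff.comp hw

theorem pderiv_conjVec {w : Pt d → Vec d} (hw : ContDiff ℝ ∞ w) (j : Fin d) (x : Pt d) :
    pderiv j (fun x => conjVec (w x)) x = conjVec (pderiv j w x) := by
  have := (conjVec.hasFDerivAt (x := w x)).comp x ((hw.differentiable (by simp)) x).hasFDerivAt
  exact congrArg (fun L : Pt d →L[ℝ] Vec d => L (EuclideanSpace.single j 1)) this.fderiv

namespace ElasticMedium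

variable {M : ElasticMedium d}

theorem inner_densityOp {R : M.L2Om →L[ℂ] M.L2Om}
    (hR : ∀ u, R u =ᵐ[M.vol] fun x => (M.rho x : ℂ) • u x) (u v : M.L2Om) :
    inner ℂ v (R u) = ∫ x, (M.rho x : ℂ) * inner ℂ (v x) (u x) ∂M.vol := by
  rw [L2.inner_def]
  refine integral_congr_ae ?_
  filter_upwards [hR u] with x hx
  rw [hx, inner_smul_right]

theorem inner_stressOp {S : Fin d → (Fin d → M.L2Om) →L[ℂ] M.L2Om}
    (hS : ∀ j G, S j G =ᵐ[M.vol] fun x =>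
      (WithLp.toLp 2 fun i => M.stress x (fun k => G k x) i j : Vec d)) (G H : Fin d → M.L2Om) :
    ∑ j, inner ℂ (H j) (S j G) =
      ∫ x, M.stressForm x (fun k => G k x) (fun k => H k x) ∂M.vol := by
  simp only [L2.inner_def]
  rw [← integral_finsetSum _ fun j _ => L2.integrable_inner (𝕜 := ℂ) (H j) (S j G)]
  refine integral_congr_ae ?_
  have : ∀ᵐ x ∂M.vol, ∀ j, S j G x =
      (WithLp.toLp 2 fun i => M.stress x (fun k => G k x) i j : Vec d) :=
    ae_all_iff.2 fun j => hS j G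
  filter_upwards [this] with x hx
  simp only [hx]
  rfl

theorem integrable_stressForm (G H : Fin d → M.L2Om) :
    Integrable (fun x => M.stressForm x (fun k => G k x) (fun k => H k x)) M.vol := by
  obtain ⟨S, hS⟩ := M.exists_stressOp
  refine (integrable_finsetSum Finset.univ fun j _ =>
    L2.integrable_inner (𝕜 := ℂ) (H j) (S j G)).congr ?_
  have : ∀ᵐ x ∂M.vol, ∀ j, S j G x =
      (WithLp.toLp 2 fun i => M.stress x (fun k => G k x) i j : Vec d) :=
    ae_all_iff.2 fun j => hS j G
  filter_upwards [this] with x hx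
  simp only [hx]
  rfl

theorem inner_jet_densityOp {R : M.L2Om →L[ℂ] M.L2Om}
    (hR : ∀ u, R u =ᵐ[M.vol] fun x => (M.rho x : ℂ) • u x) (u : M.L2Om) (w : smoothFields d) :
    inner ℂ (M.jet w).1 (R u) = M.massForm u fun x => conjVec ((w : Pt d → Vec d) x) := by
  rw [inner_densityOp hR]
  refine integral_congr_ae ?_
  filter_upwards [(M.memLp_vol (smoothFields_contDiff w).continuous.continuousOn).coeFn_toLp]
    with x hx
  rw [dotc_conjVec]
  exact congrArg (fun v => (M.rho x : ℂ) * inner ℂ v (u x)) hx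

theorem inner_jet_stressOp {S : Fin d → (Fin d → M.L2Om) →L[ℂ] M.L2Om}
    (hS : ∀ j G, S j G =ᵐ[M.vol] fun x =>
      (WithLp.toLp 2 fun i => M.stress x (fun k => G k x) i j : Vec d)) (G : Fin d → M.L2Om)
    (w : smoothFields d) :
    ∑ j, inner ℂ ((M.jet w).2.1 j) (S j G) =
      M.energyForm G fun x => conjVec ((w : Pt d → Vec d) x) := by
  rw [inner_stressOp hS]
  refine integral_congr_ae ?_
  have : ∀ᵐ x ∂M.vol, ∀ j, ((M.jet w).2.1 j : Pt d → Vec d) x = pderiv j (w : Pt d → Vec d) x :=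
    ae_all_iff.2 fun j => (M.memLp_vol (continuous_pderiv w.2 j).continuousOn).coeFn_toLp
  filter_upwards [this] with x hx
  simp only [hx, stressForm_eq, pderiv_conjVec (smoothFields_contDiff w)]

end ElasticMedium

namespace EnergyField

variable {M : ElasticMedium d} {T : ℝ}

/-- Young's inequality under the integral bounds the boundary term by the `L²` norms of the traction
and of the trace. The free parameter `ε` lets the traction be made harmless once the trace is zero.
Conjugation of `w` passes from the bilinear forms to inner products. -/
theorem norm_traction_integral_le (hT : 0 < T) (k : M.L2lat T) (w : smoothFields d) {ε : ℝ}
    (hε : 0 < ε) {t : ℝ} (ht : t ∈ Icc 0 T) :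
    ‖∫ s in (0 : ℝ)..t, ∫ x, dotc (k (s, x)) (conjVec ((w : Pt d → Vec d) x)) ∂M.surf‖ ≤
      1 / 2 * (ε * ‖k‖ ^ 2 + ε⁻¹ * (T * ‖(M.jet w).2.2‖ ^ 2)) := by
  have hw := contDiff_conjVec (smoothFields_contDiff w)
  have hki := integrable_traction_pairing k hw
  have hwn : Integrable (fun p : ℝ × Pt d => ‖(w : Pt d → Vec d) p.2‖ ^ 2) (M.lat T) := by
    have hc : Continuous fun p : ℝ × Pt d => (w : Pt d → Vec d) p.2 :=
      (smoothFields_contDiff w).continuous.comp continuous_snd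
    exact (M.memLp_lat hc.continuousOn).integrable_norm_pow (by norm_num)
  have hnc : ∀ v : Vec d, ‖conjVec v‖ = ‖v‖ := fun v => by
    rw [EuclideanSpace.norm_eq, EuclideanSpace.norm_eq]
    simp [conjVec_apply]
  have h1 : ‖∫ s in (0 : ℝ)..t, ∫ x, dotc (k (s, x)) (conjVec ((w : Pt d → Vec d) x)) ∂M.surf‖ ≤
      ∫ p, ‖dotc (k p) (conjVec ((w : Pt d → Vec d) p.2))‖ ∂M.lat T := by
    have hI := hki.integral_norm_prod_left
    have hEq : ∫ p, ‖dotc (k p) (conjVec ((w : Pt d → Vec d) p.2))‖ ∂M.lat T =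
        ∫ s in Ioo 0 T, ∫ x, ‖dotc (k (s, x)) (conjVec ((w : Pt d → Vec d) x))‖ ∂M.surf :=
      integral_prod _ hki.norm
    rw [intervalIntegral.integral_of_le ht.1, integral_Ioc_eq_integral_Ioo, hEq]
    refine (norm_integral_le_integral_norm _).trans ?_
    refine (setIntegral_mono_set hki.integral_prod_left.norm
      (Eventually.of_forall fun s => norm_nonneg _)
      (Ioo_subset_Ioo_right ht.2).eventuallyLE).trans ?_
    exact integral_mono hki.integral_prod_left.norm hI fun s => norm_integral_le_integral_norm _
  refine h1.trans ?_
  have h2 : T * ‖(M.jet w).2.2‖ ^ 2 = ∫ p, ‖(w : Pt d → Vec d) p.2‖ ^ 2 ∂M.lat T := by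
    have e1 : ∫ p, ‖(w : Pt d → Vec d) p.2‖ ^ 2 ∂M.lat T =
        ∫ s in Ioo 0 T, ∫ x, ‖(w : Pt d → Vec d) x‖ ^ 2 ∂M.surf := integral_prod _ hwn
    rw [e1, norm_sq_Lp_eq, setIntegral_const, smul_eq_mul]
    congr 1
    · simp [hT.le]
    · refine integral_congr_ae ?_
      filter_upwards [(M.memLp_surf (smoothFields_contDiff w).continuous.continuousOn).coeFn_toLp]
        with x hx
      exact congrArg (fun v : Vec d => ‖v‖ ^ 2) hx
  rw [h2, norm_sq_Lp_eq k, ← integral_const_mul, ← integral_const_mul, ← integral_add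
    ((integrable_norm_sq_Lp k).const_mul _) (hwn.const_mul _), ← integral_const_mul]
  refine integral_mono hki.norm ((((integrable_norm_sq_Lp k).const_mul _).add
    (hwn.const_mul _)).const_mul _) fun p => ?_
  have := norm_dotc_le (k p) (conjVec ((w : Pt d → Vec d) p.2)) hε
  rwa [hnc] at this

/-- The time-integrated gradient. -/
noncomputable def intDu (U : EnergyField M.toSmoothDomain T) (t : ℝ) : Fin d → M.L2Om :=
  ∫ s in (0 : ℝ)..t, U.Du s

theorem intervalIntegrable_Du (U : EnergyField M.toSmoothDomain T) {t : ℝ} (ht : t ∈ Icc 0 T) :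
    IntervalIntegrable U.Du volume 0 t := by
  apply ContinuousOn.intervalIntegrable
  rw [uIcc_of_le ht.1]
  exact U.Du_cont.mono (Icc_subset_Icc_right ht.2)

theorem energyForm_intDu (U : EnergyField M.toSmoothDomain T) {w : Pt d → Vec d}
    (hw : ContDiff ℝ ∞ w) {t : ℝ} (ht : t ∈ Icc 0 T) :
    M.energyForm (U.intDu t) w = ∫ s in (0 : ℝ)..t, M.energyForm (U.Du s) w := by
  obtain ⟨A, hA⟩ := M.exists_energyForm_clm hw
  simp only [← hA]
  exact (A.intervalIntegral_comp_comm (U.intervalIntegrable_Du ht)).symm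

theorem HasTraction.massForm_add_energyForm (hT : 0 < T) {U : EnergyField M.toSmoothDomain T}
    {k : M.L2lat T} (hk : U.HasTraction k) (h0 : U.ut 0 = 0) {w : Pt d → Vec d}
    (hw : ContDiff ℝ ∞ w) {t : ℝ} (ht : t ∈ Icc 0 T) :
    M.massForm (U.ut t) w + M.energyForm (U.intDu t) w =
      ∫ s in (0 : ℝ)..t, ∫ x, dotc (k (s, x)) (w x) ∂M.surf := by
  obtain ⟨ha, hm⟩ := hk.massForm_ut hT h0 hw
  have hb := M.intervalIntegrable_lat hT (integrable_traction_pairing k hw)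
  have hsub : uIcc 0 t ⊆ uIcc 0 T := by
    rw [uIcc_of_le ht.1, uIcc_of_le hT.le]
    exact Icc_subset_Icc_right ht.2
  rw [hm t ht, U.energyForm_intDu hw ht, intervalIntegral.integral_sub (ha.mono_set hsub)
    (hb.mono_set hsub)]
  ring

/-- The integrated weak formulation may be tested with `H¹` fields of zero trace. -/
theorem HasTraction.test_zero_trace (hT : 0 < T) {U : EnergyField M.toSmoothDomain T}
    {k : M.L2lat T} (hk : U.HasTraction k) (h0 : U.ut 0 = 0) {R : M.L2Om →L[ℂ] M.L2Om}
    (hR : ∀ u, R u =ᵐ[M.vol] fun x => (M.rho x : ℂ) • u x)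
    {S : Fin d → (Fin d → M.L2Om) →L[ℂ] M.L2Om}
    (hS : ∀ j G, S j G =ᵐ[M.vol] fun x =>
      (WithLp.toLp 2 fun i => M.stress x (fun k => G k x) i j : Vec d))
    {t : ℝ} (ht : t ∈ Icc 0 T) {p : M.L2Om × (Fin d → M.L2Om) × M.L2bdry} (hp : p ∈ M.H1Trace)
    (hp0 : p.2.2 = 0) :
    inner ℂ p.1 (R (U.ut t)) + ∑ j, inner ℂ (p.2.1 j) (S j (U.intDu t)) = 0 := by
  -- Smooth approximations of a field with zero trace need not vanish on the boundary. The bound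
  -- involving the trace is a closed condition, so it passes to the limit; only then are the trace
  -- set to zero and `ε` sent to zero.
  have hle : ∀ ε > 0, ‖inner ℂ p.1 (R (U.ut t)) + ∑ j, inner ℂ (p.2.1 j) (S j (U.intDu t))‖ ≤
      1 / 2 * (ε * ‖k‖ ^ 2 + ε⁻¹ * (T * ‖p.2.2‖ ^ 2)) := by
    intro ε hε
    have hcl : IsClosed {p : M.L2Om × (Fin d → M.L2Om) × M.L2bdry |
        ‖inner ℂ p.1 (R (U.ut t)) + ∑ j, inner ℂ (p.2.1 j) (S j (U.intDu t))‖ ≤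
      1 / 2 * (ε * ‖k‖ ^ 2 + ε⁻¹ * (T * ‖p.2.2‖ ^ 2))} := by
      refine isClosed_le (Continuous.norm ((continuous_fst.inner continuous_const).add
        (continuous_finsetSum _ fun j _ => Continuous.inner
          ((continuous_apply j).comp (continuous_fst.comp continuous_snd)) continuous_const))) ?_
      fun_prop
    refine closure_minimal ?_ hcl hp
    rintro _ ⟨w, rfl⟩
    change ‖inner ℂ (M.jet w).1 (R (U.ut t)) +
      ∑ j, inner ℂ ((M.jet w).2.1 j) (S j (U.intDu t))‖ ≤ _
    rw [ElasticMedium.inner_jet_densityOp hR, ElasticMedium.inner_jet_stressOp hS,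
      hk.massForm_add_energyForm hT h0
        (contDiff_conjVec (smoothFields_contDiff w)) ht]
    exact norm_traction_integral_le hT k w hε ht
  rw [hp0] at hle
  simp only [norm_zero, ne_eq, OfNat.ofNat_ne_zero, not_false_eq_true, zero_pow, mul_zero,
    add_zero] at hle
  refine norm_le_zero_iff.1 (le_of_forall_pos_le_add fun δ hδ => ?_)
  -- Chosen so that `ε ‖k‖² / 2 ≤ δ`; the added one covers `k = 0`.
  refine (hle (2 * δ / (‖k‖ ^ 2 + 1)) (by positivity)).trans ?_
  have h1 : 2 * δ / (‖k‖ ^ 2 + 1) * ‖k‖ ^ 2 ≤ 2 * δ := by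
    rw [div_mul_eq_mul_div, div_le_iff₀ (by positivity)]
    nlinarith
  linarith

end EnergyField

end ElasticWave

/-! ### Conservation of energy and uniqueness -/

namespace ElasticWave

variable {d : ℕ}

namespace ElasticMedium

variable {M : ElasticMedium d}

theorem inner_densityOp_conj {R : M.L2Om →L[ℂ] M.L2Om}
    (hR : ∀ u, R u =ᵐ[M.vol] fun x => (M.rho x : ℂ) • u x) (u v : M.L2Om) :
    starRingEnd ℂ (inner ℂ v (R u)) = inner ℂ u (R v) := by
  rw [inner_densityOp hR, inner_densityOp hR, ← integral_conj]
  simp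

theorem inner_stressOp_conj {S : Fin d → (Fin d → M.L2Om) →L[ℂ] M.L2Om}
    (hS : ∀ j G, S j G =ᵐ[M.vol] fun x =>
      (WithLp.toLp 2 fun i => M.stress x (fun k => G k x) i j : Vec d)) (G H : Fin d → M.L2Om) :
    starRingEnd ℂ (∑ j, inner ℂ (H j) (S j G)) = ∑ j, inner ℂ (G j) (S j H) := by
  rw [inner_stressOp hS, inner_stressOp hS, ← integral_conj]
  simp only [stressForm_conj]

theorem inner_densityOp_self {R : M.L2Om →L[ℂ] M.L2Om}
    (hR : ∀ u, R u =ᵐ[M.vol] fun x => (M.rho x : ℂ) • u x) (u : M.L2Om) :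
    0 ≤ (inner ℂ u (R u)).re ∧ ((inner ℂ u (R u)).re = 0 → u = 0) := by
  have hp : ∀ x, (M.rho x : ℂ) * inner ℂ (u x) (u x) = ((M.rho x * ‖u x‖ ^ 2 : ℝ) : ℂ) :=
    fun x => by
      rw [inner_self_eq_norm_sq_to_K (𝕜 := ℂ)]
      push_cast
      rfl
  have h1 : (inner ℂ u (R u)).re = ∫ x, M.rho x * ‖u x‖ ^ 2 ∂M.vol := by
    rw [inner_densityOp hR]
    simp only [hp]
    rw [integral_complex_ofReal, Complex.ofReal_re]
  have hi : Integrable (fun x => M.rho x * ‖u x‖ ^ 2) M.vol := by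
    have h2 : Integrable (fun x => ((M.rho x * ‖u x‖ ^ 2 : ℝ) : ℂ)) M.vol := by
      refine (L2.integrable_inner (𝕜 := ℂ) u (R u)).congr ?_
      filter_upwards [hR u] with x hx
      rw [hx, inner_smul_right, hp]
    exact h2.re
  have hn : 0 ≤ᵐ[M.vol] fun x => M.rho x * ‖u x‖ ^ 2 := by
    filter_upwards [M.ae_vol_mem] with x hx
    have := M.rho_pos x hx
    positivity
  rw [h1]
  refine ⟨integral_nonneg_of_ae hn, fun h0 => ?_⟩
  have h3 := (integral_eq_zero_iff_of_nonneg_ae hn hi).1 h0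
  refine (Lp.eq_zero_iff_ae_eq_zero).2 ?_
  filter_upwards [h3, M.ae_vol_mem] with x hx hxm
  have h4 : M.rho x * ‖u x‖ ^ 2 = 0 := hx
  rw [mul_eq_zero, or_iff_right (M.rho_pos x hxm).ne'] at h4
  exact norm_eq_zero.1 (pow_eq_zero_iff (by norm_num) |>.1 h4)

theorem inner_stressOp_self {S : Fin d → (Fin d → M.L2Om) →L[ℂ] M.L2Om}
    (hS : ∀ j G, S j G =ᵐ[M.vol] fun x =>
      (WithLp.toLp 2 fun i => M.stress x (fun k => G k x) i j : Vec d)) (G : Fin d → M.L2Om) :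
    0 ≤ (∑ j, inner ℂ (G j) (S j G)).re ∧
      ((∑ j, inner ℂ (G j) (S j G)).re = 0 → ∀ w, M.energyForm G w = 0) := by
  have hi := (integrable_stressForm (M := M) G G)
  have h1 : (∑ j, inner ℂ (G j) (S j G)).re =
      ∫ x, (M.stressForm x (fun k => G k x) (fun k => G k x)).re ∂M.vol := by
    rw [inner_stressOp hS]
    exact (integral_re hi).symm
  have hn : 0 ≤ᵐ[M.vol] fun x => (M.stressForm x (fun k => G k x) (fun k => G k x)).re := by
    filter_upwards [M.ae_vol_mem] with x hx using M.stressForm_self_nonneg hx _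
  rw [h1]
  refine ⟨integral_nonneg_of_ae hn, fun h0 w => ?_⟩
  have h3 := (integral_eq_zero_iff_of_nonneg_ae hn hi.re).1 h0
  refine integral_eq_zero_of_ae ?_
  filter_upwards [h3, M.ae_vol_mem] with x hx hxm
  simp [M.stress_eq_zero hxm hx]

end ElasticMedium

namespace EnergyField

variable {M : ElasticMedium d} {T : ℝ}

theorem hasDerivWithinAt_intDu (U : EnergyField M.toSmoothDomain T) {t : ℝ}
    (ht : t ∈ Icc 0 T) : HasDerivWithinAt U.intDu (U.Du t) (Icc 0 T) t := by
  have : Fact (t ∈ Icc 0 T) := ⟨ht⟩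
  exact intervalIntegral.integral_hasDerivWithinAt_right (U.intervalIntegrable_Du ht)
    (U.Du_cont.stronglyMeasurableAtFilter_nhdsWithin measurableSet_Icc t) (U.Du_cont t ht)

/-- The energy `(u, ρu) + ∫ σ(∫₀ᵗ∇u) : ∫₀ᵗ∇u`, for operators `R` and `S` representing multiplication
by the density and the stress. -/
noncomputable def energy (U : EnergyField M.toSmoothDomain T) (R : M.L2Om →L[ℂ] M.L2Om)
    (S : Fin d → (Fin d → M.L2Om) →L[ℂ] M.L2Om) (t : ℝ) : ℂ :=
  inner ℂ (U.u t) (R (U.u t)) + ∑ j, inner ℂ (U.intDu t j) (S j (U.intDu t))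

theorem hasDerivWithinAt_energy (U : EnergyField M.toSmoothDomain T) (R : M.L2Om →L[ℂ] M.L2Om)
    (S : Fin d → (Fin d → M.L2Om) →L[ℂ] M.L2Om) {t : ℝ} (ht : t ∈ Icc 0 T) :
    HasDerivWithinAt (U.energy R S)
      ((inner ℂ (U.u t) (R (U.ut t)) + inner ℂ (U.ut t) (R (U.u t))) +
        ∑ j, (inner ℂ (U.intDu t j) (S j (U.Du t)) + inner ℂ (U.Du t j) (S j (U.intDu t))))
      (Icc 0 T) t := by
  have h1 := U.deriv_u t ht
  have h2 := U.hasDerivWithinAt_intDu ht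
  have h3 : HasDerivWithinAt (fun t => R (U.u t)) (R (U.ut t)) (Icc 0 T) t :=
    (R.restrictScalars ℝ).hasFDerivAt.comp_hasDerivWithinAt t h1
  refine (h1.inner ℂ h3).add (HasDerivWithinAt.fun_sum fun j _ => ?_)
  have h4 : HasDerivWithinAt (fun t => S j (U.intDu t)) (S j (U.Du t)) (Icc 0 T) t :=
    ((S j).restrictScalars ℝ).hasFDerivAt.comp_hasDerivWithinAt t h2
  exact (hasDerivWithinAt_pi.1 h2 j).inner ℂ h4

theorem intDu_zero (U : EnergyField M.toSmoothDomain T) : U.intDu 0 = 0 :=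
  intervalIntegral.integral_same

/-- Testing the time-integrated equation with the admissible field `u(t)` annihilates one half of
the derivative of the energy; the other half is its complex conjugate. -/
theorem HasTraction.deriv_energy_eq_zero (hT : 0 < T) {U : EnergyField M.toSmoothDomain T}
    {k : M.L2lat T} (hk : U.HasTraction k) (hu0 : U.u 0 = 0) (h0 : U.ut 0 = 0)
    (htr : ∀ t ∈ Ioo 0 T, U.tr t = 0) {R : M.L2Om →L[ℂ] M.L2Om}
    (hR : ∀ u, R u =ᵐ[M.vol] fun x => (M.rho x : ℂ) • u x)
    {S : Fin d → (Fin d → M.L2Om) →L[ℂ] M.L2Om}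
    (hS : ∀ j G, S j G =ᵐ[M.vol] fun x =>
      (WithLp.toLp 2 fun i => M.stress x (fun k => G k x) i j : Vec d)) {t : ℝ}
    (ht : t ∈ Ico 0 T) :
    (inner ℂ (U.u t) (R (U.ut t)) + inner ℂ (U.ut t) (R (U.u t))) +
      ∑ j, (inner ℂ (U.intDu t j) (S j (U.Du t)) + inner ℂ (U.Du t j) (S j (U.intDu t))) = 0 := by
  have h3 : inner ℂ (U.u t) (R (U.ut t)) + ∑ j, inner ℂ (U.Du t j) (S j (U.intDu t)) = 0 := by
    -- The trace is known only for positive times; at `t = 0` the initial value and the empty time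
    -- integral suffice.
    rcases ht.1.eq_or_lt with h | h
    · rw [← h, hu0, U.intDu_zero]
      simp
    · have h5 := hk.test_zero_trace hT h0 hR hS (t := t) (p := (U.u t, U.Du t, U.tr t))
        ⟨ht.1, ht.2.le⟩ (U.mem_H1 t ⟨ht.1, ht.2.le⟩) (htr t ⟨h, ht.2⟩)
      exact h5
  have ea := ElasticMedium.inner_densityOp_conj hR (U.ut t) (U.u t)
  have eb := ElasticMedium.inner_stressOp_conj hS (U.intDu t) (U.Du t)
  have h4 : starRingEnd ℂ (inner ℂ (U.u t) (R (U.ut t))) +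
      starRingEnd ℂ (∑ j, inner ℂ (U.Du t j) (S j (U.intDu t))) = 0 := by
    rw [← RingHom.map_add, h3, RingHom.map_zero]
  rw [ea, eb] at h4
  rw [Finset.sum_add_distrib]
  have key : ∀ a b c e : ℂ, a + b = 0 → c + e = 0 → (a + c) + (e + b) = 0 := by
    intro a b c e h h'
    linear_combination h + h'
  exact key _ _ _ _ h3 h4

theorem HasTraction.energy_eq_zero (hT : 0 < T) {U : EnergyField M.toSmoothDomain T}
    {k : M.L2lat T} (hk : U.HasTraction k) (hu0 : U.u 0 = 0) (h0 : U.ut 0 = 0)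
    (htr : ∀ t ∈ Ioo 0 T, U.tr t = 0) {R : M.L2Om →L[ℂ] M.L2Om}
    (hR : ∀ u, R u =ᵐ[M.vol] fun x => (M.rho x : ℂ) • u x)
    {S : Fin d → (Fin d → M.L2Om) →L[ℂ] M.L2Om}
    (hS : ∀ j G, S j G =ᵐ[M.vol] fun x =>
      (WithLp.toLp 2 fun i => M.stress x (fun k => G k x) i j : Vec d)) {t : ℝ}
    (ht : t ∈ Icc 0 T) : U.energy R S t = 0 := by
  have hcont : ContinuousOn (U.energy R S) (Icc 0 T) := fun t ht =>
    (U.hasDerivWithinAt_energy R S ht).continuousWithinAt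
  -- Right derivatives on `[0,T)` together with continuity are enough, so no information on the
  -- trace at `T` is required.
  have hder : ∀ t ∈ Ico 0 T, HasDerivWithinAt (U.energy R S) 0 (Ici t) t := by
    intro t ht
    have h1 := U.hasDerivWithinAt_energy R S ⟨ht.1, ht.2.le⟩
    rw [hk.deriv_energy_eq_zero hT hu0 h0 htr hR hS ht] at h1
    exact h1.mono_of_mem_nhdsWithin (mem_of_superset (Icc_mem_nhdsGE ht.2)
      (Icc_subset_Icc_left ht.1))
  rw [constant_of_has_deriv_right_zero hcont hder t ht, energy, hu0, U.intDu_zero]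
  simp

/-- The energy argument: a finite-energy solution with zero boundary and initial values is zero. -/
theorem HasTraction.eq_zero_of_zero_trace (hT : 0 < T) {U : EnergyField M.toSmoothDomain T}
    {k : M.L2lat T} (hk : U.HasTraction k) (hu0 : U.u 0 = 0) (h0 : U.ut 0 = 0)
    (htr : ∀ t ∈ Ioo 0 T, U.tr t = 0) {t : ℝ} (ht : t ∈ Icc 0 T) :
    U.u t = 0 ∧ ∀ w, M.energyForm (U.intDu t) w = 0 := by
  obtain ⟨R, hR⟩ := M.exists_densityOp
  obtain ⟨S, hS⟩ := M.exists_stressOp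
  have hre := congrArg Complex.re (hk.energy_eq_zero hT hu0 h0 htr hR hS ht)
  rw [energy, Complex.add_re, Complex.zero_re] at hre
  obtain ⟨a1, a2⟩ := ElasticMedium.inner_densityOp_self hR (U.u t)
  obtain ⟨b1, b2⟩ := ElasticMedium.inner_stressOp_self hS (U.intDu t)
  exact ⟨a2 (by linarith), b2 (by linarith)⟩

/-- Since `u` vanishes identically so does `uₜ`, and the stress of the integrated gradient
contributes nothing; the boundary term is all that remains of the integrated equation. -/
theorem HasTraction.integral_eq_zero (hT : 0 < T) {U : EnergyField M.toSmoothDomain T}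
    {k : M.L2lat T} (hk : U.HasTraction k) (hu0 : U.u 0 = 0) (h0 : U.ut 0 = 0)
    (htr : ∀ t ∈ Ioo 0 T, U.tr t = 0) {w : Pt d → Vec d} (hw : ContDiff ℝ ∞ w) {t : ℝ}
    (ht : t ∈ Icc 0 T) : ∫ s in (0 : ℝ)..t, ∫ x, dotc (k (s, x)) (w x) ∂M.surf = 0 := by
  rw [← hk.massForm_add_energyForm hT h0 hw ht,
    (hk.eq_zero_of_zero_trace hT hu0 h0 htr ht).2 w, add_zero]
  have hut : U.ut t = 0 := by
    have h1 : HasDerivWithinAt U.u 0 (Icc 0 T) t :=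
      (hasDerivWithinAt_const t (Icc 0 T) (0 : M.L2Om)).congr
        (fun s hs => (hk.eq_zero_of_zero_trace hT hu0 h0 htr hs).1)
        (hk.eq_zero_of_zero_trace hT hu0 h0 htr ht).1
    exact (uniqueDiffOn_Icc hT t ht).eq_deriv _ (U.deriv_u t ht) h1
  obtain ⟨L, hL⟩ := M.exists_massForm_clm hw
  rw [hut, ← hL, map_zero]

end EnergyField

end ElasticWave

/-! ### Vanishing traction and well-definedness of the traction map -/

namespace ElasticWave

variable {d : ℕ}

/-- The fundamental lemma of the calculus of variations on the lateral boundary. -/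
theorem SmoothDomain.ae_lat_eq_zero (D : SmoothDomain d) {T : ℝ} {F : ℝ × Pt d → ℂ}
    (hF : Integrable F (D.lat T))
    (h : ∀ t ∈ Icc 0 T, ∀ ψ : Pt d → ℝ, ContDiff ℝ ∞ ψ →
      ∫ s in (0 : ℝ)..t, ∫ x, F (s, x) * (ψ x : ℂ) ∂D.surf = 0) : F =ᵐ[D.lat T] 0 := by
  have hres : ∀ (t : ℝ) (B : Set (Pt d)), (D.lat T).restrict (Iio t ×ˢ B) =
      (volume.restrict (Ioo 0 (min T t))).prod (D.surf.restrict B) := by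
    intro t B
    rw [SmoothDomain.lat, ← Measure.prod_restrict, Measure.restrict_restrict measurableSet_Iio,
      inter_comm, Ioo_inter_Iio]
  -- After integrating in time first, the resulting function of `x` is orthogonal to all smooth `ψ`,
  -- hence zero almost everywhere on the boundary, whatever `B` is.
  have hslab : ∀ (t : ℝ) (B : Set (Pt d)), ∫ p in Iio t ×ˢ B, F p ∂D.lat T = 0 := by
    intro t B
    rw [hres]
    rcases le_or_gt (min T t) 0 with h0 | h0
    · rw [Ioo_eq_empty (not_lt.2 h0)]
      simp
    have hI : Integrable F ((volume.restrict (Ioo 0 (min T t))).prod (D.surf.restrict B)) := by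
      rw [← hres]
      exact hF.restrict
    have hI' : Integrable F ((volume.restrict (Ioo 0 (min T t))).prod D.surf) := by
      have := hF.restrict (s := Iio t ×ˢ univ)
      rwa [hres, Measure.restrict_univ] at this
    rw [integral_prod_symm _ hI]
    refine integral_eq_zero_of_ae (ae_restrict_of_ae ?_)
    refine ae_eq_zero_of_integral_contDiff_smul_eq_zero
      hI'.integral_prod_right.locallyIntegrable fun ψ hψ hc => ?_
    have hm : Integrable (fun p : ℝ × Pt d => F p * (ψ p.2 : ℂ))
        ((volume.restrict (Ioo 0 (min T t))).prod D.surf) := by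
      obtain ⟨C, hC⟩ := hc.exists_bound_of_continuous hψ.continuous
      refine hI'.mul_bdd (c := C) (Continuous.aestronglyMeasurable ?_) (Eventually.of_forall
        fun p => ?_)
      · exact Complex.continuous_ofReal.comp (hψ.continuous.comp continuous_snd)
      · simpa using hC p.2
    have h1 := h (min T t) ⟨h0.le, min_le_left _ _⟩ ψ hψ
    rw [intervalIntegral.integral_of_le h0.le, integral_Ioc_eq_integral_Ioo,
      integral_integral_swap hm] at h1
    rw [← h1]
    refine integral_congr_ae (Eventually.of_forall fun x => ?_)
    simp only [integral_mul_const, Complex.real_smul]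
    rw [mul_comm]
  refine hF.ae_eq_zero_of_forall_setIntegral_eq_zero fun S hS _ => ?_
  -- Products of half-lines and measurable sets form a π-system generating the product σ-algebra, so
  -- vanishing integrals over them extend to all measurable sets.
  have hgen : (inferInstance : MeasurableSpace (ℝ × Pt d)) = MeasurableSpace.generateFrom
      (image2 (· ×ˢ ·) (range (Iio : ℝ → Set ℝ)) {s : Set (Pt d) | MeasurableSet s}) := by
    refine (generateFrom_eq_prod ?_ MeasurableSpace.generateFrom_measurableSet ?_ ?_).symm
    · rw [← borel_eq_generateFrom_Iio]
      exact (BorelSpace.measurable_eq (α := ℝ)).symm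
    · exact ⟨fun n : ℕ => Iio (n : ℝ), fun n => ⟨n, rfl⟩, by
        rw [eq_univ_iff_forall]
        intro x
        obtain ⟨n, hn⟩ := exists_nat_gt x
        exact mem_iUnion.2 ⟨n, hn⟩⟩
    · exact isCountablySpanning_measurableSet
  have huniv : ∫ p, F p ∂D.lat T = 0 := by
    have h2 : (D.lat T).restrict (Iio T ×ˢ univ) = D.lat T := by
      rw [hres, min_self, Measure.restrict_univ]
      rfl
    rw [← h2]
    exact hslab T univ
  induction S, hS using MeasurableSpace.induction_on_inter hgen
    (isPiSystem_Iio.prod MeasurableSpace.isPiSystem_measurableSet) with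
  | empty => simp
  | basic S hS =>
    obtain ⟨_, ⟨t, rfl⟩, B, -, rfl⟩ := hS
    exact hslab t B
  | compl S hS ih =>
    rw [setIntegral_compl hS hF, huniv, ih (measure_lt_top _ _), sub_zero]
  | iUnion f hd hf ih =>
    rw [integral_iUnion hf hd hF.integrableOn]
    simp [fun n => ih n (measure_lt_top _ _)]

namespace EnergyField

variable {M : ElasticMedium d} {T : ℝ}

theorem HasTraction.eq_zero (hT : 0 < T) {U : EnergyField M.toSmoothDomain T}
    {k : M.L2lat T} (hk : U.HasTraction k) (hu0 : U.u 0 = 0) (h0 : U.ut 0 = 0)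
    (htr : ∀ t ∈ Ioo 0 T, U.tr t = 0) : k = 0 := by
  have hi : ∀ i : Fin d, (fun p => k p i) =ᵐ[M.lat T] 0 := by
    intro i
    have hki : Integrable (fun p => k p i) (M.lat T) :=
      ((EuclideanSpace.proj (𝕜 := ℂ) i).comp_memLp' (Lp.memLp k)).integrable (by norm_num)
    refine M.ae_lat_eq_zero hki fun t ht ψ hψ => ?_
    have hw : ContDiff ℝ ∞ fun x => (ψ x : ℂ) • (EuclideanSpace.single i 1 : Vec d) :=
      (Complex.ofRealCLM.contDiff.comp hψ).smul contDiff_const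
    have := hk.integral_eq_zero hT hu0 h0 htr hw ht
    simpa [dotc, Pi.single_apply] using this
  refine (Lp.eq_zero_iff_ae_eq_zero).2 ?_
  filter_upwards [ae_all_iff.2 hi] with p hp
  ext i
  exact hp i

/-- The traction of a finite-energy solution is determined by its boundary values. -/
theorem IsSolution.traction_eq_zero (hT : 0 < T) {U : EnergyField M.toSmoothDomain T}
    (hU : U.IsSolution 0) {k : M.L2lat T} (hk : U.HasTraction k) : k = 0 :=
  hk.eq_zero hT hU.2.1 hU.2.2.1 fun t ht => (Lp.eq_zero_iff_ae_eq_zero).2 (hU.2.2.2 t ht)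

end EnergyField

/-- A submodule is the graph of its associated partial map only when it is single-valued. Linearity
reduces this to the zero datum, where the energy argument applies. -/
theorem dnMap_apply (M : ElasticMedium d) {T : ℝ} (hT : 0 < T)
    {f : boundaryData M.toSmoothDomain T} {k : M.L2lat T} (h : (f, k) ∈ dnGraph M hT) :
    ∃ hf : f ∈ (dnMap M hT).domain, dnMap M hT ⟨f, hf⟩ = k := by
  have hg : ∀ x ∈ dnGraph M hT, x.1 = 0 → x.2 = 0 := by
    rintro ⟨g, l⟩ ⟨V, hV, hVl⟩ hg
    have hg' : g = 0 := hg
    subst hg'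
    exact hV.traction_eq_zero hT hVl
  have hgr : (dnMap M hT).graph = dnGraph M hT := Submodule.toLinearPMap_graph_eq _ hg
  rw [← hgr] at h
  obtain ⟨y, hy, hyk⟩ := (LinearPMap.mem_graph_iff _).1 h
  have hy' : (y : boundaryData M.toSmoothDomain T) = f := hy
  subst hy'
  exact ⟨y.2, hyk⟩

end ElasticWave

/-! ### Pairings on the lateral boundary and the identity -/

namespace ElasticWave

variable {d : ℕ} {M : ElasticMedium d} {T : ℝ}

theorem timeInt_const (g : Pt d → Vec d) (p : ℝ × Pt d) :
    timeInt T (fun p => g p.2) p = ((T - p.1 : ℝ) : ℂ) • g p.2 := by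
  simp [timeInt, ← Complex.coe_smul]

/-- The pairing of an element of `L²` of the lateral boundary with `𝓘` of a field that is constant
in time. -/
theorem pairL2_timeInt (hT : 0 < T) (k h : M.L2lat T) {g : Pt d → Vec d}
    (hh : h =ᵐ[M.lat T] timeInt T fun p => g p.2) :
    pairL2 (M.lat T) d k h =
      ∫ s in (0 : ℝ)..T, ((T - s : ℝ) : ℂ) * ∫ x, dotc (k (s, x)) (g x) ∂M.surf := by
  have he : (fun p => dotc (k p) (h p)) =ᵐ[M.lat T]
      fun p => ((T - p.1 : ℝ) : ℂ) * dotc (k p) (g p.2) := by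
    filter_upwards [hh] with p hp
    rw [hp, timeInt_const, dotc_smul_right]
  have hi := (integrable_dotc (Lp.memLp k) (Lp.memLp h)).congr he
  change ∫ p, dotc (k p) (h p) ∂M.lat T = _
  rw [integral_congr_ae he, M.integral_lat hT hi]
  simp only [integral_const_mul]

theorem pairL2_dataToL2 (f : boundaryData M.toSmoothDomain T) (h : M.L2lat T) :
    pairL2 (M.lat T) d (dataToL2 M.toSmoothDomain T f) h =
      ∫ p, dotc ((f : ℝ × Pt d → Vec d) p) (h p) ∂M.lat T := by
  refine integral_congr_ae ?_
  filter_upwards [(M.memLp_lat (boundaryData_continuousOn f.2)).coeFn_toLp] with p hp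
  exact congrArg (fun v => dotc v (h p)) hp

theorem pairL2_dataToL2_timeInt (hT : 0 < T) (f : boundaryData M.toSmoothDomain T)
    (h : M.L2lat T) {g : Pt d → Vec d} (hh : h =ᵐ[M.lat T] timeInt T fun p => g p.2) :
    pairL2 (M.lat T) d (dataToL2 M.toSmoothDomain T f) h =
      ∫ s in (0 : ℝ)..T, ((T - s : ℝ) : ℂ) *
        ∫ x, dotc ((f : ℝ × Pt d → Vec d) (s, x)) (g x) ∂M.surf := by
  have he : (fun p => dotc ((f : ℝ × Pt d → Vec d) p) (h p)) =ᵐ[M.lat T]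
      fun p => ((T - p.1 : ℝ) : ℂ) * dotc ((f : ℝ × Pt d → Vec d) p) (g p.2) := by
    filter_upwards [hh] with p hp
    rw [hp, timeInt_const, dotc_smul_right]
  have hi := (integrable_dotc (M.memLp_lat (boundaryData_continuousOn f.2)) (Lp.memLp h)).congr he
  rw [pairL2_dataToL2, integral_congr_ae he, M.integral_lat hT hi]
  simp only [integral_const_mul]

theorem intTrace0_ae (φ : smoothFields d) :
    intTrace0 M T φ =ᵐ[M.lat T] timeInt T fun p => (φ : Pt d → Vec d) p.2 :=
  MemLp.coeFn_toLp _

theorem intTrace1_ae (φ : smoothFields d) :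
    intTrace1 M T φ =ᵐ[M.lat T] timeInt T fun p => M.traction (φ : Pt d → Vec d) p.2 :=
  MemLp.coeFn_toLp _

theorem opK_apply (hT : 0 < T) (φ : smoothFields d) (f : (dnMap M hT).domain) :
    opK M hT φ f = pairL2 (M.lat T) d (dnMap M hT f) (intTrace0 M T φ) -
      pairL2 (M.lat T) d (dataToL2 M.toSmoothDomain T f) (intTrace1 M T φ) := rfl

end ElasticWave

theorem mainTheorem6 {d : ℕ} (hd : 3 ≤ d) (M : ElasticWave.ElasticMedium d)
    {T : ℝ} (hT : 0 < T)
    -- boundary data `f` and the solution `u_f`, with surface traction in `L²((0,T) × ∂Ω)`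
    (f : ElasticWave.boundaryData M.toSmoothDomain T)
    (U : ElasticWave.EnergyField M.toSmoothDomain T)
    (hU : U.IsSolution (f : ℝ × ElasticWave.Pt d → ElasticWave.Vec d))
    (hk : ∃ k : M.L2lat T, U.HasTraction k)
    (ι : ElasticWave.Vec d) (hι : ι ≠ 0) (ξ η : ElasticWave.Pt d) (hξη : ‖ξ‖ = ‖η‖)
    (hcgo : ElasticWave.CGOCondition M ι (ElasticWave.freq ξ η)) :
    ∃ hf : f ∈ (ElasticWave.dnMap M hT).domain,
      M.massForm (U.u T) (ElasticWave.expField ι (ElasticWave.freq ξ η) :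
          ElasticWave.Pt d → ElasticWave.Vec d)
        = ElasticWave.opK M hT (ElasticWave.expField ι (ElasticWave.freq ξ η)) ⟨f, hf⟩ := by
  obtain ⟨k, hk⟩ := hk
  obtain ⟨hf, hfk⟩ := ElasticWave.dnMap_apply M hT (f := f) (k := k) ⟨U, hU, hk⟩
  refine ⟨hf, ?_⟩
  have hφ := ElasticWave.smoothFields_contDiff
    (ElasticWave.expField ι (ElasticWave.freq ξ η))
  rw [ElasticWave.opK_apply, hfk, ElasticWave.pairL2_timeInt hT k _
      (ElasticWave.intTrace0_ae _),
    ElasticWave.pairL2_dataToL2_timeInt hT f _ (ElasticWave.intTrace1_ae _),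
    hk.massForm_u hT hU.2.1 hU.2.2.1 hφ]
  -- The terms with the traction already agree. What is left is Green's formula on each time slice,
  -- with the trace replaced by `f(s)`; this boundary condition is available for `0 < s < T`, hence
  -- the passage to the open interval.
  congr 1
  rw [intervalIntegral.integral_of_le hT.le, intervalIntegral.integral_of_le hT.le,
    integral_Ioc_eq_integral_Ioo, integral_Ioc_eq_integral_Ioo]
  refine setIntegral_congr_fun measurableSet_Ioo fun s hs => ?_
  have h1 := ElasticWave.ElasticMedium.energyForm_expField (M := M) (by omega) hcgo
    (p := (U.u s, U.Du s, U.tr s)) (U.mem_H1 s (Ioo_subset_Icc_self hs))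
  refine congrArg (((T - s : ℝ) : ℂ) * ·) (h1.trans (integral_congr_ae ?_))
  filter_upwards [hU.2.2.2 s hs] with x hx
  exact congrArg (ElasticWave.dotc · _) hx
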